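/- Let $\mathfrak n$ be a real two-step Lie algebra with a basis $Z_1,\dots,Z_{n-2d},Y_1,\dots,Y_d,X_1,\dots,X_d$ ($d\ge 1$) such that $Z_1,\dots,Z_{n-2d}$ span the center $\mathfrak z$ of $\mathfrak n$, $[Y_i,Y_j]=0=[X_i,X_j]$ for all $i,j$, and for some linear functional $\ell$ on $\mathfrak n$ the radical $\{W:\ell[W,V]=0\ \forall V\}$ equals $\mathfrak z$. Let $N$ be the connected, simply connected Lie group with Lie algebra $\mathfrak n$, in the coordinates $\exp(\sum z_jZ_j)\exp(\sum y_jY_j)\exp(\sum x_jX_j)$, with Haar measure $dz\,dy\,dx$, and let $L$ be its left regular representation, $(L(g)f)(h)=f(g^{-1}h)$. For $\lambda\in\mathbb R^{n-2d}=\mathfrak z^*$ (extended by $0$ on the $Y_j,X_j$) let $B(\lambda)=(-\lambda[X_i,Y_j])_{1\le i,j\le d}$, $\Sigma=\{\lambda:\det B(\lambda)\ne0\}$, $d\mu(\lambda)=|\det B(\lambda)|\,d\lambda$, and let $\pi_\lambda$ be the representation of $N$ on $L^2(\mathbb R^d)$ given by $$\pi_\lambda\Big(e^{\sum z_jZ_j}e^{\sum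 y_jY_j}e^{\sum x_jX_j}\Big)F(t)=e^{2\pi i\langle\lambda,z\rangle}e^{2\pi i\langle t,B(\lambda)y\rangle}F(t-x).$$ Let $\mathcal P:L^2(N)\to\int_\Sigma^\oplus L^2(\mathbb R^d)\otimes L^2(\mathbb R^d)\,d\mu(\lambda)$ be the Plancherel transform, that is, the continuous extension of $f\mapsto\big(\int_N f(g)\pi_\lambda(g)\,dg\big)_\lambda$ from $L^1(N)\cap L^2(N)$, the fibres being the Hilbert-Schmidt operators on $L^2(\mathbb R^d)$. Let $a\in(0,\infty)^{n-2d}$ and $q,b\in(0,\infty)^d$ satisfy $b_1\cdots b_d\,q_1\cdots q_d\,a_1\cdots a_{n-2d}=1$, and let $$\Gamma_{a,q,b}=\Big\{\prod_j\exp\big(\tfrac{m_j}{a_j}Z_j\big)\prod_j\exp\big(\tfrac{k_j}{q_j}Y_j\big)\prod_j\exp\big(\tfrac{n_j}{b_j}X_j\big): m_j,k_j,n_j\in\mathbb Z\Big\}.$$ Let $\mathbf I\subseteq\{\lambda\in\Sigma:0\le\lambda_i\le a_i\text{ for all }i\}$ be measurable, let $$\mathbf S=\Big\{\lambda\in\mathbf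 I:\frac{|\det B(\lambda)|}{b_1\cdots b_d\,q_1\cdots q_d}\le1\Big\},$$ let $(\mathbf u(\lambda))_{\lambda\in\mathbf S}$ be a measurable field of unit vectors in $L^2(\mathbb R^d)$ (for instance a constant one), and let $\mathcal H=\mathcal P^{-1}\big(\int_{\mathbf S}^\oplus L^2(\mathbb R^d)\otimes\mathbf u(\lambda)\,d\mu(\lambda)\big)$ be the corresponding multiplicity-free band-limited subspace of $L^2(N)$. Then there is $\phi\in\mathcal H$ such that: 1. $\phi$ is a continuous wavelet (admissible vector) for $L|_{\mathcal H}$: the map $\psi\mapsto\big(g\mapsto\langle\psi,L(g)\phi\rangle\big)$ is an isometry of $\mathcal H$ into $L^2(N)$; 2. the map $\psi\mapsto(\langle\psi,L(\gamma)\phi\rangle)_{\gamma\in\Gamma_{a,q,b}}$ is a linear isometric embedding of $\mathcal H$ into $\ell^2(\Gamma_{a,q,b})$; 3. if $\mu(\mathbf S)=1$, then $\{L(\gamma)\phi\}_{\gamma\in\Gamma_{a,q,b}}$ is an orthonormal basis of $\mathcal H$. -/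

import Mathlib

open MeasureTheory
open scoped ENNReal

noncomputable section

namespace BandLimited

/-- A real Lie algebra `𝔫` in the class under study, presented with a basis
`Z₁, …, Z_m, Y₁, …, Y_d, X₁, …, X_d` (so `dim 𝔫 = n = m + 2d`): `Z₁, …, Z_m` span the center,
`𝔫` is two-step, `𝔭 = span (Z, Y)` and `𝔪 = span X` are commutative, and for some (equivalently,
generic) linear functional `ℓ` the radical `𝔫(ℓ) = {W : ℓ [W, V] = 0 for all V}` is the center. -/
structure AdaptedBasis (𝔫 : Type*) [LieRing 𝔫] [LieAlgebra ℝ 𝔫] (m d : ℕ) where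
  basis : Module.Basis (Fin m ⊕ Fin d ⊕ Fin d) ℝ 𝔫
  center_eq : (LieAlgebra.center ℝ 𝔫).toSubmodule
    = Submodule.span ℝ (Set.range fun j : Fin m => basis (Sum.inl j))
  two_step : ∀ U V : 𝔫, ⁅U, V⁆ ∈ LieAlgebra.center ℝ 𝔫
  lie_Y_Y : ∀ i j : Fin d, ⁅basis (Sum.inr (Sum.inl i)), basis (Sum.inr (Sum.inl j))⁆ = 0
  lie_X_X : ∀ i j : Fin d, ⁅basis (Sum.inr (Sum.inr i)), basis (Sum.inr (Sum.inr j))⁆ = 0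
  radical_eq_center : ∃ ℓ : Module.Dual ℝ 𝔫,
    ∀ W : 𝔫, (∀ V : 𝔫, ℓ ⁅W, V⁆ = 0) ↔ W ∈ LieAlgebra.center ℝ 𝔫

variable {𝔫 : Type*} [LieRing 𝔫] [LieAlgebra ℝ 𝔫] {m d : ℕ}

namespace AdaptedBasis

variable (β : AdaptedBasis 𝔫 m d)

def Z (j : Fin m) : 𝔫 := β.basis (Sum.inl j)
def Y (j : Fin d) : 𝔫 := β.basis (Sum.inr (Sum.inl j))
def X (j : Fin d) : 𝔫 := β.basis (Sum.inr (Sum.inr j))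

/-- The linear functional `(lam₁, …, lam_m, 0, …, 0)` on `𝔫`, in the dual basis. -/
def functional (lam : Fin m → ℝ) : Module.Dual ℝ 𝔫 :=
  ∑ j, lam j • β.basis.coord (Sum.inl j)

/-- The matrix `B(lam)`, with entries `- lam [X_i, Y_j]`. -/
def B (lam : Fin m → ℝ) : Matrix (Fin d) (Fin d) ℝ :=
  Matrix.of fun i j => - β.functional lam ⁅β.X i, β.Y j⁆

/-- The cross-section `Σ` of the generic coadjoint orbits, inside `𝔷(𝔫)^* = ℝ^m`. -/
def crossSection : Set (Fin m → ℝ) := {lam | (β.B lam).det ≠ 0}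

/-- The Plancherel measure `dμ(lam) = |det B(lam)| dlam` (the complement of `Σ` is null). -/
def plancherelMeasure : Measure (Fin m → ℝ) :=
  volume.withDensity fun lam => ENNReal.ofReal |(β.B lam).det|

/-- The structure constants: `[X_i, Y_j] = ∑ k, structConst i j k • Z_k`. -/
def structConst (i j : Fin d) (k : Fin m) : ℝ :=
  β.basis.repr ⁅β.X i, β.Y j⁆ (Sum.inl k)

/-- The coordinates in the center of `[∑ x_i X_i, ∑ y_j Y_j]`. -/
def bracket (x y : Fin d → ℝ) : Fin m → ℝ :=
  fun k => ∑ i, ∑ j, x i * y j * β.structConst i j k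

/-- The simply connected Lie group `N` with Lie algebra `𝔫`, in the global coordinates
`(z, y, x) ↦ exp (∑ z_j Z_j) exp (∑ y_j Y_j) exp (∑ x_j X_j)`. See `log_mul` and
`log_bijective` below. -/
def N (_β : AdaptedBasis 𝔫 m d) : Type := (Fin m → ℝ) × (Fin d → ℝ) × (Fin d → ℝ)

end AdaptedBasis

open AdaptedBasis

namespace N

variable {β : AdaptedBasis 𝔫 m d}

/-- The group element `exp (∑ z_j Z_j) exp (∑ y_j Y_j) exp (∑ x_j X_j)`. -/
def mk (z : Fin m → ℝ) (y x : Fin d → ℝ) : β.N := (z, y, x)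

def zc (g : β.N) : Fin m → ℝ := g.1
def yc (g : β.N) : Fin d → ℝ := g.2.1
def xc (g : β.N) : Fin d → ℝ := g.2.2

@[ext] theorem ext {g h : β.N} (hz : zc g = zc h) (hy : yc g = yc h) (hx : xc g = xc h) : g = h :=
  Prod.ext hz (Prod.ext hy hx)

/-- Haar measure on `N`: Lebesgue measure `dz dy dx` in the coordinates. -/
instance : MeasureSpace β.N :=
  inferInstanceAs (MeasureSpace ((Fin m → ℝ) × (Fin d → ℝ) × (Fin d → ℝ)))

theorem bracket_add_left (x x' y : Fin d → ℝ) :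
    β.bracket (x + x') y = β.bracket x y + β.bracket x' y := by
  ext k; simp [bracket, add_mul, Finset.sum_add_distrib]

theorem bracket_add_right (x y y' : Fin d → ℝ) :
    β.bracket x (y + y') = β.bracket x y + β.bracket x y' := by
  ext k; simp [bracket, add_mul, mul_add, Finset.sum_add_distrib]

theorem bracket_neg_left (x y : Fin d → ℝ) : β.bracket (-x) y = - β.bracket x y := by
  ext k; simp [bracket]

theorem bracket_zero_left (y : Fin d → ℝ) : β.bracket 0 y = 0 := by
  ext k; simp [bracket]

theorem bracket_zero_right (x : Fin d → ℝ) : β.bracket x 0 = 0 := by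
  ext k; simp [bracket]

instance : Mul β.N :=
  ⟨fun g h => mk (zc g + zc h + β.bracket (xc g) (yc h)) (yc g + yc h) (xc g + xc h)⟩

instance : One β.N := ⟨mk 0 0 0⟩

instance : Inv β.N :=
  ⟨fun g => mk (- zc g + β.bracket (xc g) (yc g)) (- yc g) (- xc g)⟩

@[simp] theorem zc_mk (z : Fin m → ℝ) (y x : Fin d → ℝ) : zc (mk z y x : β.N) = z := rfl
@[simp] theorem yc_mk (z : Fin m → ℝ) (y x : Fin d → ℝ) : yc (mk z y x : β.N) = y := rfl
@[simp] theorem xc_mk (z : Fin m → ℝ) (y x : Fin d → ℝ) : xc (mk z y x : β.N) = x := rfl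
@[simp] theorem zc_mul (g h : β.N) : zc (g * h) = zc g + zc h + β.bracket (xc g) (yc h) := rfl
@[simp] theorem yc_mul (g h : β.N) : yc (g * h) = yc g + yc h := rfl
@[simp] theorem xc_mul (g h : β.N) : xc (g * h) = xc g + xc h := rfl
@[simp] theorem zc_one : zc (1 : β.N) = 0 := rfl
@[simp] theorem yc_one : yc (1 : β.N) = 0 := rfl
@[simp] theorem xc_one : xc (1 : β.N) = 0 := rfl
@[simp] theorem zc_inv (g : β.N) : zc g⁻¹ = - zc g + β.bracket (xc g) (yc g) := rfl
@[simp] theorem yc_inv (g : β.N) : yc g⁻¹ = - yc g := rfl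
@[simp] theorem xc_inv (g : β.N) : xc g⁻¹ = - xc g := rfl

instance : Group β.N :=
  Group.ofLeftAxioms
    (fun a b c => by
      apply ext
      · simp only [zc_mul, yc_mul, xc_mul, bracket_add_left, bracket_add_right]; abel
      · simp only [yc_mul]; abel
      · simp only [xc_mul]; abel)
    (fun a => by apply ext <;> simp [bracket_zero_left])
    (fun a => by apply ext <;> simp [bracket_neg_left])

/-- The logarithm `N → 𝔫`; by the Baker-Campbell-Hausdorff formula in a two-step algebra,
`log (exp z exp y exp x) = z + y + x + ½ [y, x]`. -/
def log (g : β.N) : 𝔫 :=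
  ∑ j, zc g j • β.Z j + ∑ j, yc g j • β.Y j + ∑ j, xc g j • β.X j
    + (1 / 2 : ℝ) • ⁅∑ j, yc g j • β.Y j, ∑ j, xc g j • β.X j⁆

theorem lie_sum_X_sum_Y (x y : Fin d → ℝ) :
    ⁅∑ i, x i • β.X i, ∑ j, y j • β.Y j⁆ = ∑ k, β.bracket x y k • β.Z k := by
  have key : ∀ i j, ⁅β.X i, β.Y j⁆ = ∑ k, β.structConst i j k • β.Z k := by
    intro i j
    have hmem : ⁅β.X i, β.Y j⁆ ∈ Submodule.span ℝ (Set.range fun k : Fin m => β.basis (Sum.inl k)) :=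
      β.center_eq ▸ β.two_step _ _
    obtain ⟨c, hc⟩ := (Submodule.mem_span_range_iff_exists_fun ℝ).1 hmem
    have hk : ∀ k, β.structConst i j k = c k := by
      intro k
      unfold structConst
      rw [← hc]
      simp [Finsupp.single_apply]
    simp only [hk, Z, hc]
  simp only [sum_lie, lie_sum, lie_smul, smul_lie, key, bracket,
    Finset.sum_smul, Finset.smul_sum, smul_smul]
  symm
  conv_rhs => rw [Finset.sum_comm]
  rw [Finset.sum_comm]
  refine Finset.sum_congr rfl fun i _ => ?_
  rw [Finset.sum_comm]
  refine Finset.sum_congr rfl fun j _ => Finset.sum_congr rfl fun k _ => ?_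
  congr 1
  ring

/-- The group law of `N` is the Baker-Campbell-Hausdorff product of the two-step algebra `𝔫`. -/
theorem log_mul (g h : β.N) :
    log (g * h) = log g + log h + (1 / 2 : ℝ) • ⁅log g, log h⁆ := by
  have hc : ∀ U V W : 𝔫, ⁅⁅U, V⁆, W⁆ = 0 := by
    intro U V W
    rw [← lie_skew, (LieModule.mem_maxTrivSubmodule ℝ 𝔫 𝔫 _).1 (β.two_step U V) W, neg_zero]
  have hc' : ∀ U V W : 𝔫, ⁅W, ⁅U, V⁆⁆ = 0 := fun U V W =>
    (LieModule.mem_maxTrivSubmodule ℝ 𝔫 𝔫 _).1 (β.two_step U V) W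
  have hZ : ∀ (z : Fin m → ℝ) (W : 𝔫), ⁅W, ∑ j, z j • β.Z j⁆ = 0 := by
    intro z W
    have : ∀ j, ⁅W, β.Z j⁆ = 0 := fun j =>
      (LieModule.mem_maxTrivSubmodule ℝ 𝔫 𝔫 _).1
        (show β.Z j ∈ (LieAlgebra.center ℝ 𝔫).toSubmodule from
          β.center_eq ▸ Submodule.subset_span ⟨j, rfl⟩) W
    simp [lie_sum, this]
  have hZ' : ∀ (z : Fin m → ℝ) (W : 𝔫), ⁅∑ j, z j • β.Z j, W⁆ = 0 := fun z W => by
    rw [← lie_skew, hZ, neg_zero]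
  have hY : ∀ y y' : Fin d → ℝ, ⁅∑ j, y j • β.Y j, ∑ j, y' j • β.Y j⁆ = 0 := by
    intro y y'
    simp [lie_sum, sum_lie, Y, β.lie_Y_Y]
  have hX : ∀ y y' : Fin d → ℝ, ⁅∑ j, y j • β.X j, ∑ j, y' j • β.X j⁆ = 0 := by
    intro y y'
    simp [lie_sum, sum_lie, X, β.lie_X_X]
  unfold log
  simp only [zc_mul, yc_mul, xc_mul, Pi.add_apply, add_smul, Finset.sum_add_distrib]
  rw [← lie_sum_X_sum_Y]
  simp only [lie_add, add_lie, hZ, hZ', hX, hY, lie_smul, smul_lie, hc, hc', smul_zero, add_zero,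
    zero_add]
  rw [← lie_skew (∑ j, yc h j • β.Y j) (∑ j, xc g j • β.X j)]
  module

theorem log_bijective : Function.Bijective (log : β.N → 𝔫) := by
  have hlog : ∀ g : β.N, log g = β.basis.equivFun.symm
      (Sum.elim (zc g - (1 / 2 : ℝ) • β.bracket (xc g) (yc g)) (Sum.elim (yc g) (xc g))) := by
    intro g
    unfold log
    rw [← lie_skew, lie_sum_X_sum_Y, Module.Basis.equivFun_symm_apply]
    simp only [Fintype.sum_sum_type, Sum.elim_inl, Sum.elim_inr, Pi.sub_apply, Pi.smul_apply,
      sub_smul, Finset.sum_sub_distrib, smul_assoc, ← Finset.smul_sum, Z, Y, X]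
    module
  constructor
  · intro g h hgh
    rw [hlog, hlog] at hgh
    have h1 := β.basis.equivFun.symm.injective hgh
    have hy : yc g = yc h := funext fun j => congrFun h1 (Sum.inr (Sum.inl j))
    have hx : xc g = xc h := funext fun j => congrFun h1 (Sum.inr (Sum.inr j))
    have hz : zc g = zc h := funext fun j => by
      have := congrFun h1 (Sum.inl j)
      simpa [hx, hy] using this
    exact ext hz hy hx
  · intro V
    obtain ⟨w, rfl⟩ := β.basis.equivFun.symm.surjective V
    refine ⟨mk ((fun j => w (Sum.inl j)) + (1 / 2 : ℝ) • β.bracket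
      (fun j => w (Sum.inr (Sum.inr j))) (fun j => w (Sum.inr (Sum.inl j))))
      (fun j => w (Sum.inr (Sum.inl j))) (fun j => w (Sum.inr (Sum.inr j))), ?_⟩
    rw [hlog]
    congr 1
    ext j
    rcases j with j | j | j <;> simp

theorem measurePreserving_mul_left (g : β.N) : MeasurePreserving (fun h : β.N => g * h) := by
  have h1 : MeasurePreserving (fun p : (Fin d → ℝ) × (Fin d → ℝ) => (yc g + p.1, xc g + p.2))
      (volume.prod volume) (volume.prod volume) :=
    (measurePreserving_add_left volume (yc g)).prod (measurePreserving_add_left volume (xc g))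
  have hcont : Continuous fun y : Fin d → ℝ => β.bracket (xc g) y := by
    unfold bracket; fun_prop
  have h2 : MeasurePreserving
      (fun p : ((Fin d → ℝ) × (Fin d → ℝ)) × (Fin m → ℝ) =>
        ((yc g + p.1.1, xc g + p.1.2), (zc g + β.bracket (xc g) p.1.1) + p.2))
      ((volume.prod volume).prod volume) ((volume.prod volume).prod volume) := by
    refine h1.skew_product
      (g := fun (p : (Fin d → ℝ) × (Fin d → ℝ)) (z : Fin m → ℝ) =>
        (zc g + β.bracket (xc g) p.1) + z) ?_ ?_
    · apply Continuous.measurable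
      have := hcont
      simp only [Function.uncurry_def]
      fun_prop
    · exact Filter.Eventually.of_forall fun p => (measurePreserving_add_left volume _).map_eq
  have h3 := (Measure.measurePreserving_swap.comp h2).comp
    (Measure.measurePreserving_swap (μ := (volume : Measure (Fin m → ℝ)))
      (ν := (volume : Measure (Fin d → ℝ)).prod (volume : Measure (Fin d → ℝ))))
  have h4 : (fun h : β.N => g * h) =
      ((Prod.swap ∘ fun p : ((Fin d → ℝ) × (Fin d → ℝ)) × (Fin m → ℝ) =>
        ((yc g + p.1.1, xc g + p.1.2), (zc g + β.bracket (xc g) p.1.1) + p.2)) ∘ Prod.swap) := by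
    funext h
    apply ext
    · change zc g + zc h + β.bracket (xc g) (yc h) = zc g + β.bracket (xc g) (yc h) + zc h
      abel
    · rfl
    · rfl
  rw [h4]
  exact h3

end N

/-- `L²(ℝ^d)`. -/
abbrev L2R (d : ℕ) : Type := Lp ℂ 2 (volume : Measure (Fin d → ℝ))

namespace AdaptedBasis

variable (β : AdaptedBasis 𝔫 m d)

/-- `L²(N)`. -/
abbrev L2N : Type := Lp ℂ 2 (volume : Measure β.N)

/-- The left regular representation, `(L(g) f)(h) = f(g⁻¹ h)`. -/
def leftReg (g : β.N) : β.L2N →ₗᵢ[ℂ] β.L2N :=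
  Lp.compMeasurePreservingₗᵢ ℂ (fun h => g⁻¹ * h) (N.measurePreserving_mul_left g⁻¹)

/-- The phase `exp (2πi (⟨lam, z⟩ + ⟨t, B(lam) y⟩))`. -/
def phase (lam : Fin m → ℝ) (g : β.N) (t : Fin d → ℝ) : ℂ :=
  Complex.exp (2 * Real.pi * Complex.I *
    ((lam ⬝ᵥ N.zc g + t ⬝ᵥ (β.B lam).mulVec (N.yc g) : ℝ) : ℂ))

theorem memLp_rep (lam : Fin m → ℝ) (g : β.N) (v : L2R d) :
    MemLp (fun t => β.phase lam g t * v (t - N.xc g)) 2 volume := by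
  have h1 : MemLp (fun t => v (t - N.xc g)) 2 volume :=
    (Lp.memLp v).comp_measurePreserving (measurePreserving_sub_right volume (N.xc g))
  have h2 : Continuous (β.phase lam g) := by
    unfold phase Matrix.mulVec dotProduct; fun_prop
  refine h1.of_le (h2.aestronglyMeasurable.mul h1.aestronglyMeasurable) ?_
  refine Filter.Eventually.of_forall fun t => ?_
  have h3 : ‖β.phase lam g t‖ = 1 := by
    unfold phase
    rw [show ∀ r : ℝ, 2 * Real.pi * Complex.I * (r : ℂ) = ((2 * Real.pi * r : ℝ) : ℂ) * Complex.I
      from fun r => by push_cast; ring]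
    exact Complex.norm_exp_ofReal_mul_I _
  simp [h3]

/-- The irreducible representation `π_lam` induced from the character
`exp W ↦ exp (2πi lam(W))` of `exp 𝔭`, realized on `L²(ℝ^d)`: the center acts by the character,
the `Y`-directions by modulations and the `X`-directions by translations. -/
def rep (lam : Fin m → ℝ) (g : β.N) (v : L2R d) : L2R d :=
  (β.memLp_rep lam g v).toLp

/-- The operator-valued Fourier transform `F(f)(lam) = ∫_N f(g) π_lam(g) dg`. -/
def fourier (f : β.N → ℂ) (lam : Fin m → ℝ) (v : L2R d) : L2R d :=
  ∫ g : β.N, f g • β.rep lam g v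

/-- The direct integral `∫_Σ^⊕ L²(ℝ^d) ⊗ L²(ℝ^d) dμ(lam)`; the fibre is the space of
Hilbert-Schmidt operators on `L²(ℝ^d)`, given by their kernels in `L²(ℝ^d × ℝ^d)`. -/
abbrev HSField : Type :=
  Lp ℂ 2 (β.plancherelMeasure.prod (volume : Measure ((Fin d → ℝ) × (Fin d → ℝ))))

/-- The operator `T` on `L²(ℝ^d)` is the integral operator with kernel `k`. -/
def HasKernel (T : L2R d → L2R d) (k : (Fin d → ℝ) × (Fin d → ℝ) → ℂ) : Prop :=
  ∀ v : L2R d, (T v : (Fin d → ℝ) → ℂ) =ᵐ[volume] fun t => ∫ s, k (t, s) * v s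

/-- `K` is the Plancherel transform of `f`. The Plancherel transform is the continuous extension
to `L²(N)` of the Fourier transform on `L¹(N) ∩ L²(N)`: its graph is the closure of the graph of
the latter. -/
def IsPlancherelTransform (f : β.L2N) (K : β.HSField) : Prop :=
  (f, K) ∈ closure {p : β.L2N × β.HSField | Integrable (p.1 : β.N → ℂ) ∧
    ∀ᵐ lam ∂β.plancherelMeasure, HasKernel (β.fourier p.1 lam) fun ts => p.2 (lam, ts)}

/-- `K` lies in `∫_S^⊕ L²(ℝ^d) ⊗ u(lam) dμ(lam)`. The operator `w ⊗ u` has the kernel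
`(t, s) ↦ w(t) * conj (u(s))`. -/
def MemMultiplicityFree (S : Set (Fin m → ℝ)) (u : (Fin m → ℝ) → L2R d) (K : β.HSField) : Prop :=
  ∀ᵐ lam ∂β.plancherelMeasure,
    (lam ∈ S → ∃ w : L2R d, (fun ts => K (lam, ts)) =ᵐ[volume]
      fun ts : (Fin d → ℝ) × (Fin d → ℝ) => w ts.1 * (starRingEnd ℂ) (u lam ts.2)) ∧
    (lam ∉ S → (fun ts => K (lam, ts)) =ᵐ[volume] 0)

/-- `φ ∈ H` is admissible (a continuous wavelet) for the restriction of `L` to `H`: the map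
`ψ ↦ (g ↦ ⟨ψ, L(g) φ⟩)` is an isometry of `H` into `L²(N)`. -/
def IsContinuousWavelet (H : Submodule ℂ β.L2N) (φ : β.L2N) : Prop :=
  φ ∈ H ∧ ∃ W : H →ₗᵢ[ℂ] β.L2N, ∀ ψ : H,
    (W ψ : β.N → ℂ) =ᵐ[volume] fun g => inner ℂ (β.leftReg g φ) (ψ : β.L2N)

/-- The quasi-lattice `Γ_{a,q,b}` of the elements
`∏ exp ((k_j / a_j) Z_j) ∏ exp ((l_j / q_j) Y_j) ∏ exp ((p_j / b_j) X_j)` with integers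
`k_j, l_j, p_j`. -/
def quasiLattice (a : Fin m → ℝ) (q b : Fin d → ℝ) : Set β.N :=
  {g | ∃ (k : Fin m → ℤ) (l p : Fin d → ℤ),
    g = N.mk (fun j => k j / a j) (fun j => l j / q j) (fun j => p j / b j)}

end AdaptedBasis

end BandLimited

end

open BandLimited

namespace BandLimited

open Filter Topology
open scoped Pointwise Matrix

/-! ### Square norms as integrals, and measurability of maps into L² -/

section SquareIntegrable

variable {α T E : Type*} [MeasurableSpace α] [MeasurableSpace T] [NormedAddCommGroup E]

/-! In the coordinates (z, y, x), the kernel of π_λ(f) at (t, s) is the Fourier transform of f in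
(z, y), taken at x = t - s and at the frequency (λ, B(λ)ᵀ t). The substitution η = B(λ)ᵀ t has
Jacobian |det B(λ)|, which is the Plancherel density. Hence the Plancherel transform is a Euclidean
Fourier transform between two measure preserving changes of coordinates. This is `plancherel`, and
`isPlancherelTransform_iff` identifies it with the transform defined as a closure. It carries L(g)
to multiplication by the phase and translation in t (`plancherel_leftReg`). The second tensor factor
is untouched, so V ↦ V ⊗ u identifies H with L²(S × ℝ^d).

Let φ correspond to a field of unit vectors v(λ, ·). By `inner_leftReg_bandLimited`, the coefficient
of V at g = (z, y, x) is, up to conjugation, the Fourier transform at (z, y) of conj V(λ, t) · v(λ,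
t - x), viewed as a function of (λ, η). Plancherel in (z, y) and then integration in x give ‖V‖²,
because v has unit fibres: this is admissibility. On the quasi-lattice, Plancherel is replaced by
Parseval for Fourier series with periods a and q, valid when the supports pack under the period
lattice. Integration in x is replaced by a sum over p/b, computed from Σ_p |v(λ, t - p/b)|² = ∏ b.
The constants multiply to ∏ a ∏ q ∏ b = 1.

It remains to find v. Take v(λ, ·) = √(∏ b) · 1 on a set E_λ that tiles under ∏ (1/b_i) ℤ and packs
under (B(λ)ᵀ)⁻¹ ∏ q_i ℤ; packing in λ comes from the box 0 ≤ λ_i ≤ a_i. The inequality defining S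
says exactly that the first lattice has the smaller covolume. In `exists_measurable_tile`, a greedy
construction, run for all λ at once, gives a measurable set packing under both lattices to which
nothing can be added. A density comparison (`isAddFundamentalDomain_of_maximal_packing`) shows that
such a set covers almost everything under the lattice of smaller covolume.

Finally ‖φ‖² = μ(S). If μ(S) = 1, the Parseval frame consists of unit vectors and is therefore an
orthonormal basis. -/

instance fact_two_ne_top : Fact ((2 : ℝ≥0∞) ≠ ∞) := ⟨ENNReal.ofNat_ne_top⟩

theorem eLpNorm_two_sq (μ : Measure α) (f : α → E) :
    eLpNorm f 2 μ ^ 2 = ∫⁻ x, ‖f x‖ₑ ^ 2 ∂μ := by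
  have h := eLpNorm_nnreal_pow_eq_lintegral (f := f) (μ := μ) (p := 2) two_ne_zero
  have h2 : ((2 : NNReal) : ℝ) = ((2 : ℕ) : ℝ) := by norm_num
  simp only [h2, ENNReal.rpow_natCast] at h
  exact h

theorem lintegral_enorm_sq_eq {μ : Measure α} (f : Lp E 2 μ) :
    ∫⁻ x, ‖f x‖ₑ ^ 2 ∂μ = ‖f‖ₑ ^ 2 := by
  rw [← eLpNorm_two_sq, Lp.enorm_def]

theorem memLp_two_iff {μ : Measure α} {f : α → E} (hf : AEStronglyMeasurable f μ) :
    MemLp f 2 μ ↔ ∫⁻ x, ‖f x‖ₑ ^ 2 ∂μ < ∞ := by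
  rw [← eLpNorm_two_sq, MemLp]
  simp [hf, ENNReal.pow_lt_top_iff]

theorem enorm_sq_toLp {μ : Measure α} {f : α → E} (hf : MemLp f 2 μ) :
    ‖hf.toLp‖ₑ ^ 2 = ∫⁻ x, ‖f x‖ₑ ^ 2 ∂μ := by
  rw [Lp.enorm_toLp, eLpNorm_two_sq]

theorem norm_eq_of_enorm_sq_eq {F : Type*} [NormedAddCommGroup F] {x : E} {y : F}
    (h : ‖x‖ₑ ^ 2 = ‖y‖ₑ ^ 2) : ‖x‖ = ‖y‖ := by
  have h' : ‖x‖ₑ = ‖y‖ₑ := (ENNReal.pow_right_strictMono two_ne_zero).injective h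
  simpa [← toReal_enorm] using congrArg ENNReal.toReal h'

/-- An open set is a countable union of balls with rational radii and centres in a countable dense
set, so its preimage is controlled by the distance functions. -/
theorem stronglyMeasurable_of_measurable_dist {F : Type*} [PseudoMetricSpace F]
    [SecondCountableTopology F] {f : α → F} (h : ∀ y, Measurable fun a => dist (f a) y) :
    StronglyMeasurable f := by
  borelize F
  refine Measurable.stronglyMeasurable ?_
  refine measurable_of_isOpen fun U hU => ?_
  obtain ⟨D, hDc, hD⟩ := TopologicalSpace.exists_countable_dense F
  have : f ⁻¹' U = ⋃ y ∈ D, ⋃ q : {q : ℚ // Metric.ball y (q : ℝ) ⊆ U},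
      {a | dist (f a) y < (q : ℚ)} := by
    ext a
    simp only [Set.mem_preimage, Set.mem_iUnion, Set.mem_ofPred_eq]
    constructor
    · intro ha
      obtain ⟨ε, hε, hball⟩ := Metric.isOpen_iff.1 hU _ ha
      obtain ⟨y, hyD, hy⟩ := hD.exists_dist_lt (f a) (half_pos hε)
      obtain ⟨q, hq1, hq2⟩ := exists_rat_btwn hy
      refine ⟨y, hyD, ⟨q, fun z hz => hball ?_⟩, hq1⟩
      rw [Metric.mem_ball] at hz ⊢
      calc dist z (f a) ≤ dist z y + dist (f a) y := dist_triangle_right _ _ _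
        _ < ε / 2 + ε / 2 := add_lt_add (hz.trans hq2) hy
        _ = ε := add_halves ε
    · rintro ⟨y, -, ⟨q, hq⟩, ha⟩
      exact hq ha
  rw [this]
  refine MeasurableSet.biUnion hDc fun y _ => MeasurableSet.iUnion fun q => ?_
  exact measurableSet_lt (h y) measurable_const

/-- The distance to a fixed element of L² is a power of a parametric integral, hence measurable.
This makes orbit maps such as g ↦ π_λ(g) v Bochner measurable. -/
theorem stronglyMeasurable_toLp [MeasurableSpace.CountablyGenerated T] {ν : Measure T}
    [SFinite ν] {F : α × T → ℂ} (hF : StronglyMeasurable F)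
    (h : ∀ a, MemLp (fun t => F (a, t)) 2 ν) : StronglyMeasurable fun a => (h a).toLp := by
  refine stronglyMeasurable_of_measurable_dist fun g => ?_
  have key : ∀ a, dist (h a).toLp g = ((∫⁻ t, ‖F (a, t) - g t‖ₑ ^ 2 ∂ν) ^ (1 / 2 : ℝ)).toReal := by
    intro a
    rw [← eLpNorm_two_sq, dist_edist]
    congr 1
    rw [← ENNReal.rpow_natCast, ← ENNReal.rpow_mul, Lp.edist_def]
    norm_num
    refine eLpNorm_congr_ae ?_
    filter_upwards [(h a).coeFn_toLp] with t ht
    simp [ht]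
  simp_rw [key]
  refine (Measurable.pow_const ?_ _).ennreal_toReal
  refine Measurable.lintegral_prod_right' (f := fun p : α × T => ‖F p - g p.2‖ₑ ^ 2) ?_
  exact ((hF.sub ((Lp.stronglyMeasurable g).comp_measurable measurable_snd)).enorm).pow_const 2

/-- Each f a is approximated by terms of a fixed dense sequence, at a geometric rate that forces
pointwise convergence almost everywhere. The approximants are jointly measurable because only
countably many functions occur. The conclusion holds for every a, not just almost every a. -/
theorem exists_joint_representative [MeasurableSpace.CountablyGenerated T] {ν : Measure T}
    [SFinite ν] {f : α → Lp ℂ 2 ν} (hf : StronglyMeasurable f) :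
    ∃ U : α × T → ℂ, StronglyMeasurable U ∧ ∀ a, (fun t => U (a, t)) =ᵐ[ν] f a := by
  classical
  set D : ℕ → Lp ℂ 2 ν := TopologicalSpace.denseSeq (Lp ℂ 2 ν) with hD
  -- The shift by 2 pays for the triangle inequality: two errors below (1/2)^K / 4 add up to less
  -- than (1/2)^K.
  have hpos : ∀ n : ℕ, (0 : ℝ) < (1 / 2) ^ (n + 2) := fun n => by positivity
  have hex : ∀ n a, ∃ j, dist (f a) (D j) < (1 / 2) ^ (n + 2) := fun n a =>
    (TopologicalSpace.denseRange_denseSeq (Lp ℂ 2 ν)).exists_dist_lt (f a) (hpos n)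
  -- Choosing the least admissible index makes the choice measurable in a.
  set N : ℕ → α → ℕ := fun n a => Nat.find (hex n a) with hN
  have hNs : ∀ n a, dist (f a) (D (N n a)) < (1 / 2) ^ (n + 2) := fun n a => Nat.find_spec (hex n a)
  have hNm : ∀ n, Measurable (N n) := fun n => by
    refine measurable_find (hex n) fun k => ?_
    exact measurableSet_lt (hf.dist stronglyMeasurable_const).measurable measurable_const
  set G : ℕ → α × T → ℂ := fun n p => D (N n p.1) p.2 with hG
  have hGm : ∀ n, StronglyMeasurable (G n) := fun n => by
    have h1 : Measurable fun q : ℕ × T => D q.1 q.2 :=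
      measurable_from_prod_countable_right fun j => (Lp.stronglyMeasurable (D j)).measurable
    exact (h1.comp (((hNm n).comp measurable_fst).prodMk measurable_snd)).stronglyMeasurable
  refine ⟨fun p => limUnder atTop fun n => G n p, StronglyMeasurable.limUnder hGm, fun a => ?_⟩
  have hconv : Tendsto (fun n => D (N n a)) atTop (𝓝 (f a)) := by
    rw [tendsto_iff_dist_tendsto_zero]
    refine squeeze_zero (fun _ => dist_nonneg) (fun n => (dist_comm _ _).trans_le (hNs n a).le) ?_
    exact (tendsto_pow_atTop_nhds_zero_of_lt_one (by norm_num) (by norm_num)).comp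
      (tendsto_add_atTop_nat 2)
  -- A subsequence identifies the limit as f a. Summability of the errors makes the whole sequence
  -- converge, which is what `limUnder` needs.
  obtain ⟨ns, hns, hlim⟩ := (tendstoInMeasure_of_tendsto_Lp hconv).exists_seq_tendsto_ae
  have hcau : ∀ᵐ t ∂ν, ∃ l : ℂ, Tendsto (fun n => (D (N n a)) t) atTop (𝓝 l) := by
    refine Lp.ae_tendsto_of_cauchy_eLpNorm (p := 2) (fun n => Lp.aestronglyMeasurable _) (by norm_num)
      (B := fun n => ENNReal.ofReal ((1 / 2) ^ n)) ?_ ?_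
    · exact (summable_geometric_of_lt_one (by norm_num) (by norm_num)).tsum_ofReal_ne_top
    · intro K n k hn hk
      have h1 : eLpNorm (⇑(D (N n a)) - ⇑(D (N k a))) 2 ν = edist (D (N n a)) (D (N k a)) :=
        (Lp.edist_def _ _).symm
      rw [h1, edist_dist]
      refine (ENNReal.ofReal_lt_ofReal_iff (by positivity)).2 ?_
      have hm : ∀ j, K ≤ j → ((1 : ℝ) / 2) ^ (j + 2) ≤ (1 / 2) ^ K / 4 := fun j hj => by
        rw [pow_add]
        have := pow_le_pow_of_le_one (by norm_num : (0 : ℝ) ≤ 1 / 2) (by norm_num) hj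
        linarith
      have h0 : (0 : ℝ) < (1 / 2) ^ K := by positivity
      calc dist (D (N n a)) (D (N k a)) ≤ dist (f a) (D (N n a)) + dist (f a) (D (N k a)) :=
            dist_triangle_left _ _ _
        _ < (1 / 2) ^ K := by
            linarith [hNs n a, hNs k a, hm n hn, hm k hk]
  filter_upwards [hlim, hcau] with t ht ⟨l, hl⟩
  have : l = f a t := tendsto_nhds_unique (hl.comp hns.tendsto_atTop) ht
  exact (hl.limUnder_eq).trans this

end SquareIntegrable

/-! ### The identification of L²(μ; L²(ν)) with L²(μ ⊗ ν), and pointwise values of Bochner integrals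
-/

section Uncurry

variable {α T T' : Type*} [MeasurableSpace α] [MeasurableSpace T] [MeasurableSpace T']

/-- Fubini for null sets needs a measurable set of equality, so both functions are first replaced by
strongly measurable versions. -/
theorem ae_eq_prod_of_ae_ae {E : Type*} [TopologicalSpace E] [TopologicalSpace.MetrizableSpace E]
    {μ : Measure α} {ν : Measure T} [SFinite ν] {F G : α × T → E}
    (hF : AEStronglyMeasurable F (μ.prod ν)) (hG : AEStronglyMeasurable G (μ.prod ν))
    (h : ∀ᵐ a ∂μ, (fun t => F (a, t)) =ᵐ[ν] fun t => G (a, t)) : F =ᵐ[μ.prod ν] G := by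
  have h1 := Measure.ae_ae_of_ae_prod hF.ae_eq_mk
  have h2 := Measure.ae_ae_of_ae_prod hG.ae_eq_mk
  have h3 : hF.mk F =ᵐ[μ.prod ν] hG.mk G := by
    refine (Measure.ae_prod_iff_ae_ae ?_).2 ?_
    · exact hF.stronglyMeasurable_mk.measurableSet_eq_fun hG.stronglyMeasurable_mk
    · filter_upwards [h, h1, h2] with a ha ha1 ha2
      filter_upwards [ha, ha1, ha2] with t ht ht1 ht2
      rw [← ht1, ← ht2, ht]
  exact hF.ae_eq_mk.trans (h3.trans hG.ae_eq_mk.symm)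

variable [MeasurableSpace.CountablyGenerated T] [MeasurableSpace.CountablyGenerated T']
  {μ : Measure α} {ν : Measure T} [SFinite ν] {ν' : Measure T'} [SFinite ν']

omit [MeasurableSpace.CountablyGenerated T] in
theorem lintegral_prod_enorm_sq {U : α × T → ℂ} (hU : StronglyMeasurable U) {f : α → Lp ℂ 2 ν}
    (h : ∀ᵐ a ∂μ, (fun t => U (a, t)) =ᵐ[ν] f a) :
    ∫⁻ p, ‖U p‖ₑ ^ 2 ∂(μ.prod ν) = ∫⁻ a, ‖f a‖ₑ ^ 2 ∂μ := by
  rw [lintegral_prod _ (hU.enorm.pow_const 2).aemeasurable]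
  refine lintegral_congr_ae ?_
  filter_upwards [h] with a ha
  rw [← lintegral_enorm_sq_eq]
  refine lintegral_congr_ae ?_
  filter_upwards [ha] with t ht
  rw [ht]

/-- A jointly measurable representative of an element of `L²(μ; L²(ν))`. -/
noncomputable def jointRep (g : Lp (Lp ℂ 2 ν) 2 μ) : α × T → ℂ :=
  (exists_joint_representative (Lp.stronglyMeasurable g)).choose

theorem stronglyMeasurable_jointRep (g : Lp (Lp ℂ 2 ν) 2 μ) : StronglyMeasurable (jointRep g) :=
  (exists_joint_representative (Lp.stronglyMeasurable g)).choose_spec.1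

theorem jointRep_ae (g : Lp (Lp ℂ 2 ν) 2 μ) (a : α) : (fun t => jointRep g (a, t)) =ᵐ[ν] g a :=
  (exists_joint_representative (Lp.stronglyMeasurable g)).choose_spec.2 a

theorem lintegral_jointRep (g : Lp (Lp ℂ 2 ν) 2 μ) :
    ∫⁻ p, ‖jointRep g p‖ₑ ^ 2 ∂(μ.prod ν) = ‖g‖ₑ ^ 2 := by
  rw [lintegral_prod_enorm_sq (stronglyMeasurable_jointRep g)
    (Eventually.of_forall (jointRep_ae g)), lintegral_enorm_sq_eq]

theorem memLp_jointRep (g : Lp (Lp ℂ 2 ν) 2 μ) : MemLp (jointRep g) 2 (μ.prod ν) := by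
  rw [memLp_two_iff (stronglyMeasurable_jointRep g).aestronglyMeasurable, lintegral_jointRep]
  simp [ENNReal.pow_lt_top_iff]

omit [MeasurableSpace.CountablyGenerated T] in
theorem ae_of_toLp_eq {F : α × T → ℂ} (hF : MemLp F 2 (μ.prod ν)) :
    ∀ᵐ a ∂μ, (fun t => (hF.toLp : α × T → ℂ) (a, t)) =ᵐ[ν] fun t => F (a, t) :=
  Measure.ae_ae_of_ae_prod hF.coeFn_toLp

/-- The isometry `L²(μ; L²(ν)) → L²(μ ⊗ ν)`. -/
noncomputable def uncurryₗᵢ : Lp (Lp ℂ 2 ν) 2 μ →ₗᵢ[ℂ] Lp ℂ 2 (μ.prod ν) where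
  toFun g := (memLp_jointRep g).toLp
  map_add' g h := by
    rw [← MemLp.toLp_add]
    refine MemLp.toLp_congr _ _ (ae_eq_prod_of_ae_ae
      (stronglyMeasurable_jointRep _).aestronglyMeasurable
      ((stronglyMeasurable_jointRep _).add (stronglyMeasurable_jointRep _)).aestronglyMeasurable ?_)
    filter_upwards [Lp.coeFn_add g h] with a ha
    have h1 := jointRep_ae (g + h) a
    rw [ha] at h1
    filter_upwards [h1, jointRep_ae g a, jointRep_ae h a, Lp.coeFn_add (g a) (h a)]
      with t h1 h2 h3 h4
    simp only [Pi.add_apply] at h1 h4 ⊢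
    rw [h1, h2, h3, h4]
  map_smul' c g := by
    rw [RingHom.id_apply, ← MemLp.toLp_const_smul]
    refine MemLp.toLp_congr _ _ (ae_eq_prod_of_ae_ae
      (stronglyMeasurable_jointRep _).aestronglyMeasurable
      ((stronglyMeasurable_jointRep _).const_smul c).aestronglyMeasurable ?_)
    filter_upwards [Lp.coeFn_smul c g] with a ha
    have h1 := jointRep_ae (c • g) a
    rw [ha] at h1
    filter_upwards [h1, jointRep_ae g a, Lp.coeFn_smul c (g a)] with t h1 h2 h4
    simp only [Pi.smul_apply] at h1 h4 ⊢
    rw [h1, h2, h4]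
  norm_map' g := by
    refine norm_eq_of_enorm_sq_eq ?_
    simp only [LinearMap.coe_mk, AddHom.coe_mk]
    rw [enorm_sq_toLp, lintegral_jointRep]

theorem uncurryₗᵢ_ae (g : Lp (Lp ℂ 2 ν) 2 μ) :
    ∀ᵐ a ∂μ, (fun t => uncurryₗᵢ g (a, t)) =ᵐ[ν] g a := by
  filter_upwards [ae_of_toLp_eq (memLp_jointRep g)] with a ha
  exact ha.trans (jointRep_ae g a)

omit [MeasurableSpace.CountablyGenerated T] in
theorem ae_memLp_slice {F : α × T → ℂ} (hF : MemLp F 2 (μ.prod ν)) :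
    ∀ᵐ a ∂μ, MemLp (fun t => F (a, t)) 2 ν := by
  have h := (memLp_two_iff hF.aestronglyMeasurable).1 hF
  rw [lintegral_prod _ (hF.aestronglyMeasurable.enorm.pow_const 2)] at h
  have h2 := ae_lt_top' (hF.aestronglyMeasurable.enorm.pow_const 2).lintegral_prod_right' h.ne
  filter_upwards [h2, hF.aestronglyMeasurable.prodMk_left] with a ha ham
  exact (memLp_two_iff ham).2 ha

/-- A slice of F is square integrable only for almost every a. Setting F to zero over the other
points gives a curried map defined everywhere, at no cost in L². -/
theorem uncurryₗᵢ_surjective :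
    Function.Surjective (uncurryₗᵢ : Lp (Lp ℂ 2 ν) 2 μ →ₗᵢ[ℂ] Lp ℂ 2 (μ.prod ν)) := by
  intro F
  have hFm := Lp.stronglyMeasurable F
  set A : Set α := {a | ∫⁻ t, ‖F (a, t)‖ₑ ^ 2 ∂ν < ∞} with hA
  have hAm : MeasurableSet A :=
    measurableSet_lt (hFm.enorm.pow_const 2).lintegral_prod_right' measurable_const
  set F' : α × T → ℂ := (Prod.fst ⁻¹' A).indicator F with hF'
  have hF'm : StronglyMeasurable F' := hFm.indicator (measurable_fst hAm)
  have hmem : ∀ a, MemLp (fun t => F' (a, t)) 2 ν := by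
    intro a
    by_cases ha : a ∈ A
    · have : (fun t => F' (a, t)) = fun t => F (a, t) := by
        ext t; simp [hF', ha]
      rw [this]
      exact (memLp_two_iff
        (hFm.comp_measurable measurable_prodMk_left).aestronglyMeasurable).2 ha
    · have : (fun t => F' (a, t)) = fun t => 0 := by
        ext t; simp [hF', ha]
      rw [this]
      exact MemLp.zero'
  have hAae : ∀ᵐ a ∂μ, a ∈ A := by
    filter_upwards [ae_memLp_slice (Lp.memLp F)] with a ha
    exact (memLp_two_iff ha.aestronglyMeasurable).1 ha
  have hfm := stronglyMeasurable_toLp (ν := ν) hF'm hmem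
  have hf : MemLp (fun a => (hmem a).toLp) 2 μ := by
    rw [memLp_two_iff hfm.aestronglyMeasurable, ← lintegral_prod_enorm_sq hF'm
      (Eventually.of_forall fun a => (hmem a).coeFn_toLp.symm)]
    refine lt_of_le_of_lt (lintegral_mono fun p => ?_)
      ((memLp_two_iff (Lp.memLp F).aestronglyMeasurable).1 (Lp.memLp F))
    have : ‖F' p‖ₑ ≤ ‖F p‖ₑ := enorm_indicator_le_enorm_self _ _
    gcongr
  refine ⟨hf.toLp, Lp.ext ?_⟩
  refine ae_eq_prod_of_ae_ae (Lp.aestronglyMeasurable _) (Lp.aestronglyMeasurable _) ?_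
  filter_upwards [uncurryₗᵢ_ae hf.toLp, hf.coeFn_toLp, hAae] with a h1 h2 ha
  rw [h2] at h1
  filter_upwards [h1, (hmem a).coeFn_toLp] with t ht1 ht2
  rw [ht1, ht2]
  simp [hF', ha]

/-- The isometric isomorphism `L²(μ; L²(ν)) ≃ L²(μ ⊗ ν)`. -/
noncomputable def uncurryEquiv : Lp (Lp ℂ 2 ν) 2 μ ≃ₗᵢ[ℂ] Lp ℂ 2 (μ.prod ν) :=
  LinearIsometryEquiv.ofSurjective uncurryₗᵢ uncurryₗᵢ_surjective

theorem uncurryEquiv_ae (g : Lp (Lp ℂ 2 ν) 2 μ) :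
    ∀ᵐ a ∂μ, (fun t => uncurryEquiv g (a, t)) =ᵐ[ν] g a :=
  uncurryₗᵢ_ae g

theorem compLp_linearIsometryEquiv_ae {H H' : Type*} [NormedAddCommGroup H] [NormedSpace ℂ H]
    [NormedAddCommGroup H'] [NormedSpace ℂ H'] (L : H ≃ₗᵢ[ℂ] H') (f : Lp H 2 μ) :
    (L.toContinuousLinearEquiv : H →L[ℂ] H').compLpₗ 2 μ f =ᵐ[μ] fun a => L (f a) :=
  (L.toContinuousLinearEquiv : H →L[ℂ] H').coeFn_compLp f

/-- The isometric isomorphism of `L²` spaces of vector valued functions obtained by applying an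
isometric isomorphism pointwise. -/
noncomputable def mapLpEquiv {H H' : Type*} [NormedAddCommGroup H] [NormedSpace ℂ H]
    [NormedAddCommGroup H'] [NormedSpace ℂ H'] (L : H ≃ₗᵢ[ℂ] H') (μ : Measure α) :
    Lp H 2 μ ≃ₗᵢ[ℂ] Lp H' 2 μ :=
  LinearIsometryEquiv.ofSurjective
    { (L.toContinuousLinearEquiv : H →L[ℂ] H').compLpₗ 2 μ with
      norm_map' := fun f => by
        refine norm_eq_of_enorm_sq_eq ?_
        rw [← lintegral_enorm_sq_eq, ← lintegral_enorm_sq_eq]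
        refine lintegral_congr_ae ?_
        filter_upwards [compLp_linearIsometryEquiv_ae L f] with a ha
        rw [ha, ← ofReal_norm, ← ofReal_norm, L.norm_map] }
    fun f => by
      refine ⟨(L.symm.toContinuousLinearEquiv : H' →L[ℂ] H).compLpₗ 2 μ f, Lp.ext ?_⟩
      refine (compLp_linearIsometryEquiv_ae L _).trans ?_
      filter_upwards [compLp_linearIsometryEquiv_ae L.symm f] with a ha
      rw [ha, L.apply_symm_apply]

theorem mapLpEquiv_ae {H H' : Type*} [NormedAddCommGroup H] [NormedSpace ℂ H]
    [NormedAddCommGroup H'] [NormedSpace ℂ H'] (L : H ≃ₗᵢ[ℂ] H') (f : Lp H 2 μ) :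
    mapLpEquiv L μ f =ᵐ[μ] fun a => L (f a) :=
  (L.toContinuousLinearEquiv : H →L[ℂ] H').coeFn_compLp f

/-- The operator `1 ⊗ L` on `L²(μ ⊗ ν)`. -/
noncomputable def sliceMap (L : Lp ℂ 2 ν ≃ₗᵢ[ℂ] Lp ℂ 2 ν') (μ : Measure α) :
    Lp ℂ 2 (μ.prod ν) ≃ₗᵢ[ℂ] Lp ℂ 2 (μ.prod ν') :=
  uncurryEquiv.symm.trans ((mapLpEquiv L μ).trans uncurryEquiv)

/-- The slice of f is only a function, so it enters through any L² class g that it represents; the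
exceptional null set does not depend on g. -/
theorem sliceMap_ae (L : Lp ℂ 2 ν ≃ₗᵢ[ℂ] Lp ℂ 2 ν') (f : Lp ℂ 2 (μ.prod ν)) :
    ∀ᵐ a ∂μ, ∀ g : Lp ℂ 2 ν, g =ᵐ[ν] (fun t => f (a, t)) →
      (fun t => sliceMap L μ f (a, t)) =ᵐ[ν'] L g := by
  obtain ⟨h, rfl⟩ := uncurryEquiv.surjective f
  have : sliceMap L μ (uncurryEquiv h) = uncurryEquiv (mapLpEquiv L μ h) := by simp [sliceMap]
  rw [this]
  filter_upwards [uncurryEquiv_ae h, uncurryEquiv_ae (mapLpEquiv L μ h), mapLpEquiv_ae L h]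
    with a h1 h2 h3 g hg
  rw [h3] at h2
  have : g = h a := Lp.ext (hg.trans h1)
  rw [this]
  exact h2

/-- Composition with a measure preserving map that has a left inverse almost everywhere. -/
noncomputable def compEquiv {α β : Type*} [MeasurableSpace α] [MeasurableSpace β]
    {μ : Measure α} {μ' : Measure β} (e : α → β)
    (he : MeasurePreserving e μ μ') (e' : β → α) (he' : Measurable e')
    (hee' : ∀ᵐ x ∂μ, e' (e x) = x) : Lp ℂ 2 μ' ≃ₗᵢ[ℂ] Lp ℂ 2 μ :=
  LinearIsometryEquiv.ofSurjective (Lp.compMeasurePreservingₗᵢ ℂ e he) fun f => by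
    have hm : StronglyMeasurable (f ∘ e') := (Lp.stronglyMeasurable f).comp_measurable he'
    have hae : (f ∘ e') ∘ e =ᵐ[μ] f := by
      filter_upwards [hee'] with x hx
      simp [hx]
    have hmem : MemLp (f ∘ e') 2 μ' := by
      have : MemLp ((f ∘ e') ∘ e) 2 μ := (memLp_congr_ae hae).2 (Lp.memLp f)
      rw [← he.map_eq]
      exact (memLp_map_measure_iff hm.aestronglyMeasurable he.measurable.aemeasurable).2 this
    refine ⟨hmem.toLp, Lp.ext ?_⟩
    exact (Lp.coeFn_compMeasurePreserving _ he).trans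
      ((he.quasiMeasurePreserving.ae_eq_comp hmem.coeFn_toLp).trans hae)

theorem compEquiv_ae {α β : Type*} [MeasurableSpace α] [MeasurableSpace β]
    {μ : Measure α} {μ' : Measure β} (e : α → β)
    (he : MeasurePreserving e μ μ') (e' : β → α) (he' : Measurable e')
    (hee' : ∀ᵐ x ∂μ, e' (e x) = x) (f : Lp ℂ 2 μ') :
    compEquiv e he e' he' hee' f =ᵐ[μ] fun x => f (e x) :=
  Lp.coeFn_compMeasurePreserving _ he

-- On a set of finite measure the L¹ norm is bounded by the L² norm, so Bochner integrability in L²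
-- gives joint integrability there.
omit [MeasurableSpace.CountablyGenerated T] in
theorem integrable_prod_restrict_of_ae {F : α → Lp ℂ 2 ν} (hF : Integrable F μ)
    {Φ : α × T → ℂ} (hΦ : StronglyMeasurable Φ)
    (h : ∀ᵐ a ∂μ, (fun t => Φ (a, t)) =ᵐ[ν] F a) {s : Set T} (hνs : ν s < ∞) :
    Integrable Φ (μ.prod (ν.restrict s)) := by
  have : IsFiniteMeasure (ν.restrict s) := ⟨by simpa using hνs⟩
  refine ⟨hΦ.aestronglyMeasurable, ?_⟩
  rw [hasFiniteIntegral_iff_enorm, lintegral_prod _ hΦ.enorm.aemeasurable]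
  have hb : ∀ᵐ a ∂μ, ∫⁻ t, ‖Φ (a, t)‖ₑ ∂(ν.restrict s) ≤ ‖F a‖ₑ * ν s ^ (1 / 2 : ℝ) := by
    filter_upwards [h] with a ha
    have h1 := eLpNorm_le_eLpNorm_mul_rpow_measure_univ (p := 1) (q := 2) (by norm_num)
      (Lp.aestronglyMeasurable (F a)).restrict (μ := ν.restrict s)
    rw [eLpNorm_one_eq_lintegral_enorm] at h1
    have h2 : eLpNorm (F a) 2 (ν.restrict s) ≤ ‖F a‖ₑ := by
      rw [Lp.enorm_def]
      exact eLpNorm_mono_measure _ Measure.restrict_le_self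
    calc ∫⁻ t, ‖Φ (a, t)‖ₑ ∂(ν.restrict s) = ∫⁻ t, ‖F a t‖ₑ ∂(ν.restrict s) := by
          refine lintegral_congr_ae (ae_restrict_of_ae ?_)
          filter_upwards [ha] with t ht
          rw [ht]
      _ ≤ _ := h1
      _ ≤ ‖F a‖ₑ * ν s ^ (1 / 2 : ℝ) := by
          rw [Measure.restrict_apply_univ]
          norm_num
          gcongr
  refine (lintegral_mono_ae hb).trans_lt ?_
  rw [lintegral_mul_const'' _ hF.1.enorm]
  exact ENNReal.mul_lt_top hF.2 (ENNReal.rpow_lt_top_of_nonneg (by norm_num) hνs.ne)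

theorem ae_integrable_swap_of_ae [SigmaFinite ν] [SFinite μ] {F : α → Lp ℂ 2 ν}
    (hF : Integrable F μ) {Φ : α × T → ℂ} (hΦ : StronglyMeasurable Φ)
    (h : ∀ᵐ a ∂μ, (fun t => Φ (a, t)) =ᵐ[ν] F a) :
    ∀ᵐ t ∂ν, Integrable (fun a => Φ (a, t)) μ := by
  have h1 : ∀ n, ∀ᵐ t ∂(ν.restrict (spanningSets ν n)), Integrable (fun a => Φ (a, t)) μ :=
    fun n => (integrable_prod_restrict_of_ae hF hΦ h
      (measure_spanningSets_lt_top ν n)).prod_left_ae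
  have h2 := (ae_restrict_iUnion_iff (μ := ν) (spanningSets ν)
    fun t => Integrable (fun a => Φ (a, t)) μ).2 h1
  rwa [iUnion_spanningSets, Measure.restrict_univ] at h2

/-- Both sides are tested against indicators of sets of finite measure: the inner product commutes
with the Bochner integral on one side, and Fubini applies on the other. -/
theorem coeFn_integral_ae [SigmaFinite ν] [SFinite μ] {F : α → Lp ℂ 2 ν} (hF : Integrable F μ)
    {Φ : α × T → ℂ} (hΦ : StronglyMeasurable Φ)
    (h : ∀ᵐ a ∂μ, (fun t => Φ (a, t)) =ᵐ[ν] F a) :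
    (∫ a, F a ∂μ : Lp ℂ 2 ν) =ᵐ[ν] fun t => ∫ a, Φ (a, t) ∂μ := by
  have hint : ∀ s, ν s < ∞ → Integrable Φ (μ.prod (ν.restrict s)) := fun s hνs =>
    integrable_prod_restrict_of_ae hF hΦ h hνs
  refine ae_eq_of_forall_setIntegral_eq_of_sigmaFinite ?_ ?_ ?_
  · intro s hs hνs
    have : IsFiniteMeasure (ν.restrict s) := ⟨by simpa using hνs⟩
    exact ((Lp.memLp _).restrict s).integrable (by norm_num)
  · intro s hs hνs
    exact (hint s hνs).integral_prod_right
  · intro s hs hνs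
    rw [← integral_integral_swap (f := fun a t => Φ (a, t)) (hint s hνs)]
    rw [← L2.inner_indicatorConstLp_one hs hνs.ne, ← integral_inner hF]
    refine integral_congr_ae ?_
    filter_upwards [h] with a ha
    rw [L2.inner_indicatorConstLp_one hs hνs.ne]
    refine integral_congr_ae (ae_restrict_of_ae ?_)
    filter_upwards [ha] with t ht
    rw [ht]

end Uncurry

/-! ### The L² Fourier transform as an integral on L¹ ∩ L² -/

section Fourier

open FourierTransform SchwartzMap

theorem continuous_fourierInv_of_integrable {E : Type*} [NormedAddCommGroup E]
    [InnerProductSpace ℝ E] [FiniteDimensional ℝ E] [MeasurableSpace E] [BorelSpace E]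
    {f : E → ℂ} (hf : Integrable f) : Continuous (𝓕⁻ f) := by
  have h : Continuous fun p : E × E => (-innerₗ E) p.1 p.2 := by
    simp only [LinearMap.neg_apply, innerₗ_apply_apply]
    fun_prop
  exact VectorFourier.fourierIntegral_continuous Real.continuous_fourierChar h hf

/-- The L² transform is compatible with the one on tempered distributions. Moving the transform onto
a smooth compactly supported test function shows that it agrees with the integral. -/
theorem Lp_fourierInv_ae {E : Type*} [NormedAddCommGroup E] [InnerProductSpace ℝ E]
    [FiniteDimensional ℝ E] [MeasurableSpace E] [BorelSpace E] (f : Lp (α := E) ℂ 2)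
    (hf : Integrable f) : (𝓕⁻ f : Lp (α := E) ℂ 2) =ᵐ[volume] 𝓕⁻ (f : E → ℂ) := by
  refine ae_eq_of_integral_contDiff_smul_eq ((Lp.memLp _).locallyIntegrable (by norm_num))
    (continuous_fourierInv_of_integrable hf).locallyIntegrable fun g hg hgc => ?_
  have hg₁ : HasCompactSupport (Complex.ofRealCLM ∘ g) := hgc.comp_left rfl
  have hg₂ : ContDiff ℝ ((⊤ : ℕ∞) : WithTop ℕ∞) (Complex.ofRealCLM ∘ g) :=
    Complex.ofRealCLM.contDiff.comp hg
  set G : 𝓢(E, ℂ) := hg₁.toSchwartzMap hg₂ with hG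
  have h1 := congrArg (fun T => T G) (Lp.fourierInv_toTemperedDistribution_eq f)
  simp only [TemperedDistribution.fourierInv_apply, Lp.toTemperedDistribution_apply (μ := volume)] at h1
  have h2 : ∫ x, g x • (𝓕⁻ f : Lp (α := E) ℂ 2 volume) x = ∫ x, G x • (𝓕⁻ f : Lp (α := E) ℂ 2 volume) x := by
    simp [hG]
  have h3 : ∫ x, g x • 𝓕⁻ (f : E → ℂ) x = ∫ x, G x • 𝓕⁻ (f : E → ℂ) x := by simp [hG]
  rw [h2, h3, ← h1]
  have hL : Continuous fun p : E × E => (-innerₗ E) p.1 p.2 := by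
    simp only [LinearMap.neg_apply, innerₗ_apply_apply]
    fun_prop
  have hflip : (-innerₗ E).flip = -innerₗ E := by
    ext x y; simp [real_inner_comm]
  have h4 := VectorFourier.integral_fourierIntegral_smul_eq_flip (L := -innerₗ E)
    (μ := volume) (ν := volume) Real.continuous_fourierChar hL G.integrable hf
  rw [hflip] at h4
  rw [fourierInv_coe]
  exact h4

end Fourier

/-! ### The Fourier transform on ℝ^p × ℝ^q -/

section FourierProd

variable {p q : Type*} [Fintype p] [Fintype q]

/-- The character `ζ ↦ exp (2πi ⟨ξ, ζ⟩)` of `ℝ^p × ℝ^q`. -/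
noncomputable def prodChar (ξ ζ : (p → ℝ) × (q → ℝ)) : ℂ :=
  Complex.exp (2 * Real.pi * Complex.I * ((ξ.1 ⬝ᵥ ζ.1 + ξ.2 ⬝ᵥ ζ.2 : ℝ) : ℂ))

theorem prodChar_comm (ξ ζ : (p → ℝ) × (q → ℝ)) : prodChar ξ ζ = prodChar ζ ξ := by
  unfold prodChar
  rw [dotProduct_comm ξ.1, dotProduct_comm ξ.2]

theorem continuous_prodChar :
    Continuous fun w : ((p → ℝ) × (q → ℝ)) × ((p → ℝ) × (q → ℝ)) => prodChar w.1 w.2 := by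
  unfold prodChar dotProduct; fun_prop

/-- The measure preserving identification of `ℝ^(p ⊕ q)` with `ℝ^p × ℝ^q`. -/
def euclideanSplit (w : EuclideanSpace ℝ (p ⊕ q)) : (p → ℝ) × (q → ℝ) :=
  (fun i => w (Sum.inl i), fun j => w (Sum.inr j))

def euclideanJoin (ζ : (p → ℝ) × (q → ℝ)) : EuclideanSpace ℝ (p ⊕ q) :=
  WithLp.toLp 2 (Sum.elim ζ.1 ζ.2)

theorem measurePreserving_euclideanSplit :
    MeasurePreserving (euclideanSplit : EuclideanSpace ℝ (p ⊕ q) → (p → ℝ) × (q → ℝ)) :=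
  (volume_measurePreserving_sumPiEquivProdPi (fun _ : p ⊕ q => ℝ)).comp
    (PiLp.volume_preserving_ofLp (p ⊕ q))

omit [Fintype p] [Fintype q] in
theorem euclideanSplit_join (ζ : (p → ℝ) × (q → ℝ)) : euclideanSplit (euclideanJoin ζ) = ζ := rfl

omit [Fintype p] [Fintype q] in
theorem euclideanJoin_split (w : EuclideanSpace ℝ (p ⊕ q)) :
    euclideanJoin (euclideanSplit w) = w := by
  ext i; rcases i with i | i <;> rfl

omit [Fintype p] [Fintype q] in
theorem measurable_euclideanJoin :
    Measurable (euclideanJoin : (p → ℝ) × (q → ℝ) → EuclideanSpace ℝ (p ⊕ q)) := by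
  refine (WithLp.measurable_toLp 2 (p ⊕ q → ℝ)).comp ?_
  refine measurable_pi_lambda _ fun i => ?_
  rcases i with i | i
  · exact (measurable_pi_apply i).comp measurable_fst
  · exact (measurable_pi_apply i).comp measurable_snd

theorem measurableEmbedding_euclideanSplit :
    MeasurableEmbedding (euclideanSplit : EuclideanSpace ℝ (p ⊕ q) → (p → ℝ) × (q → ℝ)) :=
  MeasurableEmbedding.of_measurable_inverse measurePreserving_euclideanSplit.measurable
    (by rw [Set.range_eq_univ.2 fun ζ => ⟨_, euclideanSplit_join ζ⟩]; exact MeasurableSet.univ)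
    measurable_euclideanJoin euclideanJoin_split

theorem measurePreserving_euclideanJoin :
    MeasurePreserving (euclideanJoin : (p → ℝ) × (q → ℝ) → EuclideanSpace ℝ (p ⊕ q)) := by
  refine ⟨measurable_euclideanJoin, ?_⟩
  rw [← (measurePreserving_euclideanSplit (p := p) (q := q)).map_eq,
    Measure.map_map measurable_euclideanJoin measurePreserving_euclideanSplit.measurable]
  convert Measure.map_id
  ext1 w; exact euclideanJoin_split w

/-- The transport of `L²(ℝ^p × ℝ^q)` to `L²(ℝ^(p ⊕ q))`. -/
noncomputable def splitEquiv :
    Lp ℂ 2 (volume : Measure ((p → ℝ) × (q → ℝ))) ≃ₗᵢ[ℂ]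
      Lp ℂ 2 (volume : Measure (EuclideanSpace ℝ (p ⊕ q))) :=
  compEquiv euclideanSplit measurePreserving_euclideanSplit euclideanJoin measurable_euclideanJoin
    (Eventually.of_forall euclideanJoin_split)

theorem splitEquiv_ae (f : Lp ℂ 2 (volume : Measure ((p → ℝ) × (q → ℝ)))) :
    splitEquiv f =ᵐ[volume] fun w => f (euclideanSplit w) := compEquiv_ae _ _ _ _ _ f

/-- The transport of `L²(ℝ^(p ⊕ q))` to `L²(ℝ^p × ℝ^q)`. -/
noncomputable def joinEquiv :
    Lp ℂ 2 (volume : Measure (EuclideanSpace ℝ (p ⊕ q))) ≃ₗᵢ[ℂ]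
      Lp ℂ 2 (volume : Measure ((p → ℝ) × (q → ℝ))) :=
  compEquiv euclideanJoin measurePreserving_euclideanJoin euclideanSplit
    measurePreserving_euclideanSplit.measurable (Eventually.of_forall euclideanSplit_join)

theorem joinEquiv_ae (f : Lp ℂ 2 (volume : Measure (EuclideanSpace ℝ (p ⊕ q)))) :
    joinEquiv f =ᵐ[volume] fun ζ => f (euclideanJoin ζ) := compEquiv_ae _ _ _ _ _ f

/-- The Fourier transform on `L²(ℝ^p × ℝ^q)`, with the kernel `exp (2πi ⟨ξ, ζ⟩)`. -/
noncomputable def fourierProd :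
    Lp ℂ 2 (volume : Measure ((p → ℝ) × (q → ℝ))) ≃ₗᵢ[ℂ]
      Lp ℂ 2 (volume : Measure ((p → ℝ) × (q → ℝ))) :=
  splitEquiv.trans ((Lp.fourierTransformₗᵢ (EuclideanSpace ℝ (p ⊕ q)) ℂ).symm.trans joinEquiv)

/-- The character carries a positive sign, as in the phase of π_λ, and this is why the inverse
transform is the one used. -/
theorem fourierProd_ae (f : Lp ℂ 2 (volume : Measure ((p → ℝ) × (q → ℝ)))) (hf : Integrable f) :
    fourierProd f =ᵐ[volume] fun ξ => ∫ ζ, prodChar ξ ζ * f ζ := by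
  set f' := splitEquiv f with hf'
  have h1 : f' =ᵐ[volume] fun w => f (euclideanSplit w) := splitEquiv_ae f
  have hint : Integrable f' :=
    (integrable_congr h1).2 (measurePreserving_euclideanSplit.integrable_comp_of_integrable hf)
  have h2 := Lp_fourierInv_ae f' hint
  refine (joinEquiv_ae _).trans ?_
  refine (measurePreserving_euclideanJoin.quasiMeasurePreserving.ae_eq_comp h2).trans ?_
  refine Eventually.of_forall fun ξ => ?_
  simp only [Function.comp_apply]
  rw [Real.fourierInv_eq']
  refine Eq.trans (integral_congr_ae ?_)
    (measurePreserving_euclideanSplit.integral_comp measurableEmbedding_euclideanSplit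
      fun ζ => prodChar ξ ζ * f ζ)
  filter_upwards [h1] with w hw
  rw [hw]
  simp only [prodChar, smul_eq_mul]
  congr 2
  have : inner ℝ w (euclideanJoin ξ) =
      ξ.1 ⬝ᵥ (euclideanSplit w).1 + ξ.2 ⬝ᵥ (euclideanSplit w).2 := by
    rw [PiLp.inner_apply, Fintype.sum_sum_type]
    simp [euclideanJoin, euclideanSplit, dotProduct]
  rw [this]
  push_cast
  ring

/-- **Plancherel's theorem** on `L¹ ∩ L²`. -/
theorem lintegral_fourier_enorm_sq {h : (p → ℝ) × (q → ℝ) → ℂ} (h1 : Integrable h)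
    (h2 : MemLp h 2) :
    ∫⁻ ξ, ‖∫ ζ, prodChar ξ ζ * h ζ‖ₑ ^ 2 = ∫⁻ ζ, ‖h ζ‖ₑ ^ 2 := by
  have hint : Integrable h2.toLp := (integrable_congr h2.coeFn_toLp).2 h1
  rw [← enorm_sq_toLp h2]
  have : ‖h2.toLp‖ₑ = ‖fourierProd h2.toLp‖ₑ := by
    rw [← ofReal_norm, ← ofReal_norm, LinearIsometryEquiv.norm_map]
  rw [this, ← lintegral_enorm_sq_eq]
  refine lintegral_congr_ae ?_
  filter_upwards [fourierProd_ae h2.toLp hint] with ξ hξ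
  have : ∫ ζ, prodChar ξ ζ * h2.toLp h ζ = ∫ ζ, prodChar ξ ζ * h ζ :=
    integral_congr_ae (h2.coeFn_toLp.mono fun ζ hζ => congrArg (prodChar ξ ζ * ·) hζ)
  rw [hξ, this]

end FourierProd

/-! ### Periodization, packing and Parseval's identity for Fourier series -/

section FourierSeries

variable {ι : Type*} [Fintype ι]

/-- The unit cell `(0, 1]^ι` translated by an integer vector. -/
def unitCell (k : ι → ℤ) : Set (ι → ℝ) := {x | ∀ i, x i ∈ Set.Ioc (k i : ℝ) (k i + 1)}

theorem measurableSet_unitCell (k : ι → ℤ) : MeasurableSet (unitCell k) :=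
  MeasurableSet.univ_pi' fun _ => measurableSet_Ioc

omit [Fintype ι] in
theorem mem_unitCell_iff {k : ι → ℤ} {x : ι → ℝ} : x ∈ unitCell k ↔ ∀ i, ⌈x i⌉ - 1 = k i := by
  simp only [unitCell, Set.mem_ofPred_eq, Set.mem_Ioc]
  refine forall_congr' fun i => ?_
  rw [sub_eq_iff_eq_add, Int.ceil_eq_iff]
  push_cast
  simp

theorem iUnion_unitCell : ⋃ k : ι → ℤ, unitCell k = (Set.univ : Set (ι → ℝ)) :=
  Set.eq_univ_of_forall fun x => Set.mem_iUnion.2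
    ⟨fun i => ⌈x i⌉ - 1, mem_unitCell_iff.2 fun _ => rfl⟩

theorem pairwise_disjoint_unitCell :
    Pairwise (Function.onFun Disjoint (unitCell : (ι → ℤ) → Set (ι → ℝ))) := fun _ _ hkl =>
  Set.disjoint_left.2 fun _ hk hl => hkl (funext fun i =>
    (mem_unitCell_iff.1 hk i).symm.trans (mem_unitCell_iff.1 hl i))

omit [Fintype ι] in
theorem preimage_unitCell (k : ι → ℤ) :
    (fun x : ι → ℝ => x + fun i => (k i : ℝ)) ⁻¹' unitCell k = unitCell 0 := by
  ext x
  simp [unitCell, add_comm (x _)]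

theorem measurePreserving_unitCell (k : ι → ℤ) :
    MeasurePreserving (fun x : ι → ℝ => x + fun i => (k i : ℝ))
      (volume.restrict (unitCell 0)) (volume.restrict (unitCell k)) := by
  have := (measurePreserving_add_right (volume : Measure (ι → ℝ))
    (fun i => (k i : ℝ))).restrict_preimage (measurableSet_unitCell k)
  rwa [preimage_unitCell] at this

theorem lintegral_eq_tsum_unitCell {g : (ι → ℝ) → ℝ≥0∞} (hg : AEMeasurable g) :
    ∫⁻ x, g x = ∫⁻ x in unitCell 0, ∑' k : ι → ℤ, g (x + fun i => (k i : ℝ)) := by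
  rw [lintegral_tsum, ← setLIntegral_univ, ← iUnion_unitCell,
    lintegral_iUnion measurableSet_unitCell pairwise_disjoint_unitCell]
  · refine tsum_congr fun k => ?_
    have hg' : AEMeasurable g ((volume.restrict (unitCell (0 : ι → ℤ))).map
        fun x : ι → ℝ => x + fun i => (k i : ℝ)) := by
      rw [(measurePreserving_unitCell k).map_eq]; exact hg.restrict
    rw [← (measurePreserving_unitCell k).map_eq, lintegral_map' hg'
      (measurePreserving_unitCell k).measurable.aemeasurable]
  · intro k
    exact (hg.comp_quasiMeasurePreserving
      (measurePreserving_add_right volume _).quasiMeasurePreserving).restrict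

theorem integral_eq_tsum_unitCell {g : (ι → ℝ) → ℂ} (hg : Integrable g) :
    ∫ x, g x = ∫ x in unitCell 0, ∑' k : ι → ℤ, g (x + fun i => (k i : ℝ)) := by
  have hm : ∀ k : ι → ℤ, AEStronglyMeasurable (fun x : ι → ℝ => g (x + fun i => (k i : ℝ))) :=
    fun k => hg.1.comp_quasiMeasurePreserving
      (measurePreserving_add_right volume _).quasiMeasurePreserving
  rw [integral_tsum fun k => (hm k).restrict]
  · rw [← setIntegral_univ, ← iUnion_unitCell]
    rw [← (hasSum_integral_iUnion measurableSet_unitCell pairwise_disjoint_unitCell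
      hg.integrableOn).tsum_eq]
    refine tsum_congr fun k => ?_
    rw [← (measurePreserving_unitCell k).map_eq, integral_map
      (measurePreserving_unitCell k).measurable.aemeasurable]
    rw [(measurePreserving_unitCell k).map_eq]; exact hg.1.restrict
  · rw [← lintegral_tsum fun k => (hm k).enorm.restrict,
      ← lintegral_eq_tsum_unitCell hg.1.enorm]
    exact hg.2.ne

/-- Sum of the translates of a function by integer vectors. -/
noncomputable def periodize (h : (ι → ℝ) → ℂ) (x : ι → ℝ) : ℂ :=
  ∑' k : ι → ℤ, h (x + fun i => (k i : ℝ))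

/-- The translates of `h` by integer vectors have almost everywhere disjoint supports. -/
def IsPacking (h : (ι → ℝ) → ℂ) : Prop :=
  ∀ᵐ x, ∀ k : ι → ℤ, k ≠ 0 → h x = 0 ∨ h (x + fun i => (k i : ℝ)) = 0

/-- The packing condition holds almost everywhere at all countably many integer translates of x
simultaneously. Hence the periodization has at most one nonzero term, and its square has no cross
terms. -/
theorem IsPacking.ae_unique {h : (ι → ℝ) → ℂ} (hp : IsPacking h) :
    ∀ᵐ x, ∃ k₀ : ι → ℤ, ∀ k : ι → ℤ, k ≠ k₀ → h (x + fun i => (k i : ℝ)) = 0 := by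
  have h1 : ∀ᵐ x, ∀ l : ι → ℤ, ∀ k : ι → ℤ, k ≠ 0 → h (x + fun i => (l i : ℝ)) = 0 ∨
      h (x + (fun i => (l i : ℝ)) + fun i => (k i : ℝ)) = 0 := by
    rw [ae_all_iff]
    exact fun l => (measurePreserving_add_right (volume : Measure (ι → ℝ))
      (fun i => (l i : ℝ))).quasiMeasurePreserving.ae hp
  filter_upwards [h1] with x hx
  by_cases hz : ∃ l : ι → ℤ, h (x + fun i => (l i : ℝ)) ≠ 0
  · obtain ⟨l, hl⟩ := hz
    refine ⟨l, fun k hk => ?_⟩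
    have := (hx l (k - l) (sub_ne_zero.2 hk)).resolve_left hl
    convert this using 2
    ext i; simp
  · push Not at hz
    exact ⟨0, fun k _ => hz k⟩

theorem aestronglyMeasurable_periodize {h : (ι → ℝ) → ℂ} (hm : AEStronglyMeasurable h)
    (hp : IsPacking h) : AEStronglyMeasurable (periodize h) := by
  refine aestronglyMeasurable_of_tendsto_ae (u := (atTop : Filter (Finset (ι → ℤ))))
    (f := fun s x => ∑ k ∈ s, h (x + fun i => (k i : ℝ))) (fun s => ?_) ?_
  · exact Finset.aestronglyMeasurable_fun_sum s fun k _ => hm.comp_quasiMeasurePreserving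
      (measurePreserving_add_right volume _).quasiMeasurePreserving
  · filter_upwards [hp.ae_unique] with x ⟨k₀, hk⟩
    exact (hasSum_single k₀ hk).summable.hasSum

theorem IsPacking.enorm_sq_periodize {h : (ι → ℝ) → ℂ} (hp : IsPacking h) :
    ∀ᵐ x, ‖periodize h x‖ₑ ^ 2 = ∑' k : ι → ℤ, ‖h (x + fun i => (k i : ℝ))‖ₑ ^ 2 := by
  filter_upwards [hp.ae_unique] with x ⟨k₀, hk⟩
  rw [periodize, tsum_eq_single k₀ hk, tsum_eq_single k₀ fun k hk' => by simp [hk k hk']]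

noncomputable local instance : MeasureSpace UnitAddCircle := ⟨AddCircle.haarAddCircle⟩

theorem mFourier_coe (n : ι → ℤ) (x : ι → ℝ) :
    UnitAddTorus.mFourier n (fun i => (x i : UnitAddCircle)) =
      Complex.exp (2 * Real.pi * Complex.I * ((∑ i, n i * x i : ℝ) : ℂ)) := by
  simp only [UnitAddTorus.mFourier, ContinuousMap.coe_mk, fourier_coe_apply]
  rw [← Complex.exp_sum]
  congr 1
  push_cast
  rw [Finset.mul_sum]
  refine Finset.sum_congr rfl fun i _ => ?_
  ring

theorem mFourier_coe_add_int (n k : ι → ℤ) (x : ι → ℝ) :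
    UnitAddTorus.mFourier n (fun i => ((x i + k i : ℝ) : UnitAddCircle)) =
      UnitAddTorus.mFourier n (fun i => (x i : UnitAddCircle)) := by
  congr 1
  ext i
  rw [AddCircle.coe_add]
  have : ((k i : ℝ) : UnitAddCircle) = 0 :=
    (AddCircle.coe_eq_zero_iff 1).2 ⟨k i, by simp⟩
  rw [this, add_zero]

/-- **Parseval's identity** for the Fourier series of a function supported on a set that packs
under integer translations. -/
theorem tsum_enorm_sq_fourier_of_isPacking {h : (ι → ℝ) → ℂ} (h1 : Integrable h) (h2 : MemLp h 2)
    (hp : IsPacking h) :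
    ∑' n : ι → ℤ, ‖∫ x, Complex.exp (2 * Real.pi * Complex.I * ((∑ i, n i * x i : ℝ) : ℂ)) * h x‖ₑ
      ^ 2 = ∫⁻ x, ‖h x‖ₑ ^ 2 := by
  set Q : Set (ι → ℝ) := {x | ∀ i, x i ∈ Set.Ioc ((0 : ι → ℝ) i) ((0 : ι → ℝ) i + 1)} with hQ
  have hQ0 : Q = unitCell 0 := by ext x; simp [hQ, unitCell]
  set r : UnitAddTorus ι → ι → ℝ := fun θ => (UnitAddTorus.measurableEquivPiIoc (0 : ι → ℝ) θ).1
  have hr : MeasurePreserving r volume (volume.restrict Q) := by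
    have hQm : MeasurableSet Q := MeasurableSet.univ_pi' fun _ => measurableSet_Ioc
    refine MeasurePreserving.comp (μb := Measure.comap Subtype.val volume) ⟨measurable_subtype_coe, ?_⟩
      (UnitAddTorus.measurePreserving_equivPiIoc (0 : ι → ℝ))
    exact map_comap_subtype_coe hQm volume
  set f : UnitAddTorus ι → ℂ := fun θ => periodize h (r θ) with hf
  have hfx : ∀ x ∈ Q, f (fun i => (x i : UnitAddCircle)) = periodize h x := by
    intro x hx
    simp only [hf]
    congr 1
    have := (UnitAddTorus.measurableEquivPiIoc (0 : ι → ℝ)).apply_symm_apply ⟨x, hx⟩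
    exact congrArg Subtype.val this
  have hQm : MeasurableSet Q := hQ0 ▸ measurableSet_unitCell 0
  have hfm : AEStronglyMeasurable f :=
    (aestronglyMeasurable_periodize h1.1 hp).restrict.comp_quasiMeasurePreserving
      hr.quasiMeasurePreserving
  -- The one place where packing, and not just integrability, is needed for the norm: the square of
  -- the periodization is the periodization of the square.
  have hfn : ∫⁻ θ, ‖f θ‖ₑ ^ 2 = ∫⁻ x, ‖h x‖ₑ ^ 2 := by
    rw [UnitAddTorus.lintegral_preimage _ 0, lintegral_eq_tsum_unitCell (h1.1.enorm.pow_const 2),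
      ← hQ0]
    refine setLIntegral_congr_fun_ae hQm ?_
    filter_upwards [hp.enorm_sq_periodize] with x hx hxQ
    rw [hfx x hxQ, hx]
  have hf2 : MemLp f 2 := by
    rw [memLp_two_iff hfm, hfn]
    exact (memLp_two_iff h1.1).1 h2
  have hcoef : ∀ n : ι → ℤ, UnitAddTorus.mFourierCoeff hf2.toLp n =
      ∫ x, Complex.exp (2 * Real.pi * Complex.I * ((∑ i, (-n) i * x i : ℝ) : ℂ)) * h x := by
    intro n
    have hc : UnitAddTorus.mFourierCoeff hf2.toLp n = UnitAddTorus.mFourierCoeff f n :=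
      integral_congr_ae (hf2.coeFn_toLp.mono fun θ hθ => by simp only [hθ])
    rw [hc, UnitAddTorus.mFourierCoeff_eq_integral f n 0]
    have hgi : Integrable fun x : ι → ℝ =>
        UnitAddTorus.mFourier (-n) (fun i => (x i : UnitAddCircle)) * h x := by
      refine h1.bdd_mul (c := 1) ?_ (Eventually.of_forall fun x => ?_)
      · refine (Continuous.comp (map_continuous _) ?_).aestronglyMeasurable
        exact continuous_pi fun i => (AddCircle.continuous_mk' 1).comp (continuous_apply i)
      · exact ((UnitAddTorus.mFourier (-n)).norm_coe_le_norm _).trans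
          UnitAddTorus.mFourier_norm.le
    simp only [← mFourier_coe]
    rw [integral_eq_tsum_unitCell hgi, ← hQ0]
    refine setIntegral_congr_fun hQm fun x hx => ?_
    rw [hfx x hx, smul_eq_mul, periodize, ← tsum_mul_left]
    refine tsum_congr fun k => ?_
    rw [← mFourier_coe_add_int (-n) k x]
    rfl
  have hsum := UnitAddTorus.hasSum_sq_mFourierCoeff hf2.toLp
  have h3 : ∑' n : ι → ℤ, ‖UnitAddTorus.mFourierCoeff hf2.toLp n‖ₑ ^ 2 = ∫⁻ x, ‖h x‖ₑ ^ 2 := by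
    have e1 : ∀ n, ‖UnitAddTorus.mFourierCoeff hf2.toLp n‖ₑ ^ 2 =
        ENNReal.ofReal (‖UnitAddTorus.mFourierCoeff hf2.toLp n‖ ^ 2) := fun n => by
      rw [ENNReal.ofReal_pow (norm_nonneg _), ofReal_norm]
    simp only [e1]
    rw [← ENNReal.ofReal_tsum_of_nonneg (fun _ => by positivity) hsum.summable, hsum.tsum_eq,
      ← hfn, ← enorm_sq_toLp hf2, ← lintegral_enorm_sq_eq]
    rw [ofReal_integral_eq_lintegral_ofReal]
    · refine lintegral_congr fun θ => ?_
      rw [ENNReal.ofReal_pow (norm_nonneg _), ofReal_norm]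
    · exact (memLp_two_iff_integrable_sq_norm (Lp.aestronglyMeasurable _)).1 (Lp.memLp _)
    · exact Eventually.of_forall fun _ => by positivity
  rw [← h3]
  -- Fourier coefficients pair with the conjugate character, so the frequencies are reflected.
  rw [← (Equiv.neg (ι → ℤ)).tsum_eq]
  refine tsum_congr fun n => ?_
  rw [hcoef n]
  rfl

end FourierSeries

/-! ### Parseval's identity for general periods -/

section FourierSeriesProd

variable {p q : Type*} [Fintype p] [Fintype q]

/-- The dilation `ℝ^(p ⊕ q) → ℝ^p × ℝ^q` by the factors `a` and `c`. -/
def dilate (a : p → ℝ) (c : q → ℝ) (x : p ⊕ q → ℝ) : (p → ℝ) × (q → ℝ) :=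
  (fun i => a i * x (Sum.inl i), fun j => c j * x (Sum.inr j))

omit [Fintype p] [Fintype q] in
theorem measurable_dilate (a : p → ℝ) (c : q → ℝ) : Measurable (dilate a c) := by
  unfold dilate; fun_prop

theorem smul_map_dilate {a : p → ℝ} {c : q → ℝ} (ha : ∀ i, 0 < a i) (hc : ∀ j, 0 < c j) :
    ENNReal.ofReal ((∏ i, a i) * ∏ j, c j) • Measure.map (dilate a c) volume = volume := by
  classical
  have hdet : (Matrix.diagonal (Sum.elim a c)).det = (∏ i, a i) * ∏ j, c j := by
    rw [Matrix.det_diagonal, Fintype.prod_sum_type]; rfl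
  have hpos : 0 < (∏ i, a i) * ∏ j, c j :=
    mul_pos (Finset.prod_pos fun i _ => ha i) (Finset.prod_pos fun j _ => hc j)
  have h1 := Real.smul_map_diagonal_volume_pi (D := Sum.elim a c) (by rw [hdet]; exact hpos.ne')
  rw [hdet, abs_of_pos hpos] at h1
  have h2 := (volume_measurePreserving_sumPiEquivProdPi (fun _ : p ⊕ q => ℝ)).map_eq
  rw [← h1, Measure.map_smul, Measure.map_map (MeasurableEquiv.measurable _)
    (LinearMap.continuous_of_finiteDimensional
      (Matrix.toLin' (Matrix.diagonal (Sum.elim a c)))).measurable] at h2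
  rw [← h2]
  congr 2
  funext x
  apply Prod.ext <;> ext i <;>
  simp [dilate, MeasurableEquiv.coe_sumPiEquivProdPi, Matrix.mulVec_diagonal]

theorem lintegral_dilate {a : p → ℝ} {c : q → ℝ} (ha : ∀ i, 0 < a i) (hc : ∀ j, 0 < c j)
    {g : (p → ℝ) × (q → ℝ) → ℝ≥0∞} (hg : Measurable g) :
    ∫⁻ ξ, g ξ = ENNReal.ofReal ((∏ i, a i) * ∏ j, c j) * ∫⁻ x, g (dilate a c x) := by
  rw [← smul_map_dilate ha hc, lintegral_smul_measure, lintegral_map hg (measurable_dilate a c),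
    smul_eq_mul]

theorem quasiMeasurePreserving_dilate {a : p → ℝ} {c : q → ℝ} (ha : ∀ i, 0 < a i)
    (hc : ∀ j, 0 < c j) : Measure.QuasiMeasurePreserving (dilate a c) := by
  refine ⟨measurable_dilate a c, ?_⟩
  have hpos : 0 < (∏ i, a i) * ∏ j, c j :=
    mul_pos (Finset.prod_pos fun i _ => ha i) (Finset.prod_pos fun j _ => hc j)
  conv_rhs => rw [← smul_map_dilate ha hc]
  exact Measure.AbsolutelyContinuous.rfl.smul_right (by simpa using hpos)

theorem integral_dilate {a : p → ℝ} {c : q → ℝ} (ha : ∀ i, 0 < a i) (hc : ∀ j, 0 < c j)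
    {g : (p → ℝ) × (q → ℝ) → ℂ} (hg : StronglyMeasurable g) :
    ∫ ξ, g ξ = (((∏ i, a i) * ∏ j, c j : ℝ) : ℂ) * ∫ x, g (dilate a c x) := by
  have hpos : 0 < (∏ i, a i) * ∏ j, c j :=
    mul_pos (Finset.prod_pos fun i _ => ha i) (Finset.prod_pos fun j _ => hc j)
  rw [← smul_map_dilate ha hc, integral_smul_measure, integral_map
    (measurable_dilate a c).aemeasurable hg.aestronglyMeasurable, ENNReal.toReal_ofReal hpos.le,
    Complex.real_smul]

/-- **Parseval's identity** for the Fourier series of a function on `ℝ^p × ℝ^q` supported on a set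
that packs under translations by the lattice with periods `a` and `c`. -/
theorem tsum_enorm_sq_fourier_prod {a : p → ℝ} {c : q → ℝ} (ha : ∀ i, 0 < a i) (hc : ∀ j, 0 < c j)
    {h : (p → ℝ) × (q → ℝ) → ℂ} (hm : StronglyMeasurable h) (h1 : Integrable h) (h2 : MemLp h 2)
    (hp : ∀ᵐ ξ, ∀ n : (p → ℤ) × (q → ℤ), n ≠ 0 →
      h ξ = 0 ∨ h (ξ + (fun i => n.1 i * a i, fun j => n.2 j * c j)) = 0) :
    ∑' n : (p → ℤ) × (q → ℤ),
      ‖∫ ξ, prodChar ξ (fun i => n.1 i / a i, fun j => n.2 j / c j) * h ξ‖ₑ ^ 2 =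
      ENNReal.ofReal ((∏ i, a i) * ∏ j, c j) * ∫⁻ ξ, ‖h ξ‖ₑ ^ 2 := by
  have hpos : 0 < (∏ i, a i) * ∏ j, c j :=
    mul_pos (Finset.prod_pos fun i _ => ha i) (Finset.prod_pos fun j _ => hc j)
  set C := (∏ i, a i) * ∏ j, c j with hC
  set g : (p ⊕ q → ℝ) → ℂ := fun x => h (dilate a c x) with hg
  have hgm : StronglyMeasurable g := hm.comp_measurable (measurable_dilate a c)
  have hC0 : ENNReal.ofReal C ≠ 0 := by simpa using hpos
  have hg1 : Integrable g := by
    refine ⟨hgm.aestronglyMeasurable, ?_⟩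
    have := h1.2
    rw [hasFiniteIntegral_iff_enorm, lintegral_dilate ha hc hm.enorm] at this
    rw [hasFiniteIntegral_iff_enorm]
    exact ENNReal.lt_top_of_mul_ne_top_right this.ne hC0
  have hg2 : MemLp g 2 := by
    rw [memLp_two_iff hgm.aestronglyMeasurable]
    have := (memLp_two_iff hm.aestronglyMeasurable).1 h2
    rw [lintegral_dilate ha hc (hm.enorm.pow_const 2)] at this
    exact ENNReal.lt_top_of_mul_ne_top_right this.ne hC0
  have hgp : IsPacking g := by
    filter_upwards [(quasiMeasurePreserving_dilate ha hc).ae hp] with x hx k hk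
    have hk' : ((fun i => k (Sum.inl i), fun j => k (Sum.inr j)) : (p → ℤ) × (q → ℤ)) ≠ 0 := by
      intro h0
      apply hk
      ext i
      rcases i with i | i
      · exact congrFun (congrArg Prod.fst h0) i
      · exact congrFun (congrArg Prod.snd h0) i
    convert hx _ hk' using 3
    apply Prod.ext <;> ext i <;> simp [dilate] <;> ring
  have hchar : ∀ ζ, Continuous fun ξ : (p → ℝ) × (q → ℝ) => prodChar ξ ζ := fun ζ =>
    continuous_prodChar.comp (continuous_id.prodMk continuous_const)
  have key := tsum_enorm_sq_fourier_of_isPacking hg1 hg2 hgp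
  rw [lintegral_dilate ha hc (hm.enorm.pow_const 2), ← key, ← mul_assoc, ← ENNReal.tsum_mul_left,
    ← (Equiv.sumArrowEquivProdArrow p q ℤ).tsum_eq]
  refine tsum_congr fun n => ?_
  -- The dilation contributes its Jacobian once to ∫ |h|² but squared to the coefficients; the
  -- surplus power is the constant on the right.
  rw [integral_dilate (g := fun ξ => _ * h ξ) ha hc ((hchar _).stronglyMeasurable.mul hm), enorm_mul, mul_pow, ← sq]
  congr 2
  · rw [← hC, ← ofReal_norm, Complex.norm_real, Real.norm_of_nonneg hpos.le]
  · congr 1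
    refine integral_congr_ae (Eventually.of_forall fun x => ?_)
    simp only [prodChar, dilate]
    congr 3
    rw [Fintype.sum_sum_type]
    norm_cast
    simp only [dotProduct]
    congr 1
    · refine Finset.sum_congr rfl fun i _ => ?_
      have := (ha i).ne'
      simp only [Equiv.sumArrowEquivProdArrow, Equiv.coe_fn_mk, Function.comp_apply]
      field_simp
    · refine Finset.sum_congr rfl fun i _ => ?_
      have := (hc i).ne'
      simp only [Equiv.sumArrowEquivProdArrow, Equiv.coe_fn_mk, Function.comp_apply]
      field_simp

end FourierSeriesProd

/-! ### Greedy construction of a set packing under two actions -/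

section Greedy

variable {X G H : Type*} [AddGroup G] [AddGroup H]

/-- The `n`-th stage of the greedy construction of a set that meets every orbit of `α` and of `β`
at most once: the points of the `n`-th piece whose orbits avoid the set built so far are added. -/
def greedySet (α : G → X → X) (β : H → X → X) (piece : ℕ → Set X) : ℕ → Set X
  | 0 => ∅
  | n + 1 => greedySet α β piece n ∪ {x ∈ piece n |
      (∀ g, α g x ∉ greedySet α β piece n) ∧ ∀ r, β r x ∉ greedySet α β piece n}

omit [AddGroup G] [AddGroup H] in
theorem greedySet_mono (α : G → X → X) (β : H → X → X) (piece : ℕ → Set X) :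
    Monotone (greedySet α β piece) :=
  monotone_nat_of_le_succ fun _ => Set.subset_union_left

-- A new point has no translate in the old set, and two new points lie in the same piece, which
-- meets each orbit at most once. An old point with a new translate reduces to the first case by
-- applying -g.
omit [AddGroup H] in
theorem greedySet_packing_left {α : G → X → X} (β : H → X → X) {piece : ℕ → Set X}
    (hα : ∀ g x, α (-g) (α g x) = x) (hp : ∀ n x g, x ∈ piece n → α g x ∈ piece n → g = 0) (n : ℕ)
    (x : X) (g : G) (hx : x ∈ greedySet α β piece n) (hgx : α g x ∈ greedySet α β piece n) :
    g = 0 := by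
  induction n with
  | zero => exact absurd hx (Set.notMem_empty x)
  | succ n ih =>
    rcases hx with hx | ⟨hx, hx1, -⟩
    · rcases hgx with hgx | ⟨-, hgx1, -⟩
      · exact ih hx hgx
      · exact absurd hx (by simpa [hα] using hgx1 (-g))
    · rcases hgx with hgx | ⟨hgx, -⟩
      · exact absurd hgx (hx1 g)
      · exact hp n x g hx hgx

omit [AddGroup G] in
theorem greedySet_packing_right (α : G → X → X) {β : H → X → X} {piece : ℕ → Set X}
    (hβ : ∀ r x, β (-r) (β r x) = x) (hp : ∀ n x r, x ∈ piece n → β r x ∈ piece n → r = 0) (n : ℕ)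
    (x : X) (r : H) (hx : x ∈ greedySet α β piece n) (hrx : β r x ∈ greedySet α β piece n) :
    r = 0 := by
  induction n with
  | zero => exact absurd hx (Set.notMem_empty x)
  | succ n ih =>
    rcases hx with hx | ⟨hx, -, hx1⟩
    · rcases hrx with hrx | ⟨-, -, hrx1⟩
      · exact ih hx hrx
      · exact absurd hx (by simpa [hβ] using hrx1 (-r))
    · rcases hrx with hrx | ⟨hrx, -⟩
      · exact absurd hrx (hx1 r)
      · exact hp n x r hx hrx

omit [AddGroup G] [AddGroup H] in
theorem measurableSet_greedySet [MeasurableSpace X] [Countable G] [Countable H] {α : G → X → X}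
    {β : H → X → X} {piece : ℕ → Set X} (hα : ∀ g, Measurable (α g)) (hβ : ∀ r, Measurable (β r))
    (hp : ∀ n, MeasurableSet (piece n)) (n : ℕ) : MeasurableSet (greedySet α β piece n) := by
  induction n with
  | zero => exact MeasurableSet.empty
  | succ n ih =>
    have h1 : MeasurableSet {x | ∀ g, α g x ∉ greedySet α β piece n} := by
      rw [Set.ofPred_forall]
      exact MeasurableSet.iInter fun g => (hα g ih).compl
    have h2 : MeasurableSet {x | ∀ r, β r x ∉ greedySet α β piece n} := by
      rw [Set.ofPred_forall]
      exact MeasurableSet.iInter fun r => (hβ r ih).compl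
    exact ih.union ((hp n).inter (h1.inter h2))

/-- Given two actions of countable groups with measurable cross sections, there is a measurable
set that meets every orbit of either action at most once and that is maximal with this property. -/
theorem exists_maximal_packing [MeasurableSpace X] [Countable G] [Countable H] {α : G → X → X}
    {β : H → X → X} (hα : ∀ g, Measurable (α g)) (hβ : ∀ r, Measurable (β r))
    (hα0 : ∀ x, α 0 x = x)
    (hα' : ∀ g x, α (-g) (α g x) = x) (hβ' : ∀ r x, β (-r) (β r x) = x)
    {c : X → G} {c' : X → H} (hc : ∀ g, MeasurableSet {x | c x = g})
    (hc' : ∀ r, MeasurableSet {x | c' x = r}) (hcα : ∀ g x, c (α g x) = g + c x)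
    (hcβ : ∀ r x, c' (β r x) = r + c' x) :
    ∃ E : Set X, MeasurableSet E ∧ (∀ x g, x ∈ E → α g x ∈ E → g = 0) ∧
      (∀ x r, x ∈ E → β r x ∈ E → r = 0) ∧ ∀ x, (∃ g, α g x ∈ E) ∨ ∃ r, β r x ∈ E := by
  obtain ⟨f, hf⟩ := exists_surjective_nat (G × H)
  -- The maps c and c' shift by the acting element, so a joint level set meets each orbit at most
  -- once. Countably many level sets exhaust X.
  set piece : ℕ → Set X := fun n => {x | c x = (f n).1 ∧ c' x = (f n).2} with hpiece
  have hp1 : ∀ n x g, x ∈ piece n → α g x ∈ piece n → g = 0 := by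
    rintro n x g ⟨h1, -⟩ ⟨h2, -⟩
    rw [hcα, ← h1] at h2
    simpa using h2
  have hp2 : ∀ n x r, x ∈ piece n → β r x ∈ piece n → r = 0 := by
    rintro n x r ⟨-, h1⟩ ⟨-, h2⟩
    rw [hcβ, ← h1] at h2
    simpa using h2
  have hmono := greedySet_mono α β piece
  refine ⟨⋃ n, greedySet α β piece n, MeasurableSet.iUnion fun n =>
    measurableSet_greedySet hα hβ (fun n => (hc _).inter (hc' _)) n, ?_, ?_, ?_⟩
  · intro x g hx hgx
    obtain ⟨i, hi⟩ := Set.mem_iUnion.1 hx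
    obtain ⟨j, hj⟩ := Set.mem_iUnion.1 hgx
    exact greedySet_packing_left β hα' hp1 (max i j) x g (hmono (le_max_left i j) hi)
      (hmono (le_max_right i j) hj)
  · intro x r hx hrx
    obtain ⟨i, hi⟩ := Set.mem_iUnion.1 hx
    obtain ⟨j, hj⟩ := Set.mem_iUnion.1 hrx
    exact greedySet_packing_right α hβ' hp2 (max i j) x r (hmono (le_max_left i j) hi)
      (hmono (le_max_right i j) hj)
  · intro x
    obtain ⟨n, hn⟩ := hf (c x, c' x)
    by_contra! hcon
    -- If both orbits of x missed the union, x would have been added when its own piece was treated.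
    have hx : x ∈ greedySet α β piece (n + 1) := by
      refine Or.inr ⟨⟨by rw [hn], by rw [hn]⟩, fun g hg => ?_, fun r hr => ?_⟩
      · exact hcon.1 g (Set.mem_iUnion.2 ⟨n, hg⟩)
      · exact hcon.2 r (Set.mem_iUnion.2 ⟨n, hr⟩)
    exact hcon.1 0 (by rw [hα0]; exact Set.mem_iUnion.2 ⟨_, hx⟩)

end Greedy

/-! ### Volumes of packing sets and of sets invariant under two lattices -/

section Density

variable {ι : Type*} [Fintype ι] {L L' : AddSubgroup (ι → ℝ)} [Countable L] [Countable L']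
  {D D' : Set (ι → ℝ)}

/-- Cut F along the translates of D and move the pieces back into D: packing keeps them disjoint,
and their union is the part of D whose orbits meet F. -/
theorem measure_eq_of_packing (hD : IsAddFundamentalDomain L D) {F : Set (ι → ℝ)}
    (hF : MeasurableSet F) (hp : ∀ x, ∀ k ∈ L, x ∈ F → k + x ∈ F → k = 0) :
    volume F = volume ({x | ∃ k ∈ L, k + x ∈ F} ∩ D) := by
  rw [hD.measure_eq_tsum, ← measure_iUnion₀]
  · congr 1
    ext x
    simp only [Set.mem_iUnion, Set.mem_inter_iff, Set.mem_ofPred_eq, Set.mem_vadd_set_iff_neg_vadd_mem]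
    constructor
    · rintro ⟨k, hk, hx⟩
      exact ⟨⟨-k, L.neg_mem k.2, hk⟩, hx⟩
    · rintro ⟨⟨k, hkL, hk⟩, hx⟩
      exact ⟨-⟨k, hkL⟩, by simpa [AddSubgroup.vadd_def] using hk, hx⟩
  · intro k l hkl
    refine Disjoint.aedisjoint (Set.disjoint_left.2 ?_)
    rintro x ⟨hk, -⟩ ⟨hl, -⟩
    rw [Set.mem_vadd_set_iff_neg_vadd_mem] at hk hl
    apply hkl
    have := hp (-(k : ι → ℝ) + x) ((k : ι → ℝ) - l) (L.sub_mem k.2 l.2) hk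
      (by convert hl using 1; simp only [AddSubgroup.vadd_def, AddSubgroup.coe_neg, vadd_eq_add]; abel)
    exact Subtype.ext (sub_eq_zero.1 this)
  · intro k
    exact ((hF.const_vadd k).nullMeasurableSet).inter hD.nullMeasurableSet

/-- The density of a set invariant under both lattices does not depend on the lattice used to
compute it. Integrate the indicator of A at x + y over D × D' in both orders; by invariance each
inner integral is constant. -/
theorem measure_inter_mul_eq (hD : IsAddFundamentalDomain L D)
    (hD' : IsAddFundamentalDomain L' D') {A : Set (ι → ℝ)} (hA : MeasurableSet A)
    (hL : ∀ k ∈ L, ∀ x, k + x ∈ A ↔ x ∈ A) (hL' : ∀ k ∈ L', ∀ x, k + x ∈ A ↔ x ∈ A) :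
    volume (A ∩ D) * volume D' = volume (A ∩ D') * volume D := by
  have key : ∀ (L : AddSubgroup (ι → ℝ)) [Countable L] (D : Set (ι → ℝ)),
      IsAddFundamentalDomain L D → (∀ k ∈ L, ∀ x, k + x ∈ A ↔ x ∈ A) → ∀ y,
      ∫⁻ x in D, A.indicator 1 (x + y) = volume (A ∩ D) := by
    intro L _ D hD hL y
    have h1 := (hD.vadd_of_comm y).measure_set_eq hD hA fun k => by
      ext x; exact hL k k.2 x
    rw [← h1]
    have h2 : ∀ x, A.indicator (1 : (ι → ℝ) → ℝ≥0∞) (x + y) =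
        ((fun x => x + y) ⁻¹' A).indicator 1 x := fun x => rfl
    simp only [h2]
    rw [lintegral_indicator_one ((measurable_add_const y) hA), Measure.restrict_apply
      ((measurable_add_const y) hA)]
    have h3 := (measurePreserving_add_right (volume : Measure (ι → ℝ)) y).measure_preimage_equiv
      (f := MeasurableEquiv.addRight y) (A ∩ (y +ᵥ D))
    rw [← h3]
    congr 1
    ext x
    simp only [Set.mem_inter_iff, Set.mem_preimage, MeasurableEquiv.coe_addRight,
      Set.mem_vadd_set_iff_neg_vadd_mem, vadd_eq_add]
    rw [show -y + (x + y) = x by abel]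
  have hsw := lintegral_lintegral_swap (μ := volume.restrict D) (ν := volume.restrict D')
    (f := fun x y => A.indicator (1 : (ι → ℝ) → ℝ≥0∞) (x + y)) (by
      refine Measurable.aemeasurable ?_
      exact (measurable_one.indicator hA).comp (measurable_fst.add measurable_snd))
  have e1 : ∀ x, ∫⁻ y in D', A.indicator (1 : (ι → ℝ) → ℝ≥0∞) (x + y) = volume (A ∩ D') := by
    intro x
    simp only [add_comm x]
    exact key L' D' hD' hL' x
  simp only [e1, key L D hD hL, lintegral_const, Measure.restrict_apply_univ] at hsw
  exact hsw.symm

/-- A set that packs under two lattices, is maximal with this property, and such that the first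
lattice has the smaller covolume, is a fundamental domain of the first lattice. -/
theorem isAddFundamentalDomain_of_maximal_packing (hD : IsAddFundamentalDomain L D)
    (hD' : IsAddFundamentalDomain L' D') (hle : volume D ≤ volume D') (hD0 : volume D ≠ 0)
    (hfin' : volume D' ≠ ∞) {E : Set (ι → ℝ)} (hE : MeasurableSet E)
    (hp : ∀ x, ∀ k ∈ L, x ∈ E → k + x ∈ E → k = 0)
    (hp' : ∀ x, ∀ k ∈ L', x ∈ E → k + x ∈ E → k = 0)
    (hmax : ∀ x, (∃ k ∈ L, k + x ∈ E) ∨ ∃ k ∈ L', k + x ∈ E) :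
    IsAddFundamentalDomain L E := by
  have hfin : volume D ≠ ∞ := ne_top_of_le_ne_top hfin' hle
  -- A is the set missed by the L-translates of E, to be shown null. Its saturation A' under L' is
  -- invariant under both lattices, since translations commute.
  set A : Set (ι → ℝ) := {x | ∀ k : L, (k : ι → ℝ) + x ∉ E} with hA
  have hAm : MeasurableSet A := by
    have : A = ⋂ k : L, ((fun x => (k : ι → ℝ) + x) ⁻¹' E)ᶜ := by ext; simp [hA]
    exact this ▸ MeasurableSet.iInter fun k => ((measurable_const_add _) hE).compl
  have hAL : ∀ k ∈ L, ∀ x, k + x ∈ A → x ∈ A := by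
    intro k hk x hx l hl
    have := hx (l - ⟨k, hk⟩)
    rw [AddSubgroup.coe_sub] at this
    exact this (by convert hl using 1; dsimp only; abel)
  set A' : Set (ι → ℝ) := {x | ∃ m : L', (m : ι → ℝ) + x ∈ A} with hA'
  have hA'm : MeasurableSet A' := by
    have : A' = ⋃ m : L', (fun x => (m : ι → ℝ) + x) ⁻¹' A := by ext; simp [hA']
    exact this ▸ MeasurableSet.iUnion fun m => (measurable_const_add _) hAm
  have hinv : ∀ (K : AddSubgroup (ι → ℝ)), (∀ k ∈ K, ∀ x, k + x ∈ A' → x ∈ A') →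
      ∀ k ∈ K, ∀ x, k + x ∈ A' ↔ x ∈ A' := fun K h k hk x =>
    ⟨h k hk x, fun hx => h (-k) (K.neg_mem hk) _ (by rwa [neg_add_cancel_left])⟩
  have hA'L : ∀ k ∈ L, ∀ x, k + x ∈ A' ↔ x ∈ A' := by
    refine hinv L ?_
    rintro k hk x ⟨m, hm⟩
    exact ⟨m, hAL k hk _ (by rwa [add_left_comm])⟩
  have hA'L' : ∀ k ∈ L', ∀ x, k + x ∈ A' ↔ x ∈ A' := by
    refine hinv L' ?_
    rintro k hk x ⟨m, hm⟩
    refine ⟨m + ⟨k, hk⟩, ?_⟩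
    rwa [AddSubgroup.coe_add, add_assoc]
  have hAA' : A ⊆ A' := fun x hx => ⟨0, by simpa using hx⟩
  have hEm : MeasurableSet (E ∩ A') := hE.inter hA'm
  -- By maximality, the L'-orbit of a point of A meets E. So inside A' the set E is a fundamental
  -- domain for L'.
  have h1 : volume (E ∩ A') = volume (A' ∩ D') := by
    rw [measure_eq_of_packing hD' hEm fun x k hk hx hkx => hp' x k hk hx.1 hkx.1]
    congr 2
    ext x
    simp only [Set.mem_ofPred_eq, Set.mem_inter_iff]
    constructor
    · rintro ⟨k, hk, -, hx⟩
      exact (hA'L' k hk x).1 hx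
    · intro hx
      obtain ⟨m, hm⟩ := hx
      rcases hmax ((m : ι → ℝ) + x) with ⟨k, hk, hkE⟩ | ⟨k, hk, hkE⟩
      · exact absurd hkE (hm ⟨k, hk⟩)
      · refine ⟨k + m, L'.add_mem hk m.2, by rwa [add_assoc], ?_⟩
        exact (hA'L' _ (L'.add_mem hk m.2) x).2 ⟨m, hm⟩
  -- Under L, the set E only packs inside A', and its translates leave out all of A.
  have h2 : volume (E ∩ A') + volume (A ∩ D) ≤ volume (A' ∩ D) := by
    rw [measure_eq_of_packing hD hEm fun x k hk hx hkx => hp x k hk hx.1 hkx.1,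
      ← measure_union₀]
    · refine measure_mono ?_
      rintro x (⟨⟨k, hk, -, hx⟩, hxD⟩ | ⟨hx, hxD⟩)
      · exact ⟨(hA'L k hk x).1 hx, hxD⟩
      · exact ⟨hAA' hx, hxD⟩
    · exact hAm.nullMeasurableSet.inter hD.nullMeasurableSet
    · refine Disjoint.aedisjoint (Set.disjoint_left.2 ?_)
      rintro x ⟨⟨k, hk, hx, -⟩, -⟩ ⟨hxA, -⟩
      exact hxA ⟨k, hk⟩ hx
  have h3 := measure_inter_mul_eq hD hD' hA'm hA'L hA'L'
  -- Equal densities and the smaller covolume of L give this inequality. With the two volume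
  -- relations above it leaves no room for A ∩ D.
  have h4 : volume (A' ∩ D) ≤ volume (A' ∩ D') := by
    have : volume (A' ∩ D) * volume D ≤ volume (A' ∩ D') * volume D :=
      (mul_le_mul_right hle _).trans h3.le
    exact (ENNReal.mul_le_mul_iff_left hD0 hfin).1 this
  have h5 : volume (A ∩ D) = 0 := by
    rw [h1] at h2
    have h6 : volume (A' ∩ D') ≠ ∞ := ne_top_of_le_ne_top hfin' (measure_mono Set.inter_subset_right)
    have h7 : volume (A' ∩ D') + volume (A ∩ D) ≤ volume (A' ∩ D') + 0 := by
      rw [add_zero]; exact h2.trans h4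
    exact le_antisymm ((ENNReal.add_le_add_iff_left h6).1 h7) bot_le
  have h6 : volume A = 0 := by
    refine hD.measure_zero_of_invariant A (fun k => ?_) h5
    ext x
    rw [Set.mem_vadd_set_iff_neg_vadd_mem]
    refine ⟨fun hx => hAL _ (L.neg_mem k.2) x hx, fun hx => hAL k k.2 _ ?_⟩
    simpa [AddSubgroup.vadd_def] using hx
  refine IsAddFundamentalDomain.mk'' hE.nullMeasurableSet ?_ ?_ ?_
  · filter_upwards [measure_eq_zero_iff_ae_notMem.1 h6] with x hx
    simp only [hA, Set.mem_ofPred_eq, not_forall, not_not] at hx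
    exact hx
  · intro k hk
    refine Disjoint.aedisjoint (Set.disjoint_left.2 fun x hx hxE => hk ?_)
    rw [Set.mem_vadd_set_iff_neg_vadd_mem] at hx
    have := hp x (-k) (L.neg_mem k.2) hxE hx
    exact Subtype.ext (neg_eq_zero.1 this)
  · exact fun k => (measurePreserving_vadd k volume).quasiMeasurePreserving

end Density

/-! ### Measurable families of tiles -/

section Tile

variable {ι : Type*} [Fintype ι] [DecidableEq ι]

/-- The lattice `C ℤ^ι`. -/
def matrixLattice (C : Matrix ι ι ℝ) : AddSubgroup (ι → ℝ) :=
  ((C.mulVecLin.toAddMonoidHom).comp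
    (AddMonoidHom.pi fun i => (Int.castAddHom ℝ).comp (Pi.evalAddMonoidHom (fun _ : ι => ℤ) i))).range

omit [DecidableEq ι] in
theorem mem_matrixLattice {C : Matrix ι ι ℝ} {x : ι → ℝ} :
    x ∈ matrixLattice C ↔ ∃ n : ι → ℤ, C *ᵥ (fun i => (n i : ℝ)) = x := Iff.rfl

instance countable_matrixLattice (C : Matrix ι ι ℝ) : Countable (matrixLattice C) :=
  (Set.countable_range _).to_subtype

/-- The image of the half-open unit cube under C works: the unique translate bringing x into it is
read off from the integer parts of C⁻¹ x. -/
theorem exists_isAddFundamentalDomain_matrixLattice {C : Matrix ι ι ℝ} (hC : C.det ≠ 0) :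
    ∃ D : Set (ι → ℝ), IsAddFundamentalDomain (matrixLattice C) D ∧
      volume D = ENNReal.ofReal |C.det| := by
  have hu : IsUnit C.det := hC.isUnit
  set D : Set (ι → ℝ) := (Matrix.toLin' C⁻¹) ⁻¹' Set.univ.pi fun _ => Set.Ico 0 1 with hD
  have hinv : ∀ y, C⁻¹ *ᵥ (C *ᵥ y) = y := fun y => by
    rw [Matrix.mulVec_mulVec, Matrix.nonsing_inv_mul C hu, Matrix.one_mulVec]
  have hmem : ∀ x (n : ι → ℤ), C *ᵥ (fun i => (n i : ℝ)) + x ∈ D ↔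
      ∀ i, ⌊(C⁻¹ *ᵥ x) i⌋ = -n i := by
    intro x n
    simp only [hD, Set.mem_preimage, Matrix.toLin'_apply, Matrix.mulVec_add, hinv, Set.mem_pi,
      Set.mem_univ, true_imp_iff, Pi.add_apply, Set.mem_Ico]
    refine forall_congr' fun i => ?_
    rw [Int.floor_eq_iff]
    push_cast
    constructor <;> rintro ⟨h1, h2⟩ <;> constructor <;> linarith
  have hDm : MeasurableSet D :=
    (LinearMap.continuous_of_finiteDimensional (Matrix.toLin' C⁻¹)).measurable
      (MeasurableSet.univ_pi fun _ => measurableSet_Ico)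
  refine ⟨D, IsAddFundamentalDomain.mk' hDm.nullMeasurableSet fun x => ?_, ?_⟩
  · refine ⟨⟨C *ᵥ (fun i => ((-⌊(C⁻¹ *ᵥ x) i⌋ : ℤ) : ℝ)), _, rfl⟩, ?_, ?_⟩
    · exact (hmem x _).2 fun i => (neg_neg _).symm
    · rintro ⟨-, n, rfl⟩ hn
      have h1 := (hmem x n).1 hn
      apply Subtype.ext
      show C *ᵥ (fun i => (n i : ℝ)) = C *ᵥ _
      congr 1
      ext i
      rw [h1 i, neg_neg]
  · have hdet : LinearMap.det (Matrix.toLin' C⁻¹) ≠ 0 := by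
      rw [LinearMap.det_toLin', Matrix.det_nonsing_inv, Ring.inverse_eq_inv']
      exact inv_ne_zero hC
    rw [hD, Measure.addHaar_preimage_linearMap volume hdet, LinearMap.det_toLin',
      Matrix.det_nonsing_inv, Ring.inverse_eq_inv', inv_inv, volume_pi, Measure.pi_pi]
    simp

/-- By Cramer's rule, the entries of the inverse are quotients of polynomials in the entries. -/
theorem measurable_matrix_inv {Λ : Type*} [MeasurableSpace Λ] {M : Λ → Matrix ι ι ℝ}
    (hM : ∀ i j, Measurable fun l => M l i j) (i j : ι) : Measurable fun l => (M l)⁻¹ i j := by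
  have hdet : ∀ N : Λ → Matrix ι ι ℝ, (∀ i j, Measurable fun l => N l i j) →
      Measurable fun l => (N l).det := fun N hN => by
    simp only [Matrix.det_apply]
    exact Finset.measurable_fun_sum _ fun s _ =>
      (Finset.measurable_fun_prod _ fun i _ => hN _ _).const_smul _
  simp only [Matrix.inv_def, Matrix.smul_apply, Ring.inverse_eq_inv', smul_eq_mul,
    Matrix.adjugate_apply]
  refine (hdet M hM).inv.mul (hdet _ fun i' j' => ?_)
  by_cases h : i' = j
  · subst h; simp
  · simpa [Matrix.updateRow_ne h] using hM i' j'

omit [DecidableEq ι] in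
theorem measurable_mulVec {Λ : Type*} [MeasurableSpace Λ] {M : Λ → Matrix ι ι ℝ}
    (hM : ∀ i j, Measurable fun l => M l i j) :
    Measurable fun w : Λ × (ι → ℝ) => M w.1 *ᵥ w.2 := by
  refine measurable_pi_lambda _ fun i => ?_
  simp only [Matrix.mulVec, dotProduct]
  exact Finset.measurable_fun_sum _ fun j _ =>
    ((hM i j).comp measurable_fst).mul ((measurable_pi_apply j).comp measurable_snd)

/-- A measurable family of sets that tile under the lattice `∏ (1 / b_i) ℤ` and pack under the
lattices `(M l)⁻¹ ∏ q_i ℤ`, when the covolume of the latter is at least that of the former. -/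
theorem exists_measurable_tile {Λ : Type*} [MeasurableSpace Λ] {M : Λ → Matrix ι ι ℝ}
    (hM : ∀ i j, Measurable fun l => M l i j) (hdet : ∀ l, (M l).det ≠ 0) {b q : ι → ℝ}
    (hb : ∀ i, 0 < b i) (hq : ∀ i, 0 < q i) :
    ∃ E : Set (Λ × (ι → ℝ)), MeasurableSet E ∧
      (∀ l x x', ∀ n : ι → ℤ, (l, x) ∈ E → (l, x') ∈ E →
        M l *ᵥ x' = M l *ᵥ x + (fun i => n i * q i) → n = 0) ∧
      ∀ l, |(M l).det| ≤ (∏ i, b i) * ∏ i, q i →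
        (∀ᵐ x, ∃ n₀ : ι → ℤ, ∀ n : ι → ℤ, (l, x - fun i => n i / b i) ∈ E ↔ n = n₀) ∧
        volume {x | (l, x) ∈ E} = ENNReal.ofReal (∏ i, b i)⁻¹ := by
  have hu : ∀ l, IsUnit (M l).det := fun l => (hdet l).isUnit
  have hMi : ∀ l y, M l *ᵥ ((M l)⁻¹ *ᵥ y) = y := fun l y => by
    rw [Matrix.mulVec_mulVec, Matrix.mul_nonsing_inv _ (hu l), Matrix.one_mulVec]
  have hiM : ∀ l y, (M l)⁻¹ *ᵥ (M l *ᵥ y) = y := fun l y => by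
    rw [Matrix.mulVec_mulVec, Matrix.nonsing_inv_mul _ (hu l), Matrix.one_mulVec]
  -- Both lattices act on the total space Λ × ℝ^ι and preserve its fibres. One greedy construction
  -- there yields a set that is jointly measurable in the parameter and the point.
  set α : (ι → ℤ) → Λ × (ι → ℝ) → Λ × (ι → ℝ) := fun n w => (w.1, w.2 + fun i => n i / b i)
  set β : (ι → ℤ) → Λ × (ι → ℝ) → Λ × (ι → ℝ) :=
    fun n w => (w.1, w.2 + (M w.1)⁻¹ *ᵥ fun i => n i * q i)
  set c : Λ × (ι → ℝ) → ι → ℤ := fun w i => ⌊b i * w.2 i⌋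
  set c' : Λ × (ι → ℝ) → ι → ℤ := fun w i => ⌊(M w.1 *ᵥ w.2) i / q i⌋
  have hlevel : ∀ (C : Λ × (ι → ℝ) → ι → ℤ), (∀ i, Measurable fun w => C w i) →
      ∀ n, MeasurableSet {w | C w = n} := fun C hC n => by
    simp only [funext_iff]
    rw [Set.ofPred_forall]
    exact MeasurableSet.iInter fun i => hC i (measurableSet_singleton (n i))
  obtain ⟨E, hEm, hE1, hE2, hE3⟩ := exists_maximal_packing (α := α) (β := β) (c := c) (c' := c')
    (fun n => by fun_prop)
    (fun n => by
      refine measurable_fst.prodMk (measurable_snd.add ?_)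
      exact (measurable_mulVec (measurable_matrix_inv hM)).comp
        (measurable_fst.prodMk measurable_const))
    (fun w => Prod.ext rfl (by ext i; simp [α])) (fun n w => by ext i <;> simp [α, neg_div])
    (fun n w => by
      refine Prod.ext rfl ?_
      simp only [β, add_assoc, ← Matrix.mulVec_add]
      rw [show ((fun i => (n i : ℝ) * q i) + fun i => (((-n) i : ℤ) : ℝ) * q i) = 0 by
        ext i; simp, Matrix.mulVec_zero, add_zero])
    (hlevel c fun i => Int.measurable_floor.comp (by fun_prop))
    (hlevel c' fun i => Int.measurable_floor.comp
      (((measurable_pi_apply i).comp (measurable_mulVec hM)).div_const _))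
    (fun n w => by
      ext i
      have := (hb i).ne'
      simp only [α, c, Pi.add_apply, mul_add, mul_div_cancel₀ _ this, Int.floor_add_intCast]
      exact add_comm _ _)
    (fun n w => by
      ext i
      have := (hq i).ne'
      simp only [β, c', Pi.add_apply, Matrix.mulVec_add, hMi, add_div, mul_div_cancel_right₀ _ this,
        Int.floor_add_intCast]
      exact add_comm _ _)
  refine ⟨E, hEm, ?_, ?_⟩
  · intro l x x' n hx hx' h
    refine hE2 (l, x) n hx ?_
    have : x' = x + (M l)⁻¹ *ᵥ fun i => n i * q i := by
      rw [← hiM l x', h, Matrix.mulVec_add, hiM]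
    rwa [this] at hx'
  · intro l hl
    have hbpos : 0 < ∏ i, b i := Finset.prod_pos fun i _ => hb i
    have hqpos : 0 < ∏ i, q i := Finset.prod_pos fun i _ => hq i
    set C : Matrix ι ι ℝ := Matrix.diagonal fun i => (b i)⁻¹ with hC
    set C' : Matrix ι ι ℝ := (M l)⁻¹ * Matrix.diagonal q with hC'
    have hCdet : C.det = (∏ i, b i)⁻¹ := by rw [hC, Matrix.det_diagonal, Finset.prod_inv_distrib]
    have hC'det : C'.det = (M l).det⁻¹ * ∏ i, q i := by
      rw [hC', Matrix.det_mul, Matrix.det_diagonal, Matrix.det_nonsing_inv, Ring.inverse_eq_inv']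
    have hCv : ∀ n : ι → ℤ, (C *ᵥ fun i => (n i : ℝ)) = fun i => n i / b i := fun n => by
      ext i; rw [hC, Matrix.mulVec_diagonal, div_eq_inv_mul]
    have hCv' : ∀ n : ι → ℤ, (C' *ᵥ fun i => (n i : ℝ)) = (M l)⁻¹ *ᵥ fun i => n i * q i :=
      fun n => by
        rw [hC', ← Matrix.mulVec_mulVec]
        congr 1
        ext i; rw [Matrix.mulVec_diagonal, mul_comm]
    have hmemC : ∀ y, y ∈ matrixLattice C ↔ ∃ n : ι → ℤ, (fun i => n i / b i) = y := fun y => by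
      rw [mem_matrixLattice]; simp only [hCv]
    have hmemC' : ∀ y, y ∈ matrixLattice C' ↔
        ∃ n : ι → ℤ, ((M l)⁻¹ *ᵥ fun i => n i * q i) = y := fun y => by
      rw [mem_matrixLattice]; simp only [hCv']
    obtain ⟨D, hD, hDv⟩ := exists_isAddFundamentalDomain_matrixLattice (C := C)
      (by rw [hCdet]; positivity)
    obtain ⟨D', hD', hDv'⟩ := exists_isAddFundamentalDomain_matrixLattice (C := C')
      (by rw [hC'det]; exact mul_ne_zero (inv_ne_zero (hdet l)) hqpos.ne')
    rw [hCdet, abs_of_pos (inv_pos.2 hbpos)] at hDv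
    have hEl : MeasurableSet {x | (l, x) ∈ E} := measurable_prodMk_left hEm
    have hfd : IsAddFundamentalDomain (matrixLattice C) {x | (l, x) ∈ E} := by
      refine isAddFundamentalDomain_of_maximal_packing hD hD' ?_ ?_ ?_ hEl ?_ ?_ ?_
      -- The covolumes are 1 / ∏ b and ∏ q / |det M|; their comparison is the assumed bound on the
      -- determinant.
      · rw [hDv, hDv', hC'det]
        refine ENNReal.ofReal_le_ofReal ?_
        rw [abs_mul, abs_inv, abs_of_pos hqpos, inv_mul_eq_div, le_div_iff₀ (abs_pos.2 (hdet l)),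
          inv_mul_le_iff₀ hbpos]
        exact hl
      · rw [hDv]; simpa using hbpos
      · rw [hDv']; exact ENNReal.ofReal_ne_top
      · intro x k hk hx hkx
        obtain ⟨n, rfl⟩ := (hmemC k).1 hk
        have : n = 0 := hE1 (l, x) n hx (by rwa [add_comm] at hkx)
        subst this
        ext i; simp
      · intro x k hk hx hkx
        obtain ⟨n, rfl⟩ := (hmemC' k).1 hk
        have : n = 0 := hE2 (l, x) n hx (by rwa [add_comm] at hkx)
        subst this
        simp [← Pi.zero_def]
      · intro x
        rcases hE3 (l, x) with ⟨n, hn⟩ | ⟨n, hn⟩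
        · exact Or.inl ⟨_, (hmemC _).2 ⟨n, rfl⟩, by rwa [add_comm]⟩
        · exact Or.inr ⟨_, (hmemC' _).2 ⟨n, rfl⟩, by rwa [add_comm]⟩
    refine ⟨?_, (hfd.measure_eq hD).trans hDv⟩
    filter_upwards [hfd.ae_covers] with x hx
    obtain ⟨⟨-, k, rfl⟩, hk⟩ := hx
    have hk' : (l, x - fun i => ((-k) i : ℤ) / b i) ∈ E := by
      have e : (x - fun i => (((-k) i : ℤ) : ℝ) / b i) = (C *ᵥ fun i => (k i : ℝ)) + x := by
        rw [hCv]; ext i; simp [neg_div, add_comm]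
      rw [e]; exact hk
    refine ⟨-k, fun n => ⟨fun hn => ?_, fun hn => hn ▸ hk'⟩⟩
    have := hE1 (l, x - fun i => n i / b i) (n - -k) hn (by
      convert hk' using 1
      refine Prod.ext rfl ?_
      ext i
      simp only [α, Pi.add_apply, Pi.sub_apply, Pi.neg_apply]
      push_cast
      ring)
    exact sub_eq_zero.1 this

end Tile

/-! ### The matrices B(λ) and the coordinates that produce the Plancherel transform -/

namespace AdaptedBasis

variable {𝔫 : Type*} [LieRing 𝔫] [LieAlgebra ℝ 𝔫] {m d : ℕ} (β : AdaptedBasis 𝔫 m d)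

theorem B_apply (lam : Fin m → ℝ) (i j : Fin d) :
    β.B lam i j = -∑ k, lam k * β.structConst i j k := by
  simp [B, functional, structConst, LinearMap.sum_apply]

theorem B_add_smul (lam lam' : Fin m → ℝ) (r : ℝ) : β.B (lam + r • lam') = β.B lam + r • β.B lam' := by
  ext i j
  simp only [B_apply, Matrix.add_apply, Matrix.smul_apply, Pi.add_apply, Pi.smul_apply, smul_eq_mul,
    add_mul, Finset.sum_add_distrib, mul_neg, Finset.mul_sum, mul_assoc]
  ring

theorem continuous_B_apply (i j : Fin d) : Continuous fun lam => β.B lam i j := by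
  simp only [B_apply]; fun_prop

theorem measurable_B_apply (i j : Fin d) : Measurable fun lam => β.B lam i j :=
  (β.continuous_B_apply i j).measurable

theorem continuous_det_B : Continuous fun lam => (β.B lam).det :=
  Continuous.matrix_det (continuous_matrix β.continuous_B_apply)

theorem dotProduct_bracket (lam : Fin m → ℝ) (x y : Fin d → ℝ) :
    lam ⬝ᵥ β.bracket x y = -(x ⬝ᵥ β.B lam *ᵥ y) := by
  simp only [dotProduct, bracket, Matrix.mulVec, B_apply, Finset.mul_sum, neg_mul,
    Finset.sum_neg_distrib, mul_neg, neg_neg, Finset.sum_mul]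
  rw [Finset.sum_comm]
  refine Finset.sum_congr rfl fun i _ => ?_
  rw [Finset.sum_comm]
  refine Finset.sum_congr rfl fun j _ => Finset.sum_congr rfl fun k _ => ?_
  ring

theorem lie_X_Y_eq (i j : Fin d) : ⁅β.X i, β.Y j⁆ = ∑ k, β.structConst i j k • β.Z k := by
  have h := N.lie_sum_X_sum_Y (β := β) (Pi.single i 1) (Pi.single j 1)
  have hb : β.bracket (Pi.single i 1) (Pi.single j 1) = fun k => β.structConst i j k := by
    ext k
    simp only [bracket, Pi.single_apply]
    simp
  rw [hb] at h
  simpa [Pi.single_apply] using h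

/-- Restrict ℓ to the center. A null vector y of B would put ∑ y_j Y_j in the radical of ℓ, hence in
the center, which is spanned by the Z_j; linear independence then forces y = 0. -/
theorem exists_det_B_ne_zero : ∃ lam, (β.B lam).det ≠ 0 := by
  obtain ⟨ℓ, hℓ⟩ := β.radical_eq_center
  refine ⟨fun k => ℓ (β.Z k), fun h0 => ?_⟩
  obtain ⟨y, hy0, hy⟩ := Matrix.exists_mulVec_eq_zero_iff.2 h0
  have hZ : ∀ (j : Fin m) (W : 𝔫), ⁅W, β.Z j⁆ = 0 := fun j W =>
    (LieModule.mem_maxTrivSubmodule ℝ 𝔫 𝔫 _).1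
      (show β.Z j ∈ (LieAlgebra.center ℝ 𝔫).toSubmodule from
        β.center_eq ▸ Submodule.subset_span ⟨j, rfl⟩) W
  set W : 𝔫 := ∑ j, y j • β.Y j with hW
  have hWc : W ∈ LieAlgebra.center ℝ 𝔫 := by
    refine (hℓ W).1 fun V => ?_
    have hlin : ℓ ∘ₗ (LieModule.toEnd ℝ 𝔫 𝔫 W) = 0 := by
      refine β.basis.ext fun s => ?_
      simp only [LinearMap.comp_apply, LieModule.toEnd_apply_apply, LinearMap.zero_apply]
      rcases s with j | j | i
      · have := hZ j W
        rw [Z] at this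
        rw [this, map_zero]
      · rw [hW, sum_lie]
        simp [Y, β.lie_Y_Y]
      · have h1 : ⁅W, β.X i⁆ = -∑ j, y j • ∑ k, β.structConst i j k • β.Z k := by
          rw [← lie_skew, hW, lie_sum]
          simp only [lie_smul, lie_X_Y_eq]
        have h2 := congrFun hy i
        simp only [Matrix.mulVec, dotProduct, B_apply, Pi.zero_apply] at h2
        rw [show β.basis (Sum.inr (Sum.inr i)) = β.X i from rfl, h1]
        simp only [map_neg, map_sum, map_smul, smul_eq_mul]
        rw [← h2, ← Finset.sum_neg_distrib]
        refine Finset.sum_congr rfl fun j _ => ?_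
        rw [neg_mul, mul_comm (y j)]
        congr 2
        exact Finset.sum_congr rfl fun k _ => mul_comm _ _
    exact LinearMap.congr_fun hlin V
  have hWs : W ∈ Submodule.span ℝ (Set.range fun j : Fin m => β.basis (Sum.inl j)) := by
    have : W ∈ (LieAlgebra.center ℝ 𝔫).toSubmodule := hWc
    rwa [β.center_eq] at this
  obtain ⟨c, hc⟩ := (Submodule.mem_span_range_iff_exists_fun ℝ).1 hWs
  apply hy0
  ext j
  have h1 : β.basis.repr W (Sum.inr (Sum.inl j)) = y j := by
    rw [hW]
    simp [Y, Finsupp.single_apply]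
  rw [← h1, ← hc]
  simp

/-- On every line in a direction λ₀ with B(λ₀) invertible, the determinant is a nonzero multiple of
a characteristic polynomial in the parameter, with finitely many zeros. Fubini gives one parameter r
that is good for almost every λ, and translation by r λ₀ removes it. -/
theorem ae_det_B_ne_zero : ∀ᵐ lam : Fin m → ℝ, (β.B lam).det ≠ 0 := by
  obtain ⟨lam₀, h0⟩ := β.exists_det_B_ne_zero
  have hfin : ∀ lam, ∀ᵐ r : ℝ, (β.B (lam + r • lam₀)).det ≠ 0 := by
    intro lam
    set A := (β.B lam₀)⁻¹ * β.B lam with hA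
    have hdet : ∀ r : ℝ, (β.B (lam + r • lam₀)).det = (β.B lam₀).det * (-A).charpoly.eval r := by
      intro r
      rw [Matrix.eval_charpoly, ← Matrix.det_mul, B_add_smul]
      congr 1
      rw [sub_neg_eq_add, mul_add, hA, ← mul_assoc, Matrix.mul_nonsing_inv _ h0.isUnit, one_mul,
        add_comm]
      congr 1
      ext i j
      simp [Matrix.mul_diagonal, mul_comm]
    have : {r : ℝ | ¬ (β.B (lam + r • lam₀)).det ≠ 0} ⊆ {r | (-A).charpoly.IsRoot r} := by
      intro r hr
      simp only [Set.mem_ofPred_eq, not_not, hdet, mul_eq_zero, h0, false_or] at hr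
      exact hr
    exact measure_mono_null this
      ((Polynomial.finite_setOfPred_isRoot (Matrix.charpoly_monic _).ne_zero).measure_zero _)
  have hm : MeasurableSet {w : (Fin m → ℝ) × ℝ | (β.B (w.1 + w.2 • lam₀)).det ≠ 0} := by
    have hc : Continuous fun w : (Fin m → ℝ) × ℝ => (β.B (w.1 + w.2 • lam₀)).det :=
      β.continuous_det_B.comp (by fun_prop)
    exact (measurableSet_eq_fun hc.measurable measurable_const).compl
  have h1 : ∀ᵐ w : (Fin m → ℝ) × ℝ, (β.B (w.1 + w.2 • lam₀)).det ≠ 0 :=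
    (Measure.ae_prod_iff_ae_ae hm).2 (Eventually.of_forall hfin)
  have h2 : ∀ᵐ r : ℝ, ∀ᵐ lam : Fin m → ℝ, (β.B (lam + r • lam₀)).det ≠ 0 := by
    have := Measure.ae_ae_of_ae_prod (Measure.measurePreserving_swap
      (μ := (volume : Measure ℝ)) (ν := (volume : Measure (Fin m → ℝ)))
      |>.quasiMeasurePreserving.ae h1)
    exact this
  obtain ⟨r, hr⟩ := h2.exists
  have h3 := (measurePreserving_sub_right (volume : Measure (Fin m → ℝ))
    (r • lam₀)).quasiMeasurePreserving.ae hr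
  filter_upwards [h3] with lam hlam
  rwa [sub_add_cancel] at hlam

theorem measurable_plancherelDensity :
    Measurable fun lam => ENNReal.ofReal |(β.B lam).det| :=
  (β.continuous_det_B.abs.measurable).ennreal_ofReal

theorem plancherelMeasure_ac : β.plancherelMeasure ≪ volume :=
  withDensity_absolutelyContinuous _ _

theorem ae_plancherel_det_ne_zero : ∀ᵐ lam ∂β.plancherelMeasure, (β.B lam).det ≠ 0 :=
  β.plancherelMeasure_ac.ae_le β.ae_det_B_ne_zero

instance sigmaFinite_plancherelMeasure : SigmaFinite β.plancherelMeasure :=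
  SigmaFinite.withDensity_ofReal _

instance sFinite_plancherelMeasure : SFinite β.plancherelMeasure := inferInstance

/-- The change of variables `(lam, t) ↦ (lam, B(lam)ᵀ t)`. -/
noncomputable def dualCoord (w : (Fin m → ℝ) × (Fin d → ℝ)) : (Fin m → ℝ) × (Fin d → ℝ) :=
  (w.1, (β.B w.1)ᵀ *ᵥ w.2)

noncomputable def dualCoordInv (w : (Fin m → ℝ) × (Fin d → ℝ)) : (Fin m → ℝ) × (Fin d → ℝ) :=
  (w.1, ((β.B w.1)ᵀ)⁻¹ *ᵥ w.2)

theorem measurable_dualCoord : Measurable β.dualCoord :=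
  measurable_fst.prodMk (measurable_mulVec fun i j => β.measurable_B_apply j i)

theorem measurable_dualCoordInv : Measurable β.dualCoordInv :=
  measurable_fst.prodMk
    (measurable_mulVec (measurable_matrix_inv fun i j => β.measurable_B_apply j i))

theorem dualCoordInv_dualCoord {w : (Fin m → ℝ) × (Fin d → ℝ)} (h : (β.B w.1).det ≠ 0) :
    β.dualCoordInv (β.dualCoord w) = w := by
  refine Prod.ext rfl ?_
  simp only [dualCoord, dualCoordInv]
  rw [Matrix.mulVec_mulVec, Matrix.nonsing_inv_mul _ (by rw [Matrix.det_transpose]; exact h.isUnit),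
    Matrix.one_mulVec]

theorem dualCoord_dualCoordInv {w : (Fin m → ℝ) × (Fin d → ℝ)} (h : (β.B w.1).det ≠ 0) :
    β.dualCoord (β.dualCoordInv w) = w := by
  refine Prod.ext rfl ?_
  simp only [dualCoord, dualCoordInv]
  rw [Matrix.mulVec_mulVec, Matrix.mul_nonsing_inv _ (by rw [Matrix.det_transpose]; exact h.isUnit),
    Matrix.one_mulVec]

/-- On almost every fibre, the Jacobian |det B(λ)|⁻¹ of the linear substitution cancels the
Plancherel density. -/
theorem lintegral_plancherel_prod {g : (Fin m → ℝ) × (Fin d → ℝ) → ℝ≥0∞} (hg : Measurable g) :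
    ∫⁻ w, g (β.dualCoord w) ∂(β.plancherelMeasure.prod volume) = ∫⁻ w, g w := by
  rw [lintegral_prod (fun w => g (β.dualCoord w))
      (hg.comp β.measurable_dualCoord).aemeasurable, plancherelMeasure,
    lintegral_withDensity_eq_lintegral_mul _ β.measurable_plancherelDensity
      (g := fun lam => ∫⁻ t, g (β.dualCoord (lam, t)))
      (hg.comp β.measurable_dualCoord).lintegral_prod_right']
  change _ = ∫⁻ w, g w ∂(volume.prod volume)
  rw [lintegral_prod _ hg.aemeasurable]
  refine lintegral_congr_ae ?_
  filter_upwards [β.ae_det_B_ne_zero] with lam h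
  have hdet : ((β.B lam)ᵀ).det ≠ 0 := by rwa [Matrix.det_transpose]
  have hm : Measurable fun y => g (lam, y) := hg.comp measurable_prodMk_left
  have hL : Measurable (Matrix.toLin' (β.B lam)ᵀ) :=
    (LinearMap.continuous_of_finiteDimensional _).measurable
  have h1 : ∫⁻ t, g (lam, (β.B lam)ᵀ *ᵥ t) =
      ENNReal.ofReal |((β.B lam).det)⁻¹| * ∫⁻ y, g (lam, y) := by
    have := lintegral_map (μ := volume) hm hL
    rw [Real.map_matrix_volume_pi_eq_smul_volume_pi hdet, lintegral_smul_measure,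
      Matrix.det_transpose] at this
    exact this.symm
  simp only [Pi.mul_apply, dualCoord]
  rw [h1, ← mul_assoc, ← ENNReal.ofReal_mul (abs_nonneg _), ← abs_mul, mul_inv_cancel₀ h]
  simp

theorem measurePreserving_dualCoord :
    MeasurePreserving β.dualCoord (β.plancherelMeasure.prod volume) volume := by
  refine ⟨β.measurable_dualCoord, Measure.ext_of_lintegral _ fun g hg => ?_⟩
  rw [lintegral_map hg β.measurable_dualCoord, lintegral_plancherel_prod _ hg]

/-- The map `(lam, (t, s)) ↦ (t - s, (lam, B(lam)ᵀ t))`. -/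
noncomputable def kernelCoord (w : (Fin m → ℝ) × ((Fin d → ℝ) × (Fin d → ℝ))) :
    (Fin d → ℝ) × ((Fin m → ℝ) × (Fin d → ℝ)) :=
  (w.2.1 - w.2.2, β.dualCoord (w.1, w.2.1))

noncomputable def kernelCoordInv (w : (Fin d → ℝ) × ((Fin m → ℝ) × (Fin d → ℝ))) :
    (Fin m → ℝ) × ((Fin d → ℝ) × (Fin d → ℝ)) :=
  (w.2.1, ((β.dualCoordInv w.2).2, (β.dualCoordInv w.2).2 - w.1))

theorem measurable_kernelCoord : Measurable β.kernelCoord := by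
  refine Measurable.prodMk (by fun_prop) (β.measurable_dualCoord.comp (by fun_prop))

theorem measurable_kernelCoordInv : Measurable β.kernelCoordInv := by
  have h : Measurable fun w : (Fin d → ℝ) × ((Fin m → ℝ) × (Fin d → ℝ)) =>
      (β.dualCoordInv w.2).2 := (β.measurable_dualCoordInv.comp measurable_snd).snd
  exact (measurable_snd.fst).prodMk (h.prodMk (h.sub measurable_fst))

/-- These are the coordinates in which the kernel of π_λ(f) is the partial Fourier transform of f.
That they preserve measure is what makes the Plancherel transform unitary. -/
theorem measurePreserving_kernelCoord :
    MeasurePreserving β.kernelCoord (β.plancherelMeasure.prod volume)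
      ((volume : Measure (Fin d → ℝ)).prod (volume : Measure ((Fin m → ℝ) × (Fin d → ℝ)))) := by
  refine ⟨β.measurable_kernelCoord, Measure.ext_of_lintegral _ fun g hg => ?_⟩
  rw [lintegral_map hg β.measurable_kernelCoord,
    lintegral_prod (fun w => g (β.kernelCoord w))
      (hg.comp β.measurable_kernelCoord).aemeasurable]
  have h1 : ∀ lam, ∫⁻ ts : (Fin d → ℝ) × (Fin d → ℝ), g (β.kernelCoord (lam, ts)) =
      ∫⁻ t, ∫⁻ x, g (x, β.dualCoord (lam, t)) := by
    intro lam
    change ∫⁻ ts : (Fin d → ℝ) × (Fin d → ℝ), g (β.kernelCoord (lam, ts)) ∂(volume.prod volume) = _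
    rw [lintegral_prod (fun ts => g (β.kernelCoord (lam, ts)))
      (hg.comp (β.measurable_kernelCoord.comp measurable_prodMk_left)).aemeasurable]
    refine lintegral_congr fun t => ?_
    exact lintegral_sub_left_eq_self (fun x => g (x, β.dualCoord (lam, t))) t
  have hG : Measurable fun w => ∫⁻ x, g (x, w) :=
    Measurable.lintegral_prod_left' hg
  simp only [h1]
  rw [← lintegral_prod (fun w => ∫⁻ x, g (x, β.dualCoord w))
    (hG.comp β.measurable_dualCoord).aemeasurable, lintegral_plancherel_prod _ hG,
    lintegral_prod_symm _ hg.aemeasurable]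

theorem kernelCoordInv_kernelCoord_ae :
    ∀ᵐ w ∂(β.plancherelMeasure.prod (volume : Measure ((Fin d → ℝ) × (Fin d → ℝ)))),
      β.kernelCoordInv (β.kernelCoord w) = w := by
  filter_upwards [Measure.quasiMeasurePreserving_fst.ae β.ae_plancherel_det_ne_zero] with w hw
  have := β.dualCoordInv_dualCoord (w := (w.1, w.2.1)) hw
  simp only [kernelCoordInv, kernelCoord]
  rw [this]
  refine Prod.ext rfl (Prod.ext rfl ?_)
  simp

/-- The map `(x, (z, y)) ↦ (z, y, x)`. -/
noncomputable def groupCoord (w : (Fin d → ℝ) × ((Fin m → ℝ) × (Fin d → ℝ))) : β.N := N.mk w.2.1 w.2.2 w.1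

noncomputable def groupCoordInv (g : β.N) : (Fin d → ℝ) × ((Fin m → ℝ) × (Fin d → ℝ)) :=
  (N.xc g, (N.zc g, N.yc g))

theorem measurePreserving_groupCoord :
    MeasurePreserving β.groupCoord
      ((volume : Measure (Fin d → ℝ)).prod (volume : Measure ((Fin m → ℝ) × (Fin d → ℝ))))
      volume := by
  have h1 := Measure.measurePreserving_swap (μ := (volume : Measure (Fin d → ℝ)))
    (ν := (volume : Measure (Fin m → ℝ)).prod (volume : Measure (Fin d → ℝ)))
  exact (measurePreserving_prodAssoc (volume : Measure (Fin m → ℝ))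
    (volume : Measure (Fin d → ℝ)) (volume : Measure (Fin d → ℝ))).comp h1

theorem measurable_zc : Measurable (N.zc : β.N → _) :=
  (measurable_fst : Measurable (Prod.fst : (Fin m → ℝ) × (Fin d → ℝ) × (Fin d → ℝ) → _))

theorem measurable_yc : Measurable (N.yc : β.N → _) :=
  (measurable_snd.fst : Measurable fun g : (Fin m → ℝ) × (Fin d → ℝ) × (Fin d → ℝ) => g.2.1)

theorem measurable_xc : Measurable (N.xc : β.N → _) :=
  (measurable_snd.snd : Measurable fun g : (Fin m → ℝ) × (Fin d → ℝ) × (Fin d → ℝ) => g.2.2)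

theorem measurable_groupCoordInv : Measurable β.groupCoordInv :=
  β.measurable_xc.prodMk (β.measurable_zc.prodMk β.measurable_yc)

/-- Transport of `L²(N)` to the coordinates `(x, (z, y))`. -/
noncomputable def groupCoordEquiv :
    β.L2N ≃ₗᵢ[ℂ] Lp ℂ 2 ((volume : Measure (Fin d → ℝ)).prod
      (volume : Measure ((Fin m → ℝ) × (Fin d → ℝ)))) :=
  compEquiv β.groupCoord β.measurePreserving_groupCoord β.groupCoordInv β.measurable_groupCoordInv
    (Eventually.of_forall fun _ => rfl)

/-- Transport to the coordinates `(lam, (t, s))` of the kernels of the Fourier transform. -/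
noncomputable def kernelCoordEquiv :
    Lp ℂ 2 ((volume : Measure (Fin d → ℝ)).prod
      (volume : Measure ((Fin m → ℝ) × (Fin d → ℝ)))) ≃ₗᵢ[ℂ] β.HSField :=
  compEquiv β.kernelCoord β.measurePreserving_kernelCoord β.kernelCoordInv
    β.measurable_kernelCoordInv β.kernelCoordInv_kernelCoord_ae

/-- The Plancherel transform. -/
noncomputable def plancherel : β.L2N ≃ₗᵢ[ℂ] β.HSField :=
  β.groupCoordEquiv.trans ((sliceMap fourierProd volume).trans β.kernelCoordEquiv)

end AdaptedBasis

/-! ### Dense integrable functions and multiplication by phases -/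

section General

theorem integral_comp_of_measurePreserving {α β : Type*} [MeasurableSpace α] [MeasurableSpace β]
    {μ : Measure α} {ν : Measure β} {τ : α → β} (hτ : MeasurePreserving τ μ ν) {g : β → ℂ}
    (hg : AEStronglyMeasurable g ν) : ∫ x, g (τ x) ∂μ = ∫ y, g y ∂ν := by
  rw [← hτ.map_eq] at hg ⊢
  exact (integral_map hτ.measurable.aemeasurable hg).symm

theorem dense_integrable_Lp {α : Type*} [MeasurableSpace α] (μ : Measure α) :
    Dense {f : Lp ℂ 2 μ | Integrable f μ} := by
  refine (Lp.simpleFunc.denseRange (E := ℂ) (μ := μ) (p := 2) (by norm_num)).mono ?_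
  rintro _ ⟨f, rfl⟩
  have h1 : MemLp (Lp.simpleFunc.toSimpleFunc f) 2 μ := Lp.simpleFunc.memLp f
  exact ((SimpleFunc.memLp_iff_integrable (by norm_num) (by norm_num)).1 h1).congr
    (Lp.simpleFunc.toSimpleFunc_eq_toFun f)

theorem memLp_unimodularMul {α : Type*} [MeasurableSpace α] {μ : Measure α} {θ : α → ℂ}
    (hθ : Measurable θ) (h1 : ∀ x, ‖θ x‖ = 1) (f : Lp ℂ 2 μ) :
    MemLp (fun x => θ x * f x) 2 μ :=
  (Lp.memLp f).of_le (hθ.aestronglyMeasurable.mul (Lp.aestronglyMeasurable f))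
    (Eventually.of_forall fun x => by simp [h1])

/-- Multiplication by a function of absolute value one. -/
noncomputable def unimodularMul {α : Type*} [MeasurableSpace α] {μ : Measure α} (θ : α → ℂ)
    (hθ : Measurable θ) (h1 : ∀ x, ‖θ x‖ = 1) : Lp ℂ 2 μ →ₗᵢ[ℂ] Lp ℂ 2 μ :=
  { toFun := fun f => (memLp_unimodularMul hθ h1 f).toLp
    map_add' := fun f g => by
      rw [← MemLp.toLp_add]
      refine MemLp.toLp_congr _ _ ?_
      filter_upwards [Lp.coeFn_add f g] with x hx
      simp only [hx, Pi.add_apply, mul_add]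
    map_smul' := fun c f => by
      rw [RingHom.id_apply, ← MemLp.toLp_const_smul]
      refine MemLp.toLp_congr _ _ ?_
      filter_upwards [Lp.coeFn_smul c f] with x hx
      simp only [hx, Pi.smul_apply, smul_eq_mul, mul_left_comm]
    norm_map' := fun f => by
      refine norm_eq_of_enorm_sq_eq ?_
      simp only [LinearMap.coe_mk, AddHom.coe_mk]
      rw [enorm_sq_toLp, ← lintegral_enorm_sq_eq]
      refine lintegral_congr fun x => ?_
      rw [enorm_mul, ← ofReal_norm (θ x), h1]
      simp }

theorem unimodularMul_ae {α : Type*} [MeasurableSpace α] {μ : Measure α} (θ : α → ℂ)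
    (hθ : Measurable θ) (h1 : ∀ x, ‖θ x‖ = 1) (f : Lp ℂ 2 μ) :
    unimodularMul θ hθ h1 f =ᵐ[μ] fun x => θ x * f x :=
  MemLp.coeFn_toLp (memLp_unimodularMul hθ h1 f)

end General

/-! ### The partial Fourier transform as an integral -/

section SliceFourier

variable {α : Type*} [MeasurableSpace α] {p q : Type*} [Fintype p] [Fintype q]

/-- The Fourier transform in the second variable. -/
noncomputable def sliceFourier (F : α × ((p → ℝ) × (q → ℝ)) → ℂ)
    (w : α × ((p → ℝ) × (q → ℝ))) : ℂ :=
  ∫ ζ, prodChar w.2 ζ * F (w.1, ζ)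

theorem stronglyMeasurable_sliceFourier {F : α × ((p → ℝ) × (q → ℝ)) → ℂ}
    (hF : StronglyMeasurable F) : StronglyMeasurable (sliceFourier F) := by
  have h1 : Measurable fun w : (α × ((p → ℝ) × (q → ℝ))) × ((p → ℝ) × (q → ℝ)) => (w.1.2, w.2) :=
    measurable_fst.snd.prodMk measurable_snd
  have h2 : Measurable fun w : (α × ((p → ℝ) × (q → ℝ))) × ((p → ℝ) × (q → ℝ)) => (w.1.1, w.2) :=
    measurable_fst.fst.prodMk measurable_snd
  have h3 : StronglyMeasurable fun w : (α × ((p → ℝ) × (q → ℝ))) × ((p → ℝ) × (q → ℝ)) =>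
      prodChar w.1.2 w.2 :=
    (continuous_prodChar.measurable.comp h1).stronglyMeasurable
  exact (h3.mul (hF.comp_measurable h2)).integral_prod_right'

theorem sliceFourier_congr {μ : Measure α} {F G : α × ((p → ℝ) × (q → ℝ)) → ℂ}
    (h : F =ᵐ[μ.prod volume] G) :
    ∀ᵐ x ∂μ, ∀ ξ, sliceFourier F (x, ξ) = sliceFourier G (x, ξ) := by
  filter_upwards [Measure.ae_ae_of_ae_prod h] with x hx ξ
  refine integral_congr_ae ?_
  filter_upwards [hx] with ζ hζ
  rw [hζ]

theorem sliceFourier_congr_ae {μ : Measure α} {F G : α × ((p → ℝ) × (q → ℝ)) → ℂ}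
    (h : F =ᵐ[μ.prod volume] G) : sliceFourier F =ᵐ[μ.prod volume] sliceFourier G := by
  filter_upwards [Measure.quasiMeasurePreserving_fst.ae (sliceFourier_congr h)] with w hw
  exact hw w.2

theorem sliceMap_fourierProd_ae {μ : Measure α} [SFinite μ]
    (f : Lp ℂ 2 (μ.prod (volume : Measure ((p → ℝ) × (q → ℝ)))))
    (hf : Integrable f (μ.prod volume)) :
    sliceMap fourierProd μ f =ᵐ[μ.prod volume] sliceFourier f := by
  refine ae_eq_prod_of_ae_ae (Lp.aestronglyMeasurable _)
    (stronglyMeasurable_sliceFourier (Lp.stronglyMeasurable f)).aestronglyMeasurable ?_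
  filter_upwards [sliceMap_ae fourierProd f, ae_memLp_slice (Lp.memLp f), hf.prod_right_ae]
    with x h1 h2 h3
  refine (h1 h2.toLp h2.coeFn_toLp).trans ?_
  refine (fourierProd_ae _ (h3.congr h2.coeFn_toLp.symm)).trans (Eventually.of_forall fun ξ => ?_)
  refine integral_congr_ae ?_
  filter_upwards [h2.coeFn_toLp] with ζ hζ
  rw [hζ]

end SliceFourier

/-! ### Identification of the Plancherel transform and of the left regular representation -/

namespace AdaptedBasis

variable {𝔫 : Type*} [LieRing 𝔫] [LieAlgebra ℝ 𝔫] {m d : ℕ} (β : AdaptedBasis 𝔫 m d)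

instance sigmaFinite_volume_N : SigmaFinite (volume : Measure β.N) :=
  inferInstanceAs (SigmaFinite (volume : Measure ((Fin m → ℝ) × (Fin d → ℝ) × (Fin d → ℝ))))

theorem groupCoordEquiv_ae (f : β.L2N) :
    β.groupCoordEquiv f =ᵐ[volume.prod volume] fun v => f (β.groupCoord v) :=
  compEquiv_ae β.groupCoord β.measurePreserving_groupCoord β.groupCoordInv
    β.measurable_groupCoordInv (Eventually.of_forall fun _ => rfl) f

theorem kernelCoordEquiv_ae (f : Lp ℂ 2 ((volume : Measure (Fin d → ℝ)).prod
      (volume : Measure ((Fin m → ℝ) × (Fin d → ℝ))))) :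
    β.kernelCoordEquiv f =ᵐ[β.plancherelMeasure.prod volume] fun v => f (β.kernelCoord v) :=
  compEquiv_ae β.kernelCoord β.measurePreserving_kernelCoord β.kernelCoordInv
    β.measurable_kernelCoordInv β.kernelCoordInv_kernelCoord_ae f

theorem plancherel_ae (f : β.L2N) (hf : Integrable (f : β.N → ℂ)) :
    β.plancherel f =ᵐ[β.plancherelMeasure.prod volume]
      fun w => sliceFourier (fun v => f (β.groupCoord v)) (β.kernelCoord w) := by
  have h1 : β.groupCoordEquiv f =ᵐ[volume.prod volume] fun v => f (β.groupCoord v) :=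
    β.groupCoordEquiv_ae f
  have h2 : Integrable (β.groupCoordEquiv f) (volume.prod volume) :=
    (β.measurePreserving_groupCoord.integrable_comp_of_integrable hf).congr h1.symm
  have h3 := (sliceMap_fourierProd_ae _ h2).trans (sliceFourier_congr_ae h1)
  exact (β.kernelCoordEquiv_ae _).trans
    (β.measurePreserving_kernelCoord.quasiMeasurePreserving.ae_eq_comp h3)

theorem norm_phase (lam : Fin m → ℝ) (g : β.N) (t : Fin d → ℝ) : ‖β.phase lam g t‖ = 1 := by
  unfold phase
  rw [show ∀ r : ℝ, 2 * Real.pi * Complex.I * (r : ℂ) = ((2 * Real.pi * r : ℝ) : ℂ) * Complex.I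
    from fun r => by push_cast; ring]
  exact Complex.norm_exp_ofReal_mul_I _

theorem measurable_phase :
    Measurable fun w : (Fin m → ℝ) × (β.N × (Fin d → ℝ)) => β.phase w.1 w.2.1 w.2.2 := by
  have hd : ∀ ι : Type, ∀ _ : Fintype ι,
      Measurable fun p : (ι → ℝ) × (ι → ℝ) => p.1 ⬝ᵥ p.2 := fun ι _ => by
    unfold dotProduct
    exact Finset.measurable_sum _ fun i _ => by fun_prop
  have h1 : Measurable fun w : (Fin m → ℝ) × (β.N × (Fin d → ℝ)) => w.1 ⬝ᵥ N.zc w.2.1 :=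
    (hd (Fin m) inferInstance).comp
      (measurable_fst.prodMk (β.measurable_zc.comp measurable_snd.fst))
  have h2 : Measurable fun w : (Fin m → ℝ) × (β.N × (Fin d → ℝ)) =>
      w.2.2 ⬝ᵥ (β.B w.1) *ᵥ N.yc w.2.1 :=
    (hd (Fin d) inferInstance).comp (measurable_snd.snd.prodMk
      ((measurable_mulVec β.measurable_B_apply).comp
        (measurable_fst.prodMk (β.measurable_yc.comp measurable_snd.fst))))
  exact Complex.measurable_exp.comp
    ((Complex.measurable_ofReal.comp (h1.add h2)).const_mul (2 * Real.pi * Complex.I))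

theorem phase_groupCoord (lam : Fin m → ℝ) (x t : Fin d → ℝ) (ζ : (Fin m → ℝ) × (Fin d → ℝ)) :
    β.phase lam (β.groupCoord (x, ζ)) t = prodChar (β.dualCoord (lam, t)) ζ := by
  simp only [phase, prodChar, groupCoord, dualCoord, N.zc_mk, N.yc_mk]
  rw [Matrix.mulVec_transpose, ← Matrix.dotProduct_mulVec]

/-- Each π_λ(g) preserves norms, so f itself gives the integrable bound. -/
theorem integrable_rep (lam : Fin m → ℝ) (v : L2R d) (f : β.L2N)
    (hf : Integrable (f : β.N → ℂ)) : Integrable fun g : β.N => f g • β.rep lam g v := by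
  have h1 : StronglyMeasurable fun g : β.N => β.rep lam g v := by
    refine stronglyMeasurable_toLp (F := fun w : β.N × (Fin d → ℝ) =>
      β.phase lam w.1 w.2 * v (w.2 - N.xc w.1)) ?_ (fun g => β.memLp_rep lam g v)
    refine StronglyMeasurable.mul ?_ ?_
    · exact (β.measurable_phase.comp (measurable_const.prodMk measurable_id)).stronglyMeasurable
    · exact (Lp.stronglyMeasurable v).comp_measurable
        (measurable_snd.sub (β.measurable_xc.comp measurable_fst))
  have h2 : ∀ g : β.N, ‖β.rep lam g v‖ = ‖v‖ := by
    intro g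
    refine norm_eq_of_enorm_sq_eq ?_
    rw [rep, enorm_sq_toLp, ← lintegral_enorm_sq_eq]
    rw [← lintegral_sub_right_eq_self (fun t => ‖v t‖ₑ ^ 2) (N.xc g)]
    refine lintegral_congr fun t => ?_
    rw [enorm_mul, ← ofReal_norm (β.phase lam g t), norm_phase]
    simp
  refine (hf.norm.mul_const ‖v‖).mono' (hf.1.smul h1.aestronglyMeasurable)
    (Eventually.of_forall fun g => ?_)
  rw [norm_smul, h2]

/-- Evaluate the Bochner integral at t and integrate over (z, y) first: the phase is the character
at frequency (λ, B(λ)ᵀ t), which leaves an integral against v(t - x) in x. -/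
theorem hasKernel_fourier (f : β.L2N) (hf : Integrable (f : β.N → ℂ)) (lam : Fin m → ℝ) :
    HasKernel (β.fourier f lam)
      fun ts => sliceFourier (fun v => f (β.groupCoord v)) (β.kernelCoord (lam, ts)) := by
  intro v
  have hΦ : StronglyMeasurable fun w : β.N × (Fin d → ℝ) =>
      f w.1 * (β.phase lam w.1 w.2 * v (w.2 - N.xc w.1)) := by
    refine ((Lp.stronglyMeasurable f).comp_measurable measurable_fst).mul
      (StronglyMeasurable.mul ?_ ?_)
    · exact (β.measurable_phase.comp (measurable_const.prodMk measurable_id)).stronglyMeasurable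
    · exact (Lp.stronglyMeasurable v).comp_measurable
        (measurable_snd.sub (β.measurable_xc.comp measurable_fst))
  have hF := β.integrable_rep lam v f hf
  have hae : ∀ᵐ g : β.N, (fun t => f g * (β.phase lam g t * v (t - N.xc g))) =ᵐ[volume]
      (f g • β.rep lam g v : L2R d) := by
    refine Eventually.of_forall fun g => ?_
    filter_upwards [Lp.coeFn_smul (f g) (β.rep lam g v), (β.memLp_rep lam g v).coeFn_toLp]
      with t h1 h2
    rw [h1, Pi.smul_apply, rep, h2, smul_eq_mul]
  refine (coeFn_integral_ae hF hΦ hae).trans ?_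
  filter_upwards [ae_integrable_swap_of_ae hF hΦ hae] with t ht
  rw [← integral_comp_of_measurePreserving β.measurePreserving_groupCoord ht.1,
    integral_prod (fun w => f (β.groupCoord w) * (β.phase lam (β.groupCoord w) t *
      v (t - N.xc (β.groupCoord w))))
      (β.measurePreserving_groupCoord.integrable_comp_of_integrable ht)]
  have h1 : ∀ x, ∫ ζ, f (β.groupCoord (x, ζ)) * (β.phase lam (β.groupCoord (x, ζ)) t *
      v (t - N.xc (β.groupCoord (x, ζ)))) =
      sliceFourier (fun v => f (β.groupCoord v)) (x, β.dualCoord (lam, t)) * v (t - x) := by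
    intro x
    rw [sliceFourier, ← integral_mul_const]
    refine integral_congr_ae (Eventually.of_forall fun ζ => ?_)
    simp only [phase_groupCoord]
    simp only [groupCoord, N.xc_mk]
    ring
  simp only [h1]
  -- The substitution x = t - s turns the integral in x into an integral operator.
  rw [← integral_sub_left_eq_self _ volume t]
  simp only [sub_sub_cancel]
  rfl

theorem HasKernel.congr {T : L2R d → L2R d} {k k' : (Fin d → ℝ) × (Fin d → ℝ) → ℂ}
    (h : HasKernel T k) (hk : k =ᵐ[volume] k') : HasKernel T k' := by
  intro v
  refine (h v).trans ?_
  filter_upwards [Measure.ae_ae_of_ae_prod hk] with t ht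
  refine integral_congr_ae ?_
  filter_upwards [ht] with s hs
  rw [hs]

/-- Countably many dense test vectors give one null set of t. For the other t, continuity of the
inner product extends equality of the pairings to all of L². -/
theorem HasKernel.ae_eq {T : L2R d → L2R d} {k k' : (Fin d → ℝ) × (Fin d → ℝ) → ℂ}
    (h : HasKernel T k) (h' : HasKernel T k') (hk : MemLp k 2 volume) (hk' : MemLp k' 2 volume) :
    k =ᵐ[volume] k' := by
  refine ae_eq_prod_of_ae_ae hk.1 hk'.1 ?_
  set e := TopologicalSpace.denseSeq (L2R d) with he
  have h1 : ∀ᵐ t : Fin d → ℝ, ∀ n, ∫ s, k (t, s) * e n s = ∫ s, k' (t, s) * e n s :=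
    ae_all_iff.2 fun n => (h (e n)).symm.trans (h' (e n))
  filter_upwards [h1, ae_memLp_slice hk, ae_memLp_slice hk'] with t ht hkt hkt'
  have hc : ∀ (κ : (Fin d → ℝ) → ℂ) (hκ : MemLp κ 2 volume) (v : L2R d),
      inner ℂ hκ.star.toLp v = ∫ s, κ s * v s := by
    intro κ hκ v
    rw [L2.inner_def]
    refine integral_congr_ae ?_
    filter_upwards [hκ.star.coeFn_toLp] with s hs
    rw [hs, RCLike.inner_apply, mul_comm]
    simp
  have h2 : hkt.star.toLp = hkt'.star.toLp := by
    refine ext_inner_right ℂ fun v => ?_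
    have hcl : IsClosed {v : L2R d | inner ℂ hkt.star.toLp v = inner ℂ hkt'.star.toLp v} :=
      isClosed_eq (by fun_prop) (by fun_prop)
    refine hcl.closure_subset_iff.2 ?_ ((TopologicalSpace.denseRange_denseSeq (L2R d)) v)
    rintro _ ⟨n, rfl⟩
    change inner ℂ hkt.star.toLp (e n) = inner ℂ hkt'.star.toLp (e n)
    rw [hc _ hkt, hc _ hkt']
    exact ht n
  have h3 := (hkt.star.coeFn_toLp.symm.trans
    (Eventually.of_forall fun s => by rw [h2])).trans hkt'.star.coeFn_toLp
  filter_upwards [h3] with s hs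
  simpa using congrArg star hs

theorem ae_hasKernel_plancherel (f : β.L2N) (hf : Integrable (f : β.N → ℂ)) :
    ∀ᵐ lam ∂β.plancherelMeasure,
      HasKernel (β.fourier f lam) fun ts => β.plancherel f (lam, ts) := by
  filter_upwards [Measure.ae_ae_of_ae_prod (β.plancherel_ae f hf)] with lam h
  exact (β.hasKernel_fourier f hf lam).congr (EventuallyEq.symm h)

theorem isClosed_graph_plancherel :
    IsClosed {p : β.L2N × β.HSField | β.plancherel p.1 = p.2} :=
  isClosed_eq (β.plancherel.continuous.comp continuous_fst) continuous_snd

theorem plancherel_eq_of_hasKernel (f : β.L2N) (K : β.HSField) (hf : Integrable (f : β.N → ℂ))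
    (hK : ∀ᵐ lam ∂β.plancherelMeasure, HasKernel (β.fourier f lam) fun ts => K (lam, ts)) :
    β.plancherel f = K := by
  refine Lp.ext (ae_eq_prod_of_ae_ae (Lp.aestronglyMeasurable _) (Lp.aestronglyMeasurable _) ?_)
  filter_upwards [hK, β.ae_hasKernel_plancherel f hf, ae_memLp_slice (Lp.memLp K),
    ae_memLp_slice (Lp.memLp (β.plancherel f))] with lam h1 h2 h3 h4
  exact h2.ae_eq h1 h4 h3

/-- The graph of a continuous map is closed, and it contains the graph over L¹ ∩ L² by uniqueness of
kernels. Density of L¹ ∩ L² gives the converse. -/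
theorem isPlancherelTransform_iff (f : β.L2N) (K : β.HSField) :
    β.IsPlancherelTransform f K ↔ β.plancherel f = K := by
  constructor
  · intro h
    have h2 : (f, K) ∈ {p : β.L2N × β.HSField | β.plancherel p.1 = p.2} :=
      closure_minimal (fun p hp => β.plancherel_eq_of_hasKernel p.1 p.2 hp.1 hp.2)
        β.isClosed_graph_plancherel h
    exact h2
  · intro h
    have hc : Continuous fun f : β.L2N => (f, β.plancherel f) :=
      continuous_id.prodMk β.plancherel.continuous
    have h2 : Set.MapsTo (fun f : β.L2N => (f, β.plancherel f)) {f | Integrable (f : β.N → ℂ)}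
        {p : β.L2N × β.HSField | Integrable (p.1 : β.N → ℂ) ∧
          ∀ᵐ lam ∂β.plancherelMeasure, HasKernel (β.fourier p.1 lam) fun ts => p.2 (lam, ts)} :=
      fun f hf => ⟨hf, β.ae_hasKernel_plancherel f hf⟩
    rw [← h]
    exact h2.closure hc (dense_integrable_Lp _ f)

/-- The action of `g` by left translation, on the coordinates `(z, y)`. -/
noncomputable def shear (g : β.N) (ζ : (Fin m → ℝ) × (Fin d → ℝ)) : (Fin m → ℝ) × (Fin d → ℝ) :=
  (N.zc g + β.bracket (N.xc g) ζ.2 + ζ.1, N.yc g + ζ.2)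

theorem continuous_bracket_right (x : Fin d → ℝ) : Continuous fun y => β.bracket x y := by
  unfold bracket; fun_prop

theorem measurePreserving_shear (g : β.N) : MeasurePreserving (β.shear g) := by
  have h2 : MeasurePreserving
      (fun p : (Fin d → ℝ) × (Fin m → ℝ) =>
        (N.yc g + p.1, (N.zc g + β.bracket (N.xc g) p.1) + p.2))
      (volume.prod volume) (volume.prod volume) := by
    refine (measurePreserving_add_left volume (N.yc g)).skew_product
      (g := fun (y : Fin d → ℝ) (z : Fin m → ℝ) => (N.zc g + β.bracket (N.xc g) y) + z) ?_ ?_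
    · apply Continuous.measurable
      have := β.continuous_bracket_right (N.xc g)
      simp only [Function.uncurry_def]
      fun_prop
    · exact Filter.Eventually.of_forall fun p => (measurePreserving_add_left volume _).map_eq
  have h3 := (Measure.measurePreserving_swap.comp h2).comp
    (Measure.measurePreserving_swap (μ := (volume : Measure (Fin m → ℝ)))
      (ν := (volume : Measure (Fin d → ℝ))))
  exact h3

theorem inv_mul_groupCoord_shear (g : β.N) (x : Fin d → ℝ) (ζ : (Fin m → ℝ) × (Fin d → ℝ)) :
    g⁻¹ * β.groupCoord (x, β.shear g ζ) = β.groupCoord (x - N.xc g, ζ) := by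
  apply N.ext
  · simp only [groupCoord, shear, N.zc_mul, N.zc_inv, N.zc_mk, N.xc_inv, N.yc_mk,
      N.bracket_neg_left, N.bracket_add_right]
    abel
  · simp only [groupCoord, shear, N.yc_mul, N.yc_inv, N.yc_mk]
    abel
  · simp only [groupCoord, N.xc_mul, N.xc_inv, N.xc_mk]
    abel

/-- The commutator term of the shear pairs with λ to give -⟨x, B(λ) y⟩, which is precisely the
change of frequency from t to t - x. This is where the group law meets the definition of B. -/
theorem prodChar_dualCoord_shear (g : β.N) (lam : Fin m → ℝ) (t : Fin d → ℝ)
    (ζ : (Fin m → ℝ) × (Fin d → ℝ)) :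
    prodChar (β.dualCoord (lam, t)) (β.shear g ζ) =
      β.phase lam g t * prodChar (β.dualCoord (lam, t - N.xc g)) ζ := by
  have h := β.dotProduct_bracket lam (N.xc g) ζ.2
  simp only [phase, prodChar, shear, dualCoord]
  rw [← Complex.exp_add, Matrix.mulVec_transpose, Matrix.mulVec_transpose,
    ← Matrix.dotProduct_mulVec, ← Matrix.dotProduct_mulVec, Matrix.mulVec_add]
  simp only [dotProduct_add, sub_dotProduct, h]
  congr 1
  push_cast
  ring

theorem sliceFourier_leftReg (F : β.N → ℂ) (hF : StronglyMeasurable F) (g : β.N)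
    (lam : Fin m → ℝ) (t s : Fin d → ℝ) :
    sliceFourier (fun v => F (g⁻¹ * β.groupCoord v)) (β.kernelCoord (lam, (t, s))) =
      β.phase lam g t *
        sliceFourier (fun v => F (β.groupCoord v)) (β.kernelCoord (lam, (t - N.xc g, s))) := by
  simp only [sliceFourier, kernelCoord]
  rw [← integral_comp_of_measurePreserving (β.measurePreserving_shear g)]
  · rw [← integral_const_mul]
    refine integral_congr_ae (Eventually.of_forall fun ζ => ?_)
    simp only [inv_mul_groupCoord_shear, prodChar_dualCoord_shear]
    rw [sub_right_comm, mul_assoc]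
  · refine AEStronglyMeasurable.mul ?_ ?_
    · have : Continuous fun ζ => prodChar (β.dualCoord (lam, t)) ζ :=
        continuous_prodChar.comp (continuous_const.prodMk continuous_id)
      exact this.aestronglyMeasurable
    · exact (hF.comp_measurable ((N.measurePreserving_mul_left g⁻¹).measurable.comp
        (β.measurePreserving_groupCoord.measurable.comp measurable_prodMk_left))).aestronglyMeasurable

theorem measurePreserving_kernelShift (x : Fin d → ℝ) :
    MeasurePreserving
      (fun w : (Fin m → ℝ) × ((Fin d → ℝ) × (Fin d → ℝ)) => (w.1, (w.2.1 - x, w.2.2)))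
      (β.plancherelMeasure.prod volume) (β.plancherelMeasure.prod volume) :=
  (MeasurePreserving.id β.plancherelMeasure).prod
    ((measurePreserving_sub_right (volume : Measure (Fin d → ℝ)) x).prod
      (MeasurePreserving.id (volume : Measure (Fin d → ℝ))))

theorem measurable_phase_kernel (g : β.N) :
    Measurable fun w : (Fin m → ℝ) × ((Fin d → ℝ) × (Fin d → ℝ)) => β.phase w.1 g w.2.1 := by
  have h : Measurable fun w : (Fin m → ℝ) × ((Fin d → ℝ) × (Fin d → ℝ)) => (w.1, (g, w.2.1)) :=
    measurable_fst.prodMk (measurable_const.prodMk measurable_snd.fst)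
  have h2 := β.measurable_phase.comp h
  simp only [Function.comp_def] at h2
  exact h2

/-- The left regular representation on the side of the kernels of the Fourier transform. -/
noncomputable def kernelLeftReg (g : β.N) : β.HSField →ₗᵢ[ℂ] β.HSField :=
  (unimodularMul _ (β.measurable_phase_kernel g) fun w => β.norm_phase w.1 g w.2.1).comp
    (Lp.compMeasurePreservingₗᵢ ℂ _ (β.measurePreserving_kernelShift (N.xc g)))

theorem kernelLeftReg_ae (g : β.N) (K : β.HSField) :
    β.kernelLeftReg g K =ᵐ[β.plancherelMeasure.prod volume]
      fun w => β.phase w.1 g w.2.1 * K (w.1, (w.2.1 - N.xc g, w.2.2)) := by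
  refine (unimodularMul_ae _ (β.measurable_phase_kernel g)
    (fun w => β.norm_phase w.1 g w.2.1) _).trans ?_
  filter_upwards [Lp.coeFn_compMeasurePreserving K (β.measurePreserving_kernelShift (N.xc g))]
    with w hw
  exact congrArg (β.phase w.1 g w.2.1 * ·) hw

theorem leftReg_ae (g : β.N) (f : β.L2N) :
    β.leftReg g f =ᵐ[volume] fun h => f (g⁻¹ * h) :=
  Lp.coeFn_compMeasurePreserving f (N.measurePreserving_mul_left g⁻¹)

/-- Both sides are continuous, so integrable f suffice; there the integral formula and the
substitution by the shear apply. -/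
theorem plancherel_leftReg (g : β.N) (f : β.L2N) :
    β.plancherel (β.leftReg g f) = β.kernelLeftReg g (β.plancherel f) := by
  have hcl : IsClosed {f : β.L2N |
      β.plancherel (β.leftReg g f) = β.kernelLeftReg g (β.plancherel f)} :=
    isClosed_eq (β.plancherel.continuous.comp (β.leftReg g).continuous)
      ((β.kernelLeftReg g).continuous.comp β.plancherel.continuous)
  refine hcl.closure_subset_iff.2 ?_ (dense_integrable_Lp _ f)
  intro f (hf : Integrable (f : β.N → ℂ))
  have hgf : Integrable (β.leftReg g f : β.N → ℂ) :=
    ((N.measurePreserving_mul_left g⁻¹).integrable_comp_of_integrable hf).congr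
      (β.leftReg_ae g f).symm
  refine Lp.ext ((β.plancherel_ae _ hgf).trans ?_)
  have h1 := sliceFourier_congr_ae
    (β.measurePreserving_groupCoord.quasiMeasurePreserving.ae_eq_comp (β.leftReg_ae g f))
  have h2 := β.measurePreserving_kernelCoord.quasiMeasurePreserving.ae_eq_comp h1
  refine h2.trans (EventuallyEq.trans ?_ (β.kernelLeftReg_ae g (β.plancherel f)).symm)
  have h3 := (β.measurePreserving_kernelShift (N.xc g)).quasiMeasurePreserving.ae_eq_comp
    (β.plancherel_ae f hf)
  filter_upwards [h3] with w hw
  simp only [Function.comp_apply] at hw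
  rw [hw]
  exact β.sliceFourier_leftReg f (Lp.stronglyMeasurable f) g w.1 w.2.1 w.2.2

end AdaptedBasis

/-! ### Fields of rank one operators along a fixed field of unit vectors -/

section Tensor

variable {α T : Type*} [MeasurableSpace α] [MeasurableSpace T]
  {μ : Measure α} [SFinite μ] {ν : Measure T} [SFinite ν] {S : Set α} {U : α × T → ℂ}

/-- The field of kernels `V(a, t) * conj (U(a, s))`, for `a` in `S`. -/
noncomputable def tensorFun (S : Set α) (U V : α × T → ℂ) (w : α × (T × T)) : ℂ :=
  S.indicator (fun _ => 1) w.1 * (V (w.1, w.2.1) * (starRingEnd ℂ) (U (w.1, w.2.2)))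

theorem stronglyMeasurable_tensorFun (hS : MeasurableSet S) (hU : StronglyMeasurable U)
    {V : α × T → ℂ} (hV : StronglyMeasurable V) : StronglyMeasurable (tensorFun S U V) := by
  have h1 : Measurable fun w : α × (T × T) => (w.1, w.2.1) :=
    measurable_fst.prodMk measurable_snd.fst
  have h2 : Measurable fun w : α × (T × T) => (w.1, w.2.2) :=
    measurable_fst.prodMk measurable_snd.snd
  have h3 : StronglyMeasurable fun w : α × (T × T) => S.indicator (fun _ => (1 : ℂ)) w.1 :=
    (stronglyMeasurable_const.indicator hS).comp_measurable measurable_fst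
  exact h3.mul ((hV.comp_measurable h1).mul
    (Complex.continuous_conj.comp_stronglyMeasurable (hU.comp_measurable h2)))

omit [SFinite μ] in
theorem ae_ae_of_ae_restrict_prod {P : α → T → Prop} (hS : MeasurableSet S)
    (h : ∀ᵐ w ∂((μ.restrict S).prod ν), P w.1 w.2) :
    ∀ᵐ a ∂μ, a ∈ S → ∀ᵐ t ∂ν, P a t :=
  (ae_restrict_iff' hS).1 (Measure.ae_ae_of_ae_prod h)

theorem tensorFun_congr (hS : MeasurableSet S) (hU : StronglyMeasurable U) {V V' : α × T → ℂ}
    (hV : StronglyMeasurable V) (hV' : StronglyMeasurable V')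
    (h : V =ᵐ[(μ.restrict S).prod ν] V') :
    tensorFun S U V =ᵐ[μ.prod (ν.prod ν)] tensorFun S U V' := by
  refine ae_eq_prod_of_ae_ae (stronglyMeasurable_tensorFun hS hU hV).aestronglyMeasurable
    (stronglyMeasurable_tensorFun hS hU hV').aestronglyMeasurable ?_
  filter_upwards [ae_ae_of_ae_restrict_prod (P := fun a t => V (a, t) = V' (a, t)) hS h] with a ha
  by_cases haS : a ∈ S
  · filter_upwards [Measure.quasiMeasurePreserving_fst.ae (ha haS)] with w hw
    simp only [tensorFun, hw]
  · exact Eventually.of_forall fun w => by simp [tensorFun, haS]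

omit [SFinite μ] in
theorem lintegral_tensorFun (hS : MeasurableSet S) (hU : StronglyMeasurable U)
    (hU1 : ∀ a ∈ S, ∫⁻ s, ‖U (a, s)‖ₑ ^ 2 ∂ν = 1) {V : α × T → ℂ} (hV : StronglyMeasurable V) :
    ∫⁻ w, ‖tensorFun S U V w‖ₑ ^ 2 ∂(μ.prod (ν.prod ν)) =
      ∫⁻ w, ‖V w‖ₑ ^ 2 ∂((μ.restrict S).prod ν) := by
  have hm := stronglyMeasurable_tensorFun hS hU hV
  rw [lintegral_prod _ (hm.enorm.pow_const 2).aemeasurable,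
    lintegral_prod _ (hV.enorm.pow_const 2).aemeasurable, ← lintegral_indicator hS]
  refine lintegral_congr fun a => ?_
  rw [lintegral_prod (fun w => ‖tensorFun S U V (a, w)‖ₑ ^ 2)
    ((hm.comp_measurable measurable_prodMk_left).enorm.pow_const 2).aemeasurable]
  by_cases ha : a ∈ S
  · rw [Set.indicator_of_mem ha]
    refine lintegral_congr fun t => ?_
    have h1 : ∀ s, ‖tensorFun S U V (a, (t, s))‖ₑ ^ 2 = ‖V (a, t)‖ₑ ^ 2 * ‖U (a, s)‖ₑ ^ 2 := by
      intro s
      simp only [tensorFun, Set.indicator_of_mem ha, one_mul, enorm_mul, mul_pow]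
      rw [← ofReal_norm ((starRingEnd ℂ) _), RCLike.norm_conj, ofReal_norm]
    simp only [h1]
    rw [lintegral_const_mul (f := fun s => ‖U (a, s)‖ₑ ^ 2) _
      ((hU.comp_measurable measurable_prodMk_left).enorm.pow_const 2), hU1 a ha, mul_one]
  · simp [ha, tensorFun]

theorem memLp_tensorFun (hS : MeasurableSet S) (hU : StronglyMeasurable U)
    (hU1 : ∀ a ∈ S, ∫⁻ s, ‖U (a, s)‖ₑ ^ 2 ∂ν = 1) (V : Lp ℂ 2 ((μ.restrict S).prod ν)) :
    MemLp (tensorFun S U V) 2 (μ.prod (ν.prod ν)) := by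
  rw [memLp_two_iff (stronglyMeasurable_tensorFun hS hU
    (Lp.stronglyMeasurable V)).aestronglyMeasurable,
    lintegral_tensorFun hS hU hU1 (Lp.stronglyMeasurable V)]
  exact (memLp_two_iff (Lp.aestronglyMeasurable V)).1 (Lp.memLp V)

variable (μ ν) in
/-- The isometry `V ↦ V ⊗ U` onto the fields of operators of rank one along `U`. -/
noncomputable def tensorMap (hS : MeasurableSet S) (hU : StronglyMeasurable U)
    (hU1 : ∀ a ∈ S, ∫⁻ s, ‖U (a, s)‖ₑ ^ 2 ∂ν = 1) :
    Lp ℂ 2 ((μ.restrict S).prod ν) →ₗᵢ[ℂ] Lp ℂ 2 (μ.prod (ν.prod ν)) :=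
  { toFun := fun V => (memLp_tensorFun hS hU hU1 V).toLp
    map_add' := fun V V' => by
      rw [← MemLp.toLp_add]
      refine MemLp.toLp_congr _ _ ((tensorFun_congr hS hU (Lp.stronglyMeasurable _)
        ((Lp.stronglyMeasurable V).add (Lp.stronglyMeasurable V')) (Lp.coeFn_add V V')).trans
        (Eventually.of_forall fun w => ?_))
      simp only [tensorFun, Pi.add_apply]
      ring
    map_smul' := fun c V => by
      rw [RingHom.id_apply, ← MemLp.toLp_const_smul]
      refine MemLp.toLp_congr _ _ ((tensorFun_congr hS hU (Lp.stronglyMeasurable _)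
        ((Lp.stronglyMeasurable V).const_smul c) (Lp.coeFn_smul c V)).trans
        (Eventually.of_forall fun w => ?_))
      simp only [tensorFun, Pi.smul_apply, smul_eq_mul]
      ring
    norm_map' := fun V => by
      refine norm_eq_of_enorm_sq_eq ?_
      simp only [LinearMap.coe_mk, AddHom.coe_mk]
      rw [enorm_sq_toLp, lintegral_tensorFun hS hU hU1 (Lp.stronglyMeasurable V),
        lintegral_enorm_sq_eq] }

theorem tensorMap_ae (hS : MeasurableSet S) (hU : StronglyMeasurable U)
    (hU1 : ∀ a ∈ S, ∫⁻ s, ‖U (a, s)‖ₑ ^ 2 ∂ν = 1) {V : Lp ℂ 2 ((μ.restrict S).prod ν)}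
    {V' : α × T → ℂ} (hV' : StronglyMeasurable V') (h : V =ᵐ[(μ.restrict S).prod ν] V') :
    tensorMap μ ν hS hU hU1 V =ᵐ[μ.prod (ν.prod ν)] tensorFun S U V' :=
  (memLp_tensorFun hS hU hU1 V).coeFn_toLp.trans (tensorFun_congr hS hU (Lp.stronglyMeasurable V) hV' h)

/-- The vectors w are given fibre by fibre, with no measurability in a. Contracting the kernel with
U recovers them as a jointly measurable function, since the fibres of U have norm one. -/
theorem mem_range_tensorMap_iff [MeasurableSpace.CountablyGenerated T] (hS : MeasurableSet S) (hU : StronglyMeasurable U)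
    (hU1 : ∀ a ∈ S, ∫⁻ s, ‖U (a, s)‖ₑ ^ 2 ∂ν = 1) (K : Lp ℂ 2 (μ.prod (ν.prod ν))) :
    (∃ V, tensorMap μ ν hS hU hU1 V = K) ↔ ∀ᵐ a ∂μ,
      (a ∈ S → ∃ w : Lp ℂ 2 ν, (fun ts => K (a, ts)) =ᵐ[ν.prod ν]
        fun ts => w ts.1 * (starRingEnd ℂ) (U (a, ts.2))) ∧
      (a ∉ S → (fun ts => K (a, ts)) =ᵐ[ν.prod ν] 0) := by
  constructor
  · rintro ⟨V, rfl⟩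
    have h1 := tensorMap_ae (μ := μ) hS hU hU1 (Lp.stronglyMeasurable V) (EventuallyEq.refl _ _)
    filter_upwards [Measure.ae_ae_of_ae_prod h1,
      (ae_restrict_iff' hS).1 (ae_memLp_slice (Lp.memLp V))] with a ha hm
    refine ⟨fun haS => ⟨(hm haS).toLp, ?_⟩, fun haS => ?_⟩
    · filter_upwards [ha, Measure.quasiMeasurePreserving_fst.ae (hm haS).coeFn_toLp] with w hw hw1
      rw [hw, hw1]
      simp [tensorFun, haS]
    · filter_upwards [ha] with w hw
      rw [hw]
      simp [tensorFun, haS]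
  · intro h
    set V : α × T → ℂ := fun w => ∫ s, K (w.1, (w.2, s)) * U (w.1, s) ∂ν with hV
    have hVm : StronglyMeasurable V := by
      have h1 : Measurable fun w : (α × T) × T => (w.1.1, (w.1.2, w.2)) :=
        measurable_fst.fst.prodMk (measurable_fst.snd.prodMk measurable_snd)
      have h2 : Measurable fun w : (α × T) × T => (w.1.1, w.2) :=
        measurable_fst.fst.prodMk measurable_snd
      exact (((Lp.stronglyMeasurable K).comp_measurable h1).mul
        (hU.comp_measurable h2)).integral_prod_right'
    have hK : tensorFun S U V =ᵐ[μ.prod (ν.prod ν)] K := by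
      refine ae_eq_prod_of_ae_ae (stronglyMeasurable_tensorFun hS hU hVm).aestronglyMeasurable
        (Lp.aestronglyMeasurable K) ?_
      filter_upwards [h] with a ha
      by_cases haS : a ∈ S
      · obtain ⟨w, hw⟩ := ha.1 haS
        have h1 : ∫ s, (starRingEnd ℂ) (U (a, s)) * U (a, s) ∂ν = 1 := by
          have h2 : ∀ s, (starRingEnd ℂ) (U (a, s)) * U (a, s) =
              ((‖U (a, s)‖ ^ 2 : ℝ) : ℂ) := fun s => by
            rw [mul_comm, Complex.mul_conj, Complex.normSq_eq_norm_sq]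
          simp only [h2]
          rw [integral_complex_ofReal, integral_eq_lintegral_of_nonneg_ae
            (f := fun s => ‖U (a, s)‖ ^ 2) (Eventually.of_forall fun s => sq_nonneg ‖U (a, s)‖)
            ((hU.comp_measurable measurable_prodMk_left).norm.pow 2).aestronglyMeasurable]
          have h3 : ∀ s, ENNReal.ofReal (‖U (a, s)‖ ^ 2) = ‖U (a, s)‖ₑ ^ 2 := fun s => by
            rw [ENNReal.ofReal_pow (norm_nonneg _), ofReal_norm]
          simp only [h3, hU1 a haS]
          simp
        have h2 : ∀ᵐ t ∂ν, V (a, t) = w t := by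
          filter_upwards [Measure.ae_ae_of_ae_prod hw] with t ht
          have : V (a, t) = ∫ s, w t * ((starRingEnd ℂ) (U (a, s)) * U (a, s)) ∂ν := by
            refine integral_congr_ae ?_
            filter_upwards [ht] with s hs
            rw [hs, mul_assoc]
          rw [this, integral_const_mul, h1, mul_one]
        filter_upwards [hw, Measure.quasiMeasurePreserving_fst.ae h2] with ts h3 h4
        simp only [tensorFun, Set.indicator_of_mem haS, one_mul, h3, h4]
      · filter_upwards [ha.2 haS] with ts h3
        simp [tensorFun, haS, h3]
    have hVL : MemLp V 2 ((μ.restrict S).prod ν) := by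
      rw [memLp_two_iff hVm.aestronglyMeasurable, ← lintegral_tensorFun hS hU hU1 hVm]
      refine lt_of_eq_of_lt (lintegral_congr_ae ?_)
        ((memLp_two_iff (Lp.aestronglyMeasurable K)).1 (Lp.memLp K))
      filter_upwards [hK] with w hw
      rw [hw]
    exact ⟨hVL.toLp, Lp.ext ((tensorMap_ae hS hU hU1 hVm hVL.coeFn_toLp).trans hK)⟩

end Tensor

/-! ### Square summable sequences -/

section SquareSummable

theorem memlp_two_of_tsum_enorm_sq {ι : Type*} {f : ι → ℂ} (h : ∑' i, ‖f i‖ₑ ^ 2 ≠ ∞) :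
    Memℓp f 2 := by
  refine memℓp_gen ?_
  have h1 : ∀ i, ‖f i‖ ^ (2 : ℝ≥0∞).toReal = (‖f i‖ₑ ^ 2).toReal := fun i => by
    simp
  simp only [h1]
  exact ENNReal.summable_toReal h

theorem enorm_sq_lp_two {ι : Type*} (f : lp (fun _ : ι => ℂ) 2) :
    ‖f‖ₑ ^ 2 = ∑' i, ‖f i‖ₑ ^ 2 := by
  have h := lp.hasSum_norm (p := 2) (by norm_num) f
  have h1 : ∀ i, ‖f i‖ₑ ^ 2 = ENNReal.ofReal (‖f i‖ ^ (2 : ℝ≥0∞).toReal) := fun i => by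
    rw [← ofReal_norm, ← ENNReal.ofReal_pow (norm_nonneg _)]
    norm_num
  simp only [h1]
  rw [← ENNReal.ofReal_tsum_of_nonneg (fun i => by positivity) h.summable, h.tsum_eq,
    ← ofReal_norm, ← ENNReal.ofReal_pow (norm_nonneg _)]
  norm_num

end SquareSummable

/-! ### Restriction of a product measure in the first variable -/

section Restrict

variable {α T : Type*} [MeasurableSpace α] [MeasurableSpace T]
  {μ : Measure α} [SFinite μ] {ν : Measure T} [SFinite ν] {S : Set α}

theorem restrict_prod_eq (S : Set α) :
    (μ.restrict S).prod ν = (μ.prod ν).restrict (Prod.fst ⁻¹' S) := by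
  conv_lhs => rw [← Measure.restrict_univ (μ := ν)]
  rw [Measure.prod_restrict, Set.prod_univ]

theorem lintegral_restrict_prod (hS : MeasurableSet S) (f : α × T → ℝ≥0∞) :
    ∫⁻ w, f w ∂((μ.restrict S).prod ν) =
      ∫⁻ w, S.indicator (fun _ => 1) w.1 * f w ∂(μ.prod ν) := by
  rw [restrict_prod_eq, ← lintegral_indicator (measurable_fst hS)]
  refine lintegral_congr fun w => ?_
  by_cases h : w.1 ∈ S <;> simp [h]

theorem integral_restrict_prod (hS : MeasurableSet S) (f : α × T → ℂ) :
    ∫ w, f w ∂((μ.restrict S).prod ν) =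
      ∫ w, S.indicator (fun _ => 1) w.1 * f w ∂(μ.prod ν) := by
  rw [restrict_prod_eq, ← integral_indicator (measurable_fst hS)]
  refine integral_congr_ae (Eventually.of_forall fun w => ?_)
  by_cases h : w.1 ∈ S <;> simp [h]

omit [SFinite μ] [SFinite ν] in
theorem ae_fst_mem_restrict_prod (hS : MeasurableSet S) :
    ∀ᵐ w ∂((μ.restrict S).prod ν), w.1 ∈ S :=
  Measure.quasiMeasurePreserving_fst.ae (ae_restrict_mem hS)

end Restrict

/-! ### Windowed functions and the norm of continuous coefficients -/

namespace AdaptedBasis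

variable {𝔫 : Type*} [LieRing 𝔫] [LieAlgebra ℝ 𝔫] {m d : ℕ} (β : AdaptedBasis 𝔫 m d)

/-- The product of `conj V` with the translate by `x` of a window, in the coordinates
`(lam, B(lam)ᵀ t)`. -/
noncomputable def windowed (S : Set (Fin m → ℝ)) (v V : (Fin m → ℝ) × (Fin d → ℝ) → ℂ)
    (w : (Fin d → ℝ) × ((Fin m → ℝ) × (Fin d → ℝ))) : ℂ :=
  S.indicator (fun _ => 1) w.2.1 *
    ((starRingEnd ℂ) (V (β.dualCoordInv w.2)) * v (w.2.1, (β.dualCoordInv w.2).2 - w.1))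

variable {β} {S : Set (Fin m → ℝ)} {v V : (Fin m → ℝ) × (Fin d → ℝ) → ℂ}

theorem windowed_dualCoord {lam : Fin m → ℝ} (h : (β.B lam).det ≠ 0) (x t : Fin d → ℝ) :
    β.windowed S v V (x, β.dualCoord (lam, t)) =
      S.indicator (fun _ => 1) lam * ((starRingEnd ℂ) (V (lam, t)) * v (lam, t - x)) := by
  simp only [windowed]
  rw [β.dualCoordInv_dualCoord (w := (lam, t)) h]
  rfl

theorem stronglyMeasurable_windowed (hS : MeasurableSet S) (hv : StronglyMeasurable v)
    (hV : StronglyMeasurable V) : StronglyMeasurable (β.windowed S v V) := by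
  have h1 : Measurable fun w : (Fin d → ℝ) × ((Fin m → ℝ) × (Fin d → ℝ)) => β.dualCoordInv w.2 :=
    β.measurable_dualCoordInv.comp measurable_snd
  have h2 : Measurable fun w : (Fin d → ℝ) × ((Fin m → ℝ) × (Fin d → ℝ)) =>
      (w.2.1, (β.dualCoordInv w.2).2 - w.1) :=
    measurable_snd.fst.prodMk (h1.snd.sub measurable_fst)
  have h3 : StronglyMeasurable fun w : (Fin d → ℝ) × ((Fin m → ℝ) × (Fin d → ℝ)) =>
      S.indicator (fun _ => (1 : ℂ)) w.2.1 :=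
    (stronglyMeasurable_const.indicator hS).comp_measurable measurable_snd.fst
  exact h3.mul ((Complex.continuous_conj.comp_stronglyMeasurable (hV.comp_measurable h1)).mul
    (hv.comp_measurable h2))

theorem measurable_shift (x : Fin d → ℝ) :
    Measurable fun w : (Fin m → ℝ) × (Fin d → ℝ) => (w.1, w.2 - x) :=
  measurable_fst.prodMk (measurable_snd.sub_const x)

/-- Undoes the change of variables η = B(λ)ᵀ t. Exponent 1 serves integrability and exponent 2 the
norms; exponent 0 fails off S, where the windowed function vanishes. -/
theorem lintegral_windowed (hS : MeasurableSet S) (hv : StronglyMeasurable v)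
    (hV : StronglyMeasurable V) (x : Fin d → ℝ) {k : ℕ} (hk : k ≠ 0) :
    ∫⁻ ζ, ‖β.windowed S v V (x, ζ)‖ₑ ^ k =
      ∫⁻ w, ‖V w‖ₑ ^ k * ‖v (w.1, w.2 - x)‖ₑ ^ k
        ∂((β.plancherelMeasure.restrict S).prod volume) := by
  have hm := (stronglyMeasurable_windowed (β := β) hS hv hV).comp_measurable
    (measurable_prodMk_left (x := x))
  rw [← β.measurePreserving_dualCoord.lintegral_comp (f := fun ζ => ‖β.windowed S v V (x, ζ)‖ₑ ^ k)
    (hm.enorm.pow_const k), lintegral_restrict_prod hS]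
  refine lintegral_congr_ae ?_
  filter_upwards [Measure.quasiMeasurePreserving_fst.ae β.ae_plancherel_det_ne_zero] with w hw
  rw [show β.dualCoord w = β.dualCoord (w.1, w.2) from rfl, windowed_dualCoord hw]
  by_cases h : w.1 ∈ S
  · simp only [Set.indicator_of_mem h, one_mul, enorm_mul, mul_pow]
    rw [← ofReal_norm ((starRingEnd ℂ) _), RCLike.norm_conj, ofReal_norm]
  · simp [h, hk]

/-- The integral over `lam` in `S` of the square norms of the fibres of a window with fibres of
norm one is `μ(S)`. -/
theorem lintegral_window (hS : MeasurableSet S) (hv : StronglyMeasurable v)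
    (hv1 : ∀ lam ∈ S, ∫⁻ t, ‖v (lam, t)‖ₑ ^ 2 = 1) (x : Fin d → ℝ) :
    ∫⁻ w, ‖v (w.1, w.2 - x)‖ₑ ^ 2 ∂((β.plancherelMeasure.restrict S).prod volume) =
      β.plancherelMeasure S := by
  rw [lintegral_prod (fun w : (Fin m → ℝ) × (Fin d → ℝ) => ‖v (w.1, w.2 - x)‖ₑ ^ 2)
    ((hv.comp_measurable (measurable_shift x)).enorm.pow_const 2).aemeasurable]
  have h1 : ∀ lam, ∫⁻ t : Fin d → ℝ, ‖v (lam, t - x)‖ₑ ^ 2 = ∫⁻ t, ‖v (lam, t)‖ₑ ^ 2 :=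
    fun lam => lintegral_sub_right_eq_self (fun t => ‖v (lam, t)‖ₑ ^ 2) x
  simp only [h1]
  rw [setLIntegral_congr_fun hS hv1, setLIntegral_one]

theorem memLp_window_shift (hS : MeasurableSet S) (hv : StronglyMeasurable v)
    (hv1 : ∀ lam ∈ S, ∫⁻ t, ‖v (lam, t)‖ₑ ^ 2 = 1) (hSf : β.plancherelMeasure S < ∞)
    (x : Fin d → ℝ) :
    MemLp (fun w : (Fin m → ℝ) × (Fin d → ℝ) => v (w.1, w.2 - x)) 2
      ((β.plancherelMeasure.restrict S).prod volume) := by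
  refine (memLp_two_iff (hv.comp_measurable (measurable_shift x)).aestronglyMeasurable).2 ?_
  exact (lintegral_window hS hv hv1 x).trans_lt hSf

/-- Cauchy-Schwarz: the translated window is square integrable because μ(S) is finite. -/
theorem integrable_windowed (hS : MeasurableSet S) (hv : StronglyMeasurable v)
    (hv1 : ∀ lam ∈ S, ∫⁻ t, ‖v (lam, t)‖ₑ ^ 2 = 1) (hSf : β.plancherelMeasure S < ∞)
    (hV : StronglyMeasurable V)
    (hV2 : MemLp V 2 ((β.plancherelMeasure.restrict S).prod volume)) (x : Fin d → ℝ) :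
    Integrable fun ζ => β.windowed S v V (x, ζ) := by
  refine ⟨((stronglyMeasurable_windowed hS hv hV).comp_measurable
    measurable_prodMk_left).aestronglyMeasurable, ?_⟩
  rw [hasFiniteIntegral_iff_enorm]
  have h := lintegral_windowed (β := β) hS hv hV x one_ne_zero
  simp only [pow_one] at h
  rw [h]
  have h2 := (hV2.integrable_mul (memLp_window_shift hS hv hv1 hSf x)).2
  rw [hasFiniteIntegral_iff_enorm] at h2
  simpa only [Pi.mul_apply, enorm_mul] using h2

theorem memLp_windowed {C : ℝ} (hS : MeasurableSet S) (hv : StronglyMeasurable v)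
    (hvC : ∀ w, ‖v w‖ ≤ C) (hV : StronglyMeasurable V)
    (hV2 : MemLp V 2 ((β.plancherelMeasure.restrict S).prod volume)) (x : Fin d → ℝ) :
    MemLp (fun ζ => β.windowed S v V (x, ζ)) 2 volume := by
  refine (memLp_two_iff ((stronglyMeasurable_windowed hS hv hV).comp_measurable
    measurable_prodMk_left).aestronglyMeasurable).2 ?_
  refine (lintegral_windowed hS hv hV x two_ne_zero).trans_lt ?_
  have h1 : ∀ w, ‖v w‖ₑ ≤ ENNReal.ofReal C := fun w => by
    rw [← ofReal_norm]; exact ENNReal.ofReal_le_ofReal (hvC w)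
  calc _ ≤ ∫⁻ w, ‖V w‖ₑ ^ 2 * ENNReal.ofReal C ^ 2
        ∂((β.plancherelMeasure.restrict S).prod volume) :=
        lintegral_mono fun w => by gcongr; exact h1 _
    _ < ∞ := by
      rw [lintegral_mul_const _ (hV.enorm.pow_const 2)]
      exact ENNReal.mul_lt_top ((memLp_two_iff hV2.1).1 hV2) (by simp)

/-- The matrix coefficients have the same norm as the vector. -/
theorem lintegral_sliceFourier_windowed {C : ℝ} (hS : MeasurableSet S) (hv : StronglyMeasurable v)
    (hv1 : ∀ lam ∈ S, ∫⁻ t, ‖v (lam, t)‖ₑ ^ 2 = 1) (hvC : ∀ w, ‖v w‖ ≤ C)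
    (hSf : β.plancherelMeasure S < ∞) (hV : StronglyMeasurable V)
    (hV2 : MemLp V 2 ((β.plancherelMeasure.restrict S).prod volume)) :
    ∫⁻ g : β.N, ‖sliceFourier (β.windowed S v V) (β.groupCoordInv g)‖ₑ ^ 2 =
      ∫⁻ w, ‖V w‖ₑ ^ 2 ∂((β.plancherelMeasure.restrict S).prod volume) := by
  have hw := stronglyMeasurable_windowed (β := β) hS hv hV
  have hm := stronglyMeasurable_sliceFourier hw
  rw [← β.measurePreserving_groupCoord.lintegral_comp
    (f := fun g => ‖sliceFourier (β.windowed S v V) (β.groupCoordInv g)‖ₑ ^ 2)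
    ((hm.enorm.pow_const 2).comp β.measurable_groupCoordInv)]
  change ∫⁻ w, ‖sliceFourier (β.windowed S v V) w‖ₑ ^ 2 ∂(volume.prod volume) = _
  rw [lintegral_prod _ (hm.enorm.pow_const 2).aemeasurable]
  have h1 : ∀ x, ∫⁻ ξ, ‖sliceFourier (β.windowed S v V) (x, ξ)‖ₑ ^ 2 =
      ∫⁻ w, ‖V w‖ₑ ^ 2 * ‖v (w.1, w.2 - x)‖ₑ ^ 2
        ∂((β.plancherelMeasure.restrict S).prod volume) := by
    intro x
    rw [← lintegral_windowed hS hv hV x two_ne_zero]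
    simp only [sliceFourier]
    exact lintegral_fourier_enorm_sq (integrable_windowed hS hv hv1 hSf hV hV2 x)
      (memLp_windowed hS hv hvC hV hV2 x)
  simp only [h1]
  have hsh : Measurable fun p : (Fin d → ℝ) × ((Fin m → ℝ) × (Fin d → ℝ)) =>
      (p.2.1, p.2.2 - p.1) :=
    measurable_snd.fst.prodMk (measurable_snd.snd.sub measurable_fst)
  have hswap : Measurable fun p : (Fin d → ℝ) × ((Fin m → ℝ) × (Fin d → ℝ)) =>
      ‖V p.2‖ₑ ^ 2 * ‖v (p.2.1, p.2.2 - p.1)‖ₑ ^ 2 :=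
    ((hV.comp_measurable measurable_snd).enorm.pow_const 2).mul
      ((hv.comp_measurable hsh).enorm.pow_const 2)
  -- With V fixed, integrating over x first sees only the norm of the fibre of v, which is one.
  rw [lintegral_lintegral_swap hswap.aemeasurable]
  refine lintegral_congr_ae ?_
  filter_upwards [ae_fst_mem_restrict_prod hS] with w hwS
  have hsh2 : Measurable fun x : Fin d → ℝ => (w.1, w.2 - x) :=
    measurable_const.prodMk (measurable_const.sub measurable_id)
  rw [lintegral_const_mul (f := fun x => ‖v (w.1, w.2 - x)‖ₑ ^ 2) _
    ((hv.comp_measurable hsh2).enorm.pow_const 2),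
    lintegral_sub_left_eq_self (fun t => ‖v (w.1, t)‖ₑ ^ 2), hv1 w.1 hwS, mul_one]

end AdaptedBasis

/-! ### Packing of windowed functions and coefficients on the quasi-lattice -/

namespace AdaptedBasis

variable {𝔫 : Type*} [LieRing 𝔫] [LieAlgebra ℝ 𝔫] {m d : ℕ} {β : AdaptedBasis 𝔫 m d}
  {S : Set (Fin m → ℝ)} {v V : (Fin m → ℝ) × (Fin d → ℝ) → ℂ}

/-- The box excludes translations in λ by multiples of a, after which both points share the same λ
and the packing property of the window excludes translations in η by multiples of q. -/
theorem ae_windowed_packing {a : Fin m → ℝ} {q : Fin d → ℝ} (ha : ∀ i, 0 < a i)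
    (hSdet : ∀ lam ∈ S, (β.B lam).det ≠ 0) (hSa : ∀ lam ∈ S, ∀ i, 0 ≤ lam i ∧ lam i ≤ a i)
    (hpack : ∀ lam ∈ S, ∀ t t', ∀ n : Fin d → ℤ, v (lam, t) ≠ 0 → v (lam, t') ≠ 0 →
      (β.B lam)ᵀ *ᵥ t' = (β.B lam)ᵀ *ᵥ t + (fun i => n i * q i) → n = 0) (x : Fin d → ℝ) :
    ∀ᵐ ξ : (Fin m → ℝ) × (Fin d → ℝ), ∀ n : (Fin m → ℤ) × (Fin d → ℤ), n ≠ 0 →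
      β.windowed S v V (x, ξ) = 0 ∨
      β.windowed S v V (x, ξ + (fun i => n.1 i * a i, fun j => n.2 j * q j)) = 0 := by
  have hne1 : ∀ (i : Fin m) (r : ℝ), ∀ᵐ lam : Fin m → ℝ, lam i ≠ r := fun i r =>
    Measure.ae_eval_ne (α := fun _ => ℝ) (fun _ => volume) i r
  have hbd : ∀ᵐ lam : Fin m → ℝ, ∀ i, lam i ≠ 0 ∧ lam i ≠ a i :=
    ae_all_iff.2 fun i => (hne1 i 0).and (hne1 i (a i))
  have hne : ∀ ξ : (Fin m → ℝ) × (Fin d → ℝ), β.windowed S v V (x, ξ) ≠ 0 →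
      ξ.1 ∈ S ∧ v (ξ.1, (β.dualCoordInv ξ).2 - x) ≠ 0 := by
    intro ξ hξ
    simp only [windowed] at hξ
    refine ⟨?_, right_ne_zero_of_mul (right_ne_zero_of_mul hξ)⟩
    by_contra h
    simp [h] at hξ
  have hbd' : ∀ᵐ ξ : (Fin m → ℝ) × (Fin d → ℝ), ∀ i, ξ.1 i ≠ 0 ∧ ξ.1 i ≠ a i :=
    Measure.quasiMeasurePreserving_fst.ae hbd
  filter_upwards [hbd'] with ξ hξ n hn
  by_contra! hcon
  obtain ⟨h1, h1'⟩ := hne _ hcon.1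
  obtain ⟨h2, h2'⟩ := hne _ hcon.2
  obtain ⟨lam, η⟩ := ξ
  obtain ⟨n₁, n₂⟩ := n
  simp only [Prod.mk_add_mk] at h1 h1' h2 h2' hξ
  -- S may touch opposite faces of the closed box. Off these null faces λ is interior, which gives
  -- |n₁ i| < 1.
  have hn1 : n₁ = 0 := by
    funext i
    have h3 := hSa _ h1 i
    have h4 := hSa _ h2 i
    have h5 := hξ i
    have h6 := ha i
    have h7 : 0 < lam i := lt_of_le_of_ne h3.1 (Ne.symm h5.1)
    have h8 : lam i < a i := lt_of_le_of_ne h3.2 h5.2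
    simp only [Pi.add_apply] at h4
    have h9 : (n₁ i : ℝ) < 1 := by nlinarith
    have h10 : (-1 : ℝ) < n₁ i := by nlinarith
    have h11 : n₁ i < 1 := by exact_mod_cast h9
    have h12 : -1 < n₁ i := by exact_mod_cast h10
    simp only [Pi.zero_apply]
    omega
  have hz : (fun i => (n₁ i : ℝ) * a i) = 0 := by
    funext i; simp [hn1]
  rw [hz, add_zero] at h2 h2'
  have hd := hSdet lam h1
  have e1 := congrArg Prod.snd (β.dualCoord_dualCoordInv (w := (lam, η)) hd)
  have e2 := congrArg Prod.snd
    (β.dualCoord_dualCoordInv (w := (lam, η + fun j => (n₂ j : ℝ) * q j)) hd)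
  -- Both arguments of v are shifted by the same x, which cancels in the difference.
  have hn2 := hpack lam h1 _ _ n₂ h1' h2' (by
    rw [Matrix.mulVec_sub, Matrix.mulVec_sub]
    refine Eq.trans (congrArg (· - _) e2) (Eq.trans ?_ (congrArg (· - _ + _) e1).symm)
    exact (sub_add_eq_add_sub _ _ _).symm)
  exact hn (Prod.ext hn1 hn2)

/-- The coefficients along the quasi-lattice have the same norm as the vector. -/
theorem tsum_sliceFourier_windowed {C : ℝ} {a : Fin m → ℝ} {q b : Fin d → ℝ}
    (ha : ∀ i, 0 < a i) (hq : ∀ i, 0 < q i) (hS : MeasurableSet S) (hv : StronglyMeasurable v)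
    (hv1 : ∀ lam ∈ S, ∫⁻ t, ‖v (lam, t)‖ₑ ^ 2 = 1) (hvC : ∀ w, ‖v w‖ ≤ C)
    (hSf : β.plancherelMeasure S < ∞)
    (hSdet : ∀ lam ∈ S, (β.B lam).det ≠ 0) (hSa : ∀ lam ∈ S, ∀ i, 0 ≤ lam i ∧ lam i ≤ a i)
    (hpack : ∀ lam ∈ S, ∀ t t', ∀ n : Fin d → ℤ, v (lam, t) ≠ 0 → v (lam, t') ≠ 0 →
      (β.B lam)ᵀ *ᵥ t' = (β.B lam)ᵀ *ᵥ t + (fun i => n i * q i) → n = 0)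
    (hsum : ∀ lam ∈ S, ∀ᵐ t : Fin d → ℝ, ∑' p : Fin d → ℤ, ‖v (lam, t - fun i => p i / b i)‖ₑ ^ 2 =
      ENNReal.ofReal (∏ i, b i))
    (hV : StronglyMeasurable V)
    (hV2 : MemLp V 2 ((β.plancherelMeasure.restrict S).prod volume)) :
    ∑' p : Fin d → ℤ, ∑' n : (Fin m → ℤ) × (Fin d → ℤ),
      ‖sliceFourier (β.windowed S v V)
        (fun i => p i / b i, (fun i => n.1 i / a i, fun j => n.2 j / q j))‖ₑ ^ 2 =
      ENNReal.ofReal ((∏ i, a i) * ∏ j, q j) * (ENNReal.ofReal (∏ i, b i) *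
        ∫⁻ w, ‖V w‖ₑ ^ 2 ∂((β.plancherelMeasure.restrict S).prod volume)) := by
  have h1 : ∀ x, ∑' n : (Fin m → ℤ) × (Fin d → ℤ), ‖sliceFourier (β.windowed S v V)
        (x, (fun i => n.1 i / a i, fun j => n.2 j / q j))‖ₑ ^ 2 =
      ENNReal.ofReal ((∏ i, a i) * ∏ j, q j) *
        ∫⁻ w, ‖V w‖ₑ ^ 2 * ‖v (w.1, w.2 - x)‖ₑ ^ 2
          ∂((β.plancherelMeasure.restrict S).prod volume) := by
    intro x
    rw [← lintegral_windowed hS hv hV x two_ne_zero, ← tsum_enorm_sq_fourier_prod ha hq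
      (h := fun ζ => β.windowed S v V (x, ζ))
      ((stronglyMeasurable_windowed hS hv hV).comp_measurable measurable_prodMk_left)
      (integrable_windowed hS hv hv1 hSf hV hV2 x) (memLp_windowed hS hv hvC hV hV2 x)
      (ae_windowed_packing ha hSdet hSa hpack x)]
    refine tsum_congr fun n => ?_
    simp only [sliceFourier, prodChar_comm]
  simp only [h1]
  rw [ENNReal.tsum_mul_left]
  congr 1
  have hm : ∀ x : Fin d → ℝ, Measurable fun w : (Fin m → ℝ) × (Fin d → ℝ) =>
      ‖V w‖ₑ ^ 2 * ‖v (w.1, w.2 - x)‖ₑ ^ 2 := fun x =>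
    (hV.enorm.pow_const 2).mul ((hv.comp_measurable (measurable_shift x)).enorm.pow_const 2)
  rw [← lintegral_tsum fun p => (hm _).aemeasurable,
    ← lintegral_const_mul _ (hV.enorm.pow_const 2)]
  simp only [ENNReal.tsum_mul_left]
  have hm2 : Measurable fun w : (Fin m → ℝ) × (Fin d → ℝ) =>
      ∑' p : Fin d → ℤ, ‖v (w.1, w.2 - fun i => p i / b i)‖ₑ ^ 2 :=
    Measurable.tsum fun p =>
      (hv.comp_measurable (measurable_shift _)).enorm.pow_const 2
  -- Tiling makes the sum over p of the squared translates of the window constant, so summing over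
  -- the X-part of the quasi-lattice removes the window.
  have hae : ∀ᵐ w ∂((β.plancherelMeasure.restrict S).prod (volume : Measure (Fin d → ℝ))),
      ∑' p : Fin d → ℤ, ‖v (w.1, w.2 - fun i => p i / b i)‖ₑ ^ 2 =
        ENNReal.ofReal (∏ i, b i) := by
    refine (Measure.ae_prod_iff_ae_ae (measurableSet_eq_fun hm2 measurable_const)).2 ?_
    filter_upwards [ae_restrict_mem hS] with lam hlam
    exact hsum lam hlam
  refine lintegral_congr_ae ?_
  filter_upwards [hae] with w hw
  rw [hw, mul_comm]

end AdaptedBasis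

/-! ### The band-limited space as L²(S × ℝ^d), and its matrix coefficients -/

namespace AdaptedBasis

variable {𝔫 : Type*} [LieRing 𝔫] [LieAlgebra ℝ 𝔫] {m d : ℕ} (β : AdaptedBasis 𝔫 m d)
  {S : Set (Fin m → ℝ)} {U v : (Fin m → ℝ) × (Fin d → ℝ) → ℂ}

/-- The isometry of `L²(S × ℝ^d)` onto the multiplicity free band-limited space. -/
noncomputable def bandLimited (hS : MeasurableSet S) (hU : StronglyMeasurable U)
    (hU1 : ∀ lam ∈ S, ∫⁻ s, ‖U (lam, s)‖ₑ ^ 2 = 1) :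
    Lp ℂ 2 ((β.plancherelMeasure.restrict S).prod (volume : Measure (Fin d → ℝ))) →ₗᵢ[ℂ] β.L2N :=
  β.plancherel.symm.toLinearIsometry.comp
    (tensorMap β.plancherelMeasure (volume : Measure (Fin d → ℝ)) hS hU hU1)

variable (hS : MeasurableSet S) (hU : StronglyMeasurable U)
    (hU1 : ∀ lam ∈ S, ∫⁻ s, ‖U (lam, s)‖ₑ ^ 2 = 1)

theorem plancherel_bandLimited
    (V : Lp ℂ 2 ((β.plancherelMeasure.restrict S).prod (volume : Measure (Fin d → ℝ)))) :
    β.plancherel (β.bandLimited hS hU hU1 V) =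
      tensorMap β.plancherelMeasure (volume : Measure (Fin d → ℝ)) hS hU hU1 V :=
  β.plancherel.apply_symm_apply _

theorem memMultiplicityFree_iff {u : (Fin m → ℝ) → L2R d}
    (hUu : ∀ lam, (fun s => U (lam, s)) =ᵐ[volume] u lam) (K : β.HSField) :
    β.MemMultiplicityFree S u K ↔
      ∃ V, tensorMap β.plancherelMeasure (volume : Measure (Fin d → ℝ)) hS hU hU1 V = K := by
  refine Iff.trans ?_ (mem_range_tensorMap_iff hS hU hU1 K).symm
  have h : ∀ (lam : Fin m → ℝ) (w : L2R d),
      (fun ts : (Fin d → ℝ) × (Fin d → ℝ) => w ts.1 * (starRingEnd ℂ) (u lam ts.2)) =ᵐ[volume]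
        fun ts => w ts.1 * (starRingEnd ℂ) (U (lam, ts.2)) := by
    intro lam w
    have h1 : ∀ᵐ ts : (Fin d → ℝ) × (Fin d → ℝ), U (lam, ts.2) = u lam ts.2 :=
      Measure.quasiMeasurePreserving_snd.ae (hUu lam)
    filter_upwards [h1] with ts hts
    rw [hts]
  refine eventually_congr (Eventually.of_forall fun lam => and_congr_left' ?_)
  refine imp_congr_right fun _ => exists_congr fun w => ?_
  exact ⟨fun hw => EventuallyEq.trans hw (h lam w), fun hw => EventuallyEq.trans hw (h lam w).symm⟩

theorem memLp_translate (hS : MeasurableSet S) (hv : StronglyMeasurable v)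
    (hv1 : ∀ lam ∈ S, ∫⁻ t, ‖v (lam, t)‖ₑ ^ 2 = 1) (hSf : β.plancherelMeasure S < ∞) (g : β.N) :
    MemLp (fun w : (Fin m → ℝ) × (Fin d → ℝ) => β.phase w.1 g w.2 * v (w.1, w.2 - N.xc g)) 2
      ((β.plancherelMeasure.restrict S).prod volume) := by
  have hp : Measurable fun w : (Fin m → ℝ) × (Fin d → ℝ) => β.phase w.1 g w.2 := by
    have h : Measurable fun w : (Fin m → ℝ) × (Fin d → ℝ) => (w.1, (g, w.2)) :=
      measurable_fst.prodMk (measurable_const.prodMk measurable_snd)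
    have h2 := β.measurable_phase.comp h
    simp only [Function.comp_def] at h2
    exact h2
  have h := memLp_window_shift (β := β) hS hv hv1 hSf (N.xc g)
  exact h.of_le (hp.aestronglyMeasurable.mul h.1)
    (Eventually.of_forall fun w => by rw [norm_mul, norm_phase, one_mul])

theorem stronglyMeasurable_translate (hv : StronglyMeasurable v) (g : β.N) :
    StronglyMeasurable fun w : (Fin m → ℝ) × (Fin d → ℝ) =>
      β.phase w.1 g w.2 * v (w.1, w.2 - N.xc g) := by
  have h : Measurable fun w : (Fin m → ℝ) × (Fin d → ℝ) => (w.1, (g, w.2)) :=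
    measurable_fst.prodMk (measurable_const.prodMk measurable_snd)
  have h2 := β.measurable_phase.comp h
  simp only [Function.comp_def] at h2
  exact h2.stronglyMeasurable.mul (hv.comp_measurable (measurable_shift _))

/-- Left translation acts on kernels through t alone, so it passes through the tensor product with
U. -/
theorem leftReg_bandLimited (hv : StronglyMeasurable v)
    (hv1 : ∀ lam ∈ S, ∫⁻ t, ‖v (lam, t)‖ₑ ^ 2 = 1) (hSf : β.plancherelMeasure S < ∞)
    {V₀ : Lp ℂ 2 ((β.plancherelMeasure.restrict S).prod (volume : Measure (Fin d → ℝ)))}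
    (hV₀ : V₀ =ᵐ[(β.plancherelMeasure.restrict S).prod volume] v) (g : β.N) :
    β.leftReg g (β.bandLimited hS hU hU1 V₀) =
      β.bandLimited hS hU hU1 (β.memLp_translate hS hv hv1 hSf g).toLp := by
  apply β.plancherel.injective
  rw [plancherel_leftReg, plancherel_bandLimited, plancherel_bandLimited]
  refine Lp.ext ((β.kernelLeftReg_ae g _).trans ?_)
  have h1 := tensorMap_ae hS hU hU1 (β.stronglyMeasurable_translate hv g)
    (β.memLp_translate hS hv hv1 hSf g).coeFn_toLp
  have h2 := (β.measurePreserving_kernelShift (N.xc g)).quasiMeasurePreserving.ae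
    (tensorMap_ae hS hU hU1 hv hV₀)
  refine EventuallyEq.trans ?_ (EventuallyEq.symm h1)
  filter_upwards [h2] with w hw
  rw [hw]
  simp only [tensorFun]
  ring

/-- In the variables (λ, η) the phase of π_λ(g) is the character at (z, y), so the inner product
over S × ℝ^d becomes a Fourier integral. Both norm computations, over N and over the quasi-lattice,
rest on this. -/
theorem inner_leftReg_bandLimited (hv : StronglyMeasurable v)
    (hv1 : ∀ lam ∈ S, ∫⁻ t, ‖v (lam, t)‖ₑ ^ 2 = 1) (hSf : β.plancherelMeasure S < ∞)
    {V₀ : Lp ℂ 2 ((β.plancherelMeasure.restrict S).prod (volume : Measure (Fin d → ℝ)))}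
    (hV₀ : V₀ =ᵐ[(β.plancherelMeasure.restrict S).prod volume] v) (g : β.N)
    (V : Lp ℂ 2 ((β.plancherelMeasure.restrict S).prod (volume : Measure (Fin d → ℝ)))) :
    inner ℂ (β.leftReg g (β.bandLimited hS hU hU1 V₀)) (β.bandLimited hS hU hU1 V) =
      (starRingEnd ℂ) (sliceFourier (β.windowed S v V) (β.groupCoordInv g)) := by
  rw [β.leftReg_bandLimited hS hU hU1 hv hv1 hSf hV₀, LinearIsometry.inner_map_map,
    ← inner_conj_symm]
  congr 1
  rw [L2.inner_def]
  have h1 : ∫ w, inner ℂ (V w) ((β.memLp_translate hS hv hv1 hSf g).toLp _ w)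
      ∂((β.plancherelMeasure.restrict S).prod volume) =
      ∫ w, β.phase w.1 g w.2 * ((starRingEnd ℂ) (V w) * v (w.1, w.2 - N.xc g))
        ∂((β.plancherelMeasure.restrict S).prod volume) := by
    refine integral_congr_ae ?_
    filter_upwards [(β.memLp_translate hS hv hv1 hSf g).coeFn_toLp] with w hw
    rw [hw, RCLike.inner_apply]
    ring
  rw [h1, integral_restrict_prod hS, sliceFourier,
    ← integral_comp_of_measurePreserving β.measurePreserving_dualCoord]
  · refine integral_congr_ae ?_
    filter_upwards [Measure.quasiMeasurePreserving_fst.ae β.ae_plancherel_det_ne_zero] with w hw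
    have h2 := β.phase_groupCoord w.1 (N.xc g) w.2 (N.zc g, N.yc g)
    have h3 : β.groupCoord (N.xc g, (N.zc g, N.yc g)) = g := rfl
    rw [h3] at h2
    simp only [groupCoordInv]
    rw [show β.dualCoord w = β.dualCoord (w.1, w.2) from rfl, windowed_dualCoord hw,
      prodChar_comm, ← h2]
    ring
  · have h4 : Continuous fun ζ => prodChar (β.groupCoordInv g).2 ζ :=
      continuous_prodChar.comp (continuous_const.prodMk continuous_id)
    exact h4.aestronglyMeasurable.mul ((stronglyMeasurable_windowed hS hv
      (Lp.stronglyMeasurable V)).comp_measurable measurable_prodMk_left).aestronglyMeasurable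

end AdaptedBasis

/-! ### Isometries and orthonormal bases from Parseval identities -/

section Frames

variable {E : Type*} [NormedAddCommGroup E] [InnerProductSpace ℂ E]

theorem exists_linearIsometry_Lp {α : Type*} [MeasurableSpace α] {μ : Measure α} {e : α → E}
    (hm : ∀ x, AEStronglyMeasurable (fun g => inner ℂ (e g) x) μ)
    (h : ∀ x, ∫⁻ g, ‖inner ℂ (e g) x‖ₑ ^ 2 ∂μ = ‖x‖ₑ ^ 2) :
    ∃ W : E →ₗᵢ[ℂ] Lp ℂ 2 μ, ∀ x, W x =ᵐ[μ] fun g => inner ℂ (e g) x := by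
  have hL : ∀ x, MemLp (fun g => inner ℂ (e g) x) 2 μ := fun x => by
    rw [memLp_two_iff (hm x), h]
    simp [ENNReal.pow_lt_top_iff]
  refine ⟨
    { toFun := fun x => (hL x).toLp
      map_add' := fun x y => by
        rw [← MemLp.toLp_add]
        exact MemLp.toLp_congr _ _ (Eventually.of_forall fun g => inner_add_right _ _ _)
      map_smul' := fun c x => by
        rw [RingHom.id_apply, ← MemLp.toLp_const_smul]
        exact MemLp.toLp_congr _ _ (Eventually.of_forall fun g => inner_smul_right _ _ _)
      norm_map' := fun x => by
        refine norm_eq_of_enorm_sq_eq ?_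
        simp only [LinearMap.coe_mk, AddHom.coe_mk]
        rw [enorm_sq_toLp, h] }, fun x => (hL x).coeFn_toLp⟩

variable {ι : Type*} {e : ι → E} (h : ∀ x, ∑' i, ‖inner ℂ (e i) x‖ₑ ^ 2 = ‖x‖ₑ ^ 2)

include h

theorem exists_linearIsometry_lp :
    ∃ D : E →ₗᵢ[ℂ] lp (fun _ : ι => ℂ) 2, ∀ x i, D x i = inner ℂ (e i) x := by
  have hL : ∀ x, Memℓp (fun i => inner ℂ (e i) x) 2 := fun x =>
    memlp_two_of_tsum_enorm_sq (by rw [h]; simp)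
  refine ⟨
    { toFun := fun x => ⟨fun i => inner ℂ (e i) x, hL x⟩
      map_add' := fun x y => by
        ext i
        exact inner_add_right _ _ _
      map_smul' := fun c x => by
        ext i
        exact inner_smul_right _ _ _
      norm_map' := fun x => by
        refine norm_eq_of_enorm_sq_eq ?_
        simp only [LinearMap.coe_mk, AddHom.coe_mk]
        rw [enorm_sq_lp_two]
        exact h x }, fun x i => rfl⟩

/-- A Parseval frame of unit vectors is an orthonormal basis. -/
theorem exists_hilbertBasis_of_parseval [CompleteSpace E] (h1 : ∀ i, ‖e i‖ = 1) :
    ∃ b : HilbertBasis ι ℂ E, ∀ i, b i = e i := by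
  classical
  have hon : Orthonormal ℂ e := by
    refine ⟨h1, fun i j hij => ?_⟩
    -- In the identity for e j, its own term already equals the total 1, so all other terms vanish.
    have h2 := h (e j)
    rw [ENNReal.tsum_eq_add_tsum_ite j] at h2
    have h3 : ‖inner ℂ (e j) (e j)‖ₑ ^ 2 = 1 := by
      rw [inner_self_eq_norm_sq_to_K, h1]
      simp
    have h4 : ‖e j‖ₑ ^ 2 = 1 := by
      rw [← ofReal_norm, h1]; simp
    rw [h3, h4] at h2
    have h5 := (ENNReal.add_right_inj ENNReal.one_ne_top).1 (h2.trans (add_zero 1).symm)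
    have h6 := ENNReal.tsum_eq_zero.1 h5 i
    simpa [hij] using h6
  refine ⟨HilbertBasis.mkOfOrthogonalEqBot hon ?_, fun i => by
    rw [HilbertBasis.coe_mkOfOrthogonalEqBot]⟩
  rw [Submodule.eq_bot_iff]
  intro x hx
  have h2 : ∀ i, inner ℂ (e i) x = 0 := fun i =>
    hx (e i) (Submodule.subset_span ⟨i, rfl⟩)
  have h3 := h x
  simp only [h2] at h3
  simpa using h3.symm

end Frames

/-! ### The window, finiteness of μ(S), and the index set of the quasi-lattice -/

namespace AdaptedBasis

variable {𝔫 : Type*} [LieRing 𝔫] [LieAlgebra ℝ 𝔫] {m d : ℕ} (β : AdaptedBasis 𝔫 m d)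

/-- The window is √(∏ b) on a measurable family of tiles for the matrices B(λ)ᵀ. Each tile has
volume 1 / ∏ b, so the fibres have norm one, and exactly one translate by p/b is nonzero at almost
every t. -/
theorem exists_window {q b : Fin d → ℝ} (hq : ∀ i, 0 < q i) (hb : ∀ i, 0 < b i)
    {S : Set (Fin m → ℝ)} (hSdet : ∀ lam ∈ S, (β.B lam).det ≠ 0)
    (hSle : ∀ lam ∈ S, |(β.B lam).det| ≤ (∏ i, b i) * ∏ i, q i) :
    ∃ (v : (Fin m → ℝ) × (Fin d → ℝ) → ℂ) (C : ℝ), StronglyMeasurable v ∧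
      (∀ lam ∈ S, ∫⁻ t, ‖v (lam, t)‖ₑ ^ 2 = 1) ∧ (∀ w, ‖v w‖ ≤ C) ∧
      (∀ lam ∈ S, ∀ t t', ∀ n : Fin d → ℤ, v (lam, t) ≠ 0 → v (lam, t') ≠ 0 →
        (β.B lam)ᵀ *ᵥ t' = (β.B lam)ᵀ *ᵥ t + (fun i => n i * q i) → n = 0) ∧
      ∀ lam ∈ S, ∀ᵐ t : Fin d → ℝ, ∑' p : Fin d → ℤ, ‖v (lam, t - fun i => p i / b i)‖ₑ ^ 2 =
        ENNReal.ofReal (∏ i, b i) := by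
  classical
  set M : (Fin m → ℝ) → Matrix (Fin d) (Fin d) ℝ :=
    fun lam => if (β.B lam).det = 0 then 1 else (β.B lam)ᵀ with hM
  have hMS : ∀ lam ∈ S, M lam = (β.B lam)ᵀ := fun lam h => if_neg (hSdet lam h)
  have hMm : ∀ i j, Measurable fun lam => M lam i j := by
    intro i j
    have : (fun lam => M lam i j) = fun lam =>
        if (β.B lam).det = 0 then (1 : Matrix (Fin d) (Fin d) ℝ) i j else β.B lam j i := by
      funext lam
      simp only [hM]
      split_ifs <;> rfl
    rw [this]
    exact Measurable.ite (measurableSet_eq_fun β.continuous_det_B.measurable measurable_const)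
      measurable_const (β.measurable_B_apply j i)
  have hMdet : ∀ lam, (M lam).det ≠ 0 := by
    intro lam
    simp only [hM]
    split_ifs with h
    · simp
    · rwa [Matrix.det_transpose]
  obtain ⟨E, hE, hpack, htile⟩ := exists_measurable_tile hMm hMdet hb hq
  have hpos : 0 < ∏ i, b i := Finset.prod_pos fun i _ => hb i
  set c : ℂ := (Real.sqrt (∏ i, b i) : ℂ) with hc
  have hcn : ‖c‖ₑ ^ 2 = ENNReal.ofReal (∏ i, b i) := by
    rw [← ofReal_norm, ← ENNReal.ofReal_pow (norm_nonneg _), hc, Complex.norm_real,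
      Real.norm_eq_abs, sq_abs, Real.sq_sqrt hpos.le]
  have hvE : ∀ w, ‖E.indicator (fun _ => c) w‖ₑ ^ 2 =
      E.indicator (fun _ => ENNReal.ofReal (∏ i, b i)) w := by
    intro w
    by_cases h : w ∈ E <;> simp [h, hcn]
  have hle : ∀ lam ∈ S, |(M lam).det| ≤ (∏ i, b i) * ∏ i, q i := fun lam h => by
    rw [hMS lam h, Matrix.det_transpose]; exact hSle lam h
  have hmem : ∀ w, E.indicator (fun _ => c) w ≠ 0 → w ∈ E := fun w h =>
    Set.mem_of_indicator_ne_zero h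
  refine ⟨E.indicator fun _ => c, ‖c‖, stronglyMeasurable_const.indicator hE, ?_, ?_, ?_, ?_⟩
  · intro lam h
    simp only [hvE]
    have h1 : ∀ t, E.indicator (fun _ => ENNReal.ofReal (∏ i, b i)) (lam, t) =
        {t | (lam, t) ∈ E}.indicator (fun _ => ENNReal.ofReal (∏ i, b i)) t := fun t => rfl
    simp only [h1]
    have hEl : MeasurableSet {t | (lam, t) ∈ E} := measurable_prodMk_left hE
    rw [lintegral_indicator_const hEl, ((htile lam (hle lam h)).2),
      ← ENNReal.ofReal_mul hpos.le, mul_inv_cancel₀ hpos.ne', ENNReal.ofReal_one]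
  · intro w
    exact norm_indicator_le_norm_self (fun _ => c) w
  · intro lam h t t' n ht ht' htt
    rw [← hMS lam h] at htt
    exact hpack lam t t' n (hmem _ ht) (hmem _ ht') htt
  · intro lam h
    filter_upwards [(htile lam (hle lam h)).1] with t ht
    obtain ⟨n₀, hn₀⟩ := ht
    simp only [hvE]
    rw [tsum_eq_single n₀]
    · rw [Set.indicator_of_mem ((hn₀ n₀).2 rfl)]
    · intro n hn
      rw [Set.indicator_of_notMem]
      exact fun h => hn ((hn₀ n).1 h)

theorem plancherelMeasure_lt_top {S : Set (Fin m → ℝ)} (hS : MeasurableSet S) {a : Fin m → ℝ}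
    {r : ℝ} (hSa : ∀ lam ∈ S, ∀ i, 0 ≤ lam i ∧ lam i ≤ a i)
    (hSle : ∀ lam ∈ S, |(β.B lam).det| ≤ r) : β.plancherelMeasure S < ∞ := by
  rw [plancherelMeasure, withDensity_apply _ hS]
  calc _ ≤ ∫⁻ _ in S, ENNReal.ofReal r :=
        setLIntegral_mono' hS fun lam h => ENNReal.ofReal_le_ofReal (hSle lam h)
    _ = ENNReal.ofReal r * volume S := setLIntegral_const _ _
    _ < ∞ := by
      refine ENNReal.mul_lt_top ENNReal.ofReal_lt_top ?_
      refine lt_of_le_of_lt (measure_mono (t := Set.Icc 0 a) fun lam h => ?_)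
        isCompact_Icc.measure_lt_top
      exact ⟨fun i => (hSa lam h i).1, fun i => (hSa lam h i).2⟩

/-- The parametrization of the quasi-lattice by the integer coordinates. -/
noncomputable def quasiLatticeEquiv {a : Fin m → ℝ} {q b : Fin d → ℝ}
    (ha : ∀ j, 0 < a j) (hq : ∀ j, 0 < q j) (hb : ∀ j, 0 < b j) :
    (Fin d → ℤ) × ((Fin m → ℤ) × (Fin d → ℤ)) ≃ β.quasiLattice a q b :=
  Equiv.ofBijective
    (fun n => ⟨N.mk (fun j => n.2.1 j / a j) (fun j => n.2.2 j / q j) (fun j => n.1 j / b j),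
      n.2.1, n.2.2, n.1, rfl⟩) <| by
    have key : ∀ {k : ℕ} {r : Fin k → ℝ} (_ : ∀ j, 0 < r j) {n n' : Fin k → ℤ},
        (fun j => (n j : ℝ) / r j) = (fun j => (n' j : ℝ) / r j) → n = n' := by
      intro k r hr n n' hn
      funext j
      have h1 := congrFun hn j
      have h2 := (div_left_inj' (hr j).ne').1 h1
      exact_mod_cast h2
    constructor
    · rintro ⟨p, k, l⟩ ⟨p', k', l'⟩ h
      have h1 := congrArg Subtype.val h
      have hz := key ha (congrArg N.zc h1)
      have hy := key hq (congrArg N.yc h1)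
      have hx := key hb (congrArg N.xc h1)
      simp only at hz hy hx
      rw [hz, hy, hx]
    · rintro ⟨g, k, l, p, rfl⟩
      exact ⟨(p, (k, l)), rfl⟩

end AdaptedBasis

end BandLimited

/-! ### The main theorem -/

theorem mainTheorem4 {𝔫 : Type*} [LieRing 𝔫] [LieAlgebra ℝ 𝔫] {m d : ℕ} (hd : 0 < d)
    (β : AdaptedBasis 𝔫 m d)
    (a : Fin m → ℝ) (q b : Fin d → ℝ)
    (ha : ∀ j, 0 < a j) (hq : ∀ j, 0 < q j) (hb : ∀ j, 0 < b j)
    (I S : Set (Fin m → ℝ)) (hI : MeasurableSet I)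
    (hI_sub : I ⊆ {lam ∈ β.crossSection | ∀ j, 0 ≤ lam j ∧ lam j ≤ a j})
    (hS : S = {lam ∈ I | |(β.B lam).det| / ((∏ j, b j) * ∏ j, q j) ≤ 1})
    (hbqa : (∏ j, b j) * (∏ j, q j) * ∏ j, a j = 1)
    (u : (Fin m → ℝ) → L2R d) (hu : MeasureTheory.StronglyMeasurable u)
    (hu_norm : ∀ lam ∈ S, ‖u lam‖ = 1)
    (H : Submodule ℂ β.L2N)
    (hH : ∀ f : β.L2N, f ∈ H ↔
      ∃ K : β.HSField, β.IsPlancherelTransform f K ∧ β.MemMultiplicityFree S u K) :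
    ∃ φ : β.L2N, β.IsContinuousWavelet H φ ∧
      (∃ D : H →ₗᵢ[ℂ] lp (fun _ : β.quasiLattice a q b => ℂ) 2,
        ∀ (ψ : H) (γ : β.quasiLattice a q b),
          D ψ γ = inner ℂ (β.leftReg γ φ) (ψ : β.L2N)) ∧
      (β.plancherelMeasure S = 1 →
        ∃ e : HilbertBasis (β.quasiLattice a q b) ℂ H,
          ∀ γ : β.quasiLattice a q b, (e γ : β.L2N) = β.leftReg γ φ) := by
  have hB : 0 < ∏ j, b j := Finset.prod_pos fun j _ => hb j
  have hQ : 0 < ∏ j, q j := Finset.prod_pos fun j _ => hq j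
  have hSI : ∀ lam ∈ S, lam ∈ I ∧ |(β.B lam).det| / ((∏ j, b j) * ∏ j, q j) ≤ 1 := by
    intro lam h
    rwa [hS] at h
  have hSdet : ∀ lam ∈ S, (β.B lam).det ≠ 0 := fun lam h => (hI_sub (hSI lam h).1).1
  have hSa : ∀ lam ∈ S, ∀ i, 0 ≤ lam i ∧ lam i ≤ a i := fun lam h => (hI_sub (hSI lam h).1).2
  have hSle : ∀ lam ∈ S, |(β.B lam).det| ≤ (∏ j, b j) * ∏ j, q j := fun lam h => by
    have := (hSI lam h).2
    rwa [div_le_one (mul_pos hB hQ)] at this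
  have hSm : MeasurableSet S := by
    rw [hS]
    exact hI.inter (measurableSet_le
      (β.continuous_det_B.abs.measurable.div_const _) measurable_const)
  have hSf := β.plancherelMeasure_lt_top hSm hSa hSle
  -- The field u is a measurable map into L²; kernels require a function of (λ, s).
  obtain ⟨U, hU, hUu⟩ := exists_joint_representative hu
  have hU1 : ∀ lam ∈ S, ∫⁻ s, ‖U (lam, s)‖ₑ ^ 2 = 1 := by
    intro lam h
    have h1 : ∫⁻ s, ‖U (lam, s)‖ₑ ^ 2 = ∫⁻ s, ‖u lam s‖ₑ ^ 2 :=
      lintegral_congr_ae (by filter_upwards [hUu lam] with s hs; rw [hs])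
    rw [h1, lintegral_enorm_sq_eq, ← ofReal_norm, hu_norm lam h]
    simp
  obtain ⟨v, C, hv, hv1, hvC, hpack, hsum⟩ := β.exists_window hq hb hSdet hSle
  set J := β.bandLimited hSm hU hU1 with hJ
  have hHJ : H = LinearMap.range J.toLinearMap := by
    ext f
    rw [hH, LinearMap.mem_range]
    have h1 : (∃ K : β.HSField, β.IsPlancherelTransform f K ∧ β.MemMultiplicityFree S u K) ↔
        β.MemMultiplicityFree S u (β.plancherel f) := by
      constructor
      · rintro ⟨K, hK, hKS⟩
        rwa [(β.isPlancherelTransform_iff f K).1 hK]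
      · exact fun h => ⟨_, (β.isPlancherelTransform_iff f _).2 rfl, h⟩
    rw [h1, β.memMultiplicityFree_iff hSm hU hU1 hUu]
    constructor
    · rintro ⟨V, hV⟩
      exact ⟨V, β.plancherel.injective ((β.plancherel_bandLimited hSm hU hU1 V).trans hV)⟩
    · rintro ⟨V, rfl⟩
      exact ⟨V, (β.plancherel_bandLimited hSm hU hU1 V).symm⟩
  have hHc : CompleteSpace H := by
    rw [hHJ]
    exact (J.isometry.isUniformInducing.isComplete_range).completeSpace_coe
  have hvL : MemLp v 2 ((β.plancherelMeasure.restrict S).prod volume) := by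
    simpa using AdaptedBasis.memLp_window_shift (β := β) hSm hv hv1 hSf 0
  have hcoef := fun g V => β.inner_leftReg_bandLimited hSm hU hU1 hv hv1 hSf hvL.coeFn_toLp g V
  have hleft := β.leftReg_bandLimited hSm hU hU1 hv hv1 hSf hvL.coeFn_toLp
  rw [← hJ] at hcoef hleft
  -- The wavelet is the preimage of v ⊗ u under the Plancherel transform.
  set φ := J hvL.toLp with hφ
  have hmem : ∀ g, β.leftReg g φ ∈ H := fun g => by
    rw [hleft g, hHJ]
    exact ⟨_, rfl⟩
  have hsurj : ∀ ψ : H, ∃ V, J V = ψ := fun ψ => by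
    exact LinearMap.mem_range.1 (hHJ.le ψ.2)
  have hconj : ∀ z : ℂ, ‖(starRingEnd ℂ) z‖ₑ = ‖z‖ₑ := fun z => by
    rw [← ofReal_norm, RCLike.norm_conj, ofReal_norm]
  have hnorm : ∀ V, ∫⁻ w, ‖V w‖ₑ ^ 2 ∂((β.plancherelMeasure.restrict S).prod volume) =
      ‖J V‖ₑ ^ 2 := fun V => by
    rw [lintegral_enorm_sq_eq, ← ofReal_norm, ← ofReal_norm, J.norm_map]
  have hcm : ∀ ψ : H, AEStronglyMeasurable
      (fun g : β.N => inner ℂ (⟨β.leftReg g φ, hmem g⟩ : H) ψ) := by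
    intro ψ
    obtain ⟨V, hV⟩ := hsurj ψ
    simp only [Submodule.coe_inner, ← hV, hcoef]
    exact (Complex.continuous_conj.comp_stronglyMeasurable
      ((stronglyMeasurable_sliceFourier (AdaptedBasis.stronglyMeasurable_windowed hSm hv
        (Lp.stronglyMeasurable V))).comp_measurable
        β.measurable_groupCoordInv)).aestronglyMeasurable
  have hcn : ∀ ψ : H, ∫⁻ g : β.N, ‖inner ℂ (⟨β.leftReg g φ, hmem g⟩ : H) ψ‖ₑ ^ 2 = ‖ψ‖ₑ ^ 2 := by
    intro ψ
    obtain ⟨V, hV⟩ := hsurj ψ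
    simp only [Submodule.coe_inner, ← hV, hcoef, hconj]
    rw [AdaptedBasis.lintegral_sliceFourier_windowed hSm hv hv1 hvC hSf (Lp.stronglyMeasurable V)
      (Lp.memLp V), hnorm, hV]
    rfl
  have hparseval : ∀ ψ : H, ∑' γ : β.quasiLattice a q b,
      ‖inner ℂ (⟨β.leftReg γ φ, hmem γ⟩ : H) ψ‖ₑ ^ 2 = ‖ψ‖ₑ ^ 2 := by
    intro ψ
    obtain ⟨V, hV⟩ := hsurj ψ
    simp only [Submodule.coe_inner, ← hV, hcoef, hconj]
    have h1 := AdaptedBasis.tsum_sliceFourier_windowed ha hq hSm hv hv1 hvC hSf hSdet hSa hpack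
      hsum (Lp.stronglyMeasurable V) (Lp.memLp V)
    rw [← (β.quasiLatticeEquiv ha hq hb).tsum_eq, ENNReal.tsum_prod']
    refine h1.trans ?_
    -- The period lattice contributes ∏ a ∏ q and the window ∏ b; the normalization makes the total
    -- one.
    rw [← mul_assoc, ← ENNReal.ofReal_mul
        (mul_nonneg (Finset.prod_nonneg fun i _ => (ha i).le) hQ.le), hnorm, hV,
      show ((∏ i, a i) * ∏ j, q j) * ∏ j, b j = 1 by rw [← hbqa]; ring, ENNReal.ofReal_one,
      one_mul]
    rfl
  obtain ⟨W, hW⟩ := exists_linearIsometry_Lp hcm hcn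
  simp only [Submodule.coe_inner] at hW
  refine ⟨φ, ⟨?_, W, hW⟩, exists_linearIsometry_lp hparseval,
    fun hμ => ?_⟩
  · rw [hHJ]
    exact ⟨_, rfl⟩
  · have hφ1 : ‖φ‖ = 1 := by
      have h1 : ‖φ‖ₑ ^ 2 = 1 := by
        rw [← hnorm]
        -- With unit fibres the squared norm of φ is μ(S); the shift 0 is the untranslated window.
        have h2 := AdaptedBasis.lintegral_window (β := β) hSm hv hv1 0
        simp only [sub_zero] at h2
        rw [← hμ, ← h2]
        refine lintegral_congr_ae ?_
        filter_upwards [hvL.coeFn_toLp] with w hw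
        rw [hw]
      rw [← ofReal_norm, ← ENNReal.ofReal_pow (norm_nonneg _), ENNReal.ofReal_eq_one] at h1
      exact (pow_eq_one_iff_of_nonneg (norm_nonneg φ) two_ne_zero).1 h1
    obtain ⟨e, he⟩ := exists_hilbertBasis_of_parseval hparseval fun γ =>
      ((β.leftReg γ).norm_map φ).trans hφ1
    exact ⟨e, fun γ => by rw [he]⟩
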